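/- **Setting.** For each $n$ let $\Phi_n\in\mathcal H_{A,n}\otimes\mathcal H_{B,n}$ be a unit vector in a tensor product of complex Hilbert spaces of arbitrary (possibly infinite) dimension, let $\rho_n=\mathrm{Tr}_{\mathcal H_{B,n}}|\Phi_n\rangle\langle\Phi_n|$, and put $\psi_n(s)=\log\mathrm{Tr}\,\rho_n^s=\log\sum_i p_{n,i}^s\in(-\infty,\infty]$, where $p_{n,i}$ are the positive eigenvalues of $\rho_n$ counted with multiplicity (so $\psi_n(0)$ is the logarithm of the rank of $\rho_n$). LOCC protocols consist of finitely many rounds; in each round one party performs a local measurement (given by Kraus operators) that may depend on all earlier outcomes and announces its outcome. The local systems may change, so the output systems are arbitrary Hilbert spaces $\mathcal K_A,\mathcal K_B$. A maximally entangled state of size $L\ge1$ is $\Psi=L^{-1/2}\sum_{i=1}^Le_i\otimes f_i$ with orthonormal $(e_i)$ in $\mathcal K_A$ and $(f_i)$ in $\mathcal K_B$; we write $L(\Psi)=L$. A DFLEC is a pair $(C,\Psi)$ of an LOCC operation $C$ and a maximally entangled state $\Psi$ on its output systems. A PFLEC of $\Phi$ is a two-valued LOCC instrument $I=\{I_0,I_1\}$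 with $\mathrm{Tr}\,I_1(\Phi)>0$ such that $I_1(\Phi)/\mathrm{Tr}\,I_1(\Phi)=|\Psi\rangle\langle\Psi|$ for a maximally entangled $\Psi$; we write $L(I)=L(\Psi)$. With $\log 0=-\infty$ define, as suprema in $[-\infty,\infty]$ over sequences of PFLECs $I^n$ of $\Phi_n$, respectively of DFLECs $(C^n,\Psi_n)$, $$B_P(\epsilon)=\sup\{\varliminf\tfrac1n\log L(I^n)\mid\varlimsup\mathrm{Tr}\,I^n_0(\Phi_n)\le\epsilon\},\quad B_D(\epsilon)=\sup\{\varliminf\tfrac1n\log L(\Psi_n)\mid\varliminf\langle\Psi_n|C^n(\Phi_n)|\Psi_n\rangle\ge1-\epsilon\},$$ $$B_{e,P}(r)=\sup\{\varliminf\tfrac1n\log L(I^n)\mid\varliminf\tfrac{-1}n\log\mathrm{Tr}\,I^n_0(\Phi_n)\ge r\},\quad B_{e,D}(r)=\sup\{\varliminf\tfrac1n\log L(\Psi_n)\mid\varliminf\tfrac{-1}n\log(1-\langle\Psi_n|C^n(\Phi_n)|\Psi_n\rangle)\ge r\},$$ $$B^*_{e,P}(r)=\sup\{\varliminf\tfrac1n\log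 L(I^n)\mid\varlimsup\tfrac{-1}n\log\mathrm{Tr}\,I^n_1(\Phi_n)\le r\},\quad B^*_{e,D}(r)=\sup\{\varliminf\tfrac1n\log L(\Psi_n)\mid\varlimsup\tfrac{-1}n\log\langle\Psi_n|C^n(\Phi_n)|\Psi_n\rangle\le r\}.$$ **Theorem.** Assume that the limit $\overline\psi(s)=\lim_n\frac1n\psi_n(s)\in[-\infty,\infty]$ exists for every $s\ge0$, and that $\overline\psi$ is finite and twice differentiable on $(0,1)\cup(1,\infty)$. Then the following hold. 1. The limits $\overline H_-=-\lim_{s\downarrow1}\overline\psi'(s)$ and $\overline H_+=-\lim_{s\uparrow1}\overline\psi'(s)$ exist in $\mathbb R$, and $\overline H_-\le B_D(\epsilon)=B_P(\epsilon)\le\overline H_+$ for all $0\le\epsilon<1$. 2. For all $r>0$: $B_{e,D}(r)=B_{e,P}(r)=\sup_{s>1}\frac{r+\overline\psi(s)}{1-s}$. 3. For all $r\ge0$: $B^*_{e,P}(r)=\inf_{0\le s<1}\frac{sr+\overline\psi(s)}{1-s}$. 4. Put $r_{1/2}=-\frac12\overline\psi'(\frac12)-\overline\psi(\frac12)$. For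 all $r\ge0$: $B^*_{e,D}(r)=\inf_{0\le s<1}\frac{sr+\overline\psi(s)}{1-s}$ if $r\le r_{1/2}$, and $B^*_{e,D}(r)=2\overline\psi(\frac12)+r$ if $r>r_{1/2}$. 5. For $r>0$ the infimum in 3 and 4 is a minimum if $r\le r_{1/2}$, and also if $\overline\psi$ is right-continuous at $0$ (as a function with values in $[-\infty,\infty]$). 6. The limits $\overline H_\infty=\lim_{s\to\infty}\frac{-\overline\psi(s)}{s}$ and $\lim_{s\to\infty}-\overline\psi'(s)$ exist in $\mathbb R$ and are equal, and $B_{e,D}(r)=B_{e,P}(r)=\overline H_\infty$ for all $r>0$ with $r\ge\overline H_\infty$. 7. The limit $\overline\psi'(+0)=\lim_{s\downarrow0}\overline\psi'(s)$ exists in $[-\infty,\infty)$. If $\overline\psi(0)<\infty$ and $\overline\psi$ is right-continuous at $0$, then $B^*_{e,P}(r)=\overline\psi(0)$ for all real $r\ge-\overline\psi'(+0)-\overline\psi(0)$. -/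

import Mathlib

open Filter Topology
open scoped TensorProduct ENNReal InnerProductSpace

universe u

namespace EntConc

noncomputable section

section Bipartite

variable {A B C D : Type u}
  [NormedAddCommGroup A] [InnerProductSpace ℂ A]
  [NormedAddCommGroup B] [InnerProductSpace ℂ B]
  [NormedAddCommGroup C] [InnerProductSpace ℂ C]
  [NormedAddCommGroup D] [InnerProductSpace ℂ D]

/-- The Hilbert space tensor product: the completion of the algebraic tensor product with
`⟪a ⊗ b, a' ⊗ b'⟫ = ⟪a, a'⟫ ⟪b, b'⟫`. -/
abbrev HTensor (A B : Type u) [NormedAddCommGroup A] [InnerProductSpace ℂ A]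
    [NormedAddCommGroup B] [InnerProductSpace ℂ B] : Type u :=
  UniformSpace.Completion (A ⊗[ℂ] B)

/-- The product vector `a ⊗ b`. -/
def prodVec (a : A) (b : B) : HTensor A B := ((a ⊗ₜ[ℂ] b : A ⊗[ℂ] B) : HTensor A B)

/-- The operator `S ⊗ T` on the Hilbert space tensor product. -/
def opTensor (S : A →L[ℂ] C) (T : B →L[ℂ] D) : HTensor A B →L[ℂ] HTensor C D :=
  ((UniformSpace.Completion.toComplL : (C ⊗[ℂ] D) →L[ℂ] HTensor C D) ∘L
    TensorProduct.mapL S T).extend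
      (UniformSpace.Completion.toComplL : (A ⊗[ℂ] B) →L[ℂ] HTensor A B)

/-- `a ↦ a ⊗ b`. -/
def tensorRight (b : B) : A →L[ℂ] HTensor A B :=
  (UniformSpace.Completion.toComplL : (A ⊗[ℂ] B) →L[ℂ] HTensor A B) ∘L
    (TensorProduct.mkL ℂ A B).flip b

/-- The partial inner product `⟨b|Φ⟩ ∈ A` of `Φ ∈ A ⊗ B` with `b ∈ B`: the adjoint of
`a ↦ a ⊗ b` applied to `Φ`. -/
def partialInner [CompleteSpace A] (b : B) (Φ : HTensor A B) : A :=
  ContinuousLinearMap.adjoint (tensorRight (A := A) b) Φ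

/-- The reduced density `Tr_B |Φ⟩⟨Φ| = ∑ⱼ ⟨bⱼ|Φ⟩⟨Φ|bⱼ⟩`, where `(bⱼ)` is an orthonormal (Hilbert)
basis of `B`; the series converges in norm and its sum does not depend on the basis. -/
def reducedDensity [CompleteSpace A] [CompleteSpace B] (Φ : HTensor A B) : A →L[ℂ] A :=
  ∑' j : (exists_hilbertBasis ℂ B).choose,
    InnerProductSpace.rankOne ℂ (partialInner (j : B) Φ) (partialInner (j : B) Φ)

/-- `Tr ρ ^ s = ∑ᵢ pᵢ ^ s`, the sum over the positive eigenvalues `pᵢ` of the density `ρ` counted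
with multiplicity (so for `s = 0` it is the rank of `ρ`); the value may be infinite. -/
def trPow (ρ : A →L[ℂ] A) (s : ℝ) : ℝ≥0∞ :=
  ∑' x : Set.Ioi (0 : ℝ),
    (Module.finrank ℂ (Module.End.eigenspace (ρ : A →ₗ[ℂ] A) ((x : ℝ) : ℂ)) : ℝ≥0∞) *
      ENNReal.ofReal ((x : ℝ) ^ s)

/-- A maximally entangled state of size `size` on a pair of `size`-dimensional subspaces, given by
orthonormal families spanning them. -/
structure MaxEnt (A B : Type u) [NormedAddCommGroup A] [InnerProductSpace ℂ A]
    [NormedAddCommGroup B] [InnerProductSpace ℂ B] where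
  size : ℕ
  size_pos : 0 < size
  e : Fin size → A
  f : Fin size → B
  orthonormal_e : Orthonormal ℂ e
  orthonormal_f : Orthonormal ℂ f

/-- The vector `L ^ (-1/2) ∑ᵢ eᵢ ⊗ fᵢ`. -/
def MaxEnt.vec (Ψ : MaxEnt A B) : HTensor A B :=
  (((√(Ψ.size : ℝ))⁻¹ : ℝ) : ℂ) • ∑ i, prodVec (Ψ.e i) (Ψ.f i)

/-- A local measurement with outcomes `κ`: Kraus operators with `∑ᵢ Kᵢ† Kᵢ = 1`. -/
def IsMeasurement {κ : Type u} (K : κ → (A →L[ℂ] C)) : Prop :=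
  ∀ x, HasSum (fun i => ‖K i x‖ ^ 2) (‖x‖ ^ 2)

end Bipartite

section LOCC

/-- LOCC protocols between two parties which start with the systems `HA`, `HB`.  `IsLOCC S T` says
that the family of product operators `S l ⊗ T l : HA ⊗ HB → KA ⊗ KB` is the collection of Kraus
operators of an LOCC protocol whose complete record of classical data is `l`: the protocol has
finitely many rounds, and in each round one of the parties performs a local measurement, chosen
according to the record so far, and announces its outcome to the other party. Local systems may
change in each round (ancillas may be added, subsystems may be discarded by measuring them). -/
inductive IsLOCC (HA HB : Type u)
    [NormedAddCommGroup HA] [InnerProductSpace ℂ HA] [CompleteSpace HA]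
    [NormedAddCommGroup HB] [InnerProductSpace ℂ HB] [CompleteSpace HB] :
    ∀ (KA KB ι : Type u)
      [NormedAddCommGroup KA] [InnerProductSpace ℂ KA] [CompleteSpace KA]
      [NormedAddCommGroup KB] [InnerProductSpace ℂ KB] [CompleteSpace KB],
      (ι → (HA →L[ℂ] KA)) → (ι → (HB →L[ℂ] KB)) → Prop
  | start : IsLOCC HA HB HA HB PUnit
      (fun _ => ContinuousLinearMap.id ℂ HA) (fun _ => ContinuousLinearMap.id ℂ HB)
  | alice {KA KB ι KA' : Type u} {κ : ι → Type u}
      [NormedAddCommGroup KA] [InnerProductSpace ℂ KA] [CompleteSpace KA]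
      [NormedAddCommGroup KB] [InnerProductSpace ℂ KB] [CompleteSpace KB]
      [NormedAddCommGroup KA'] [InnerProductSpace ℂ KA'] [CompleteSpace KA']
      {S : ι → (HA →L[ℂ] KA)} {T : ι → (HB →L[ℂ] KB)}
      (h : IsLOCC HA HB KA KB ι S T)
      (K : ∀ l, κ l → (KA →L[ℂ] KA')) (hK : ∀ l, IsMeasurement (K l)) :
      IsLOCC HA HB KA' KB (Σ l, κ l) (fun p => K p.1 p.2 ∘L S p.1) (fun p => T p.1)
  | bob {KA KB ι KB' : Type u} {κ : ι → Type u}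
      [NormedAddCommGroup KA] [InnerProductSpace ℂ KA] [CompleteSpace KA]
      [NormedAddCommGroup KB] [InnerProductSpace ℂ KB] [CompleteSpace KB]
      [NormedAddCommGroup KB'] [InnerProductSpace ℂ KB'] [CompleteSpace KB']
      {S : ι → (HA →L[ℂ] KA)} {T : ι → (HB →L[ℂ] KB)}
      (h : IsLOCC HA HB KA KB ι S T)
      (K : ∀ l, κ l → (KB →L[ℂ] KB')) (hK : ∀ l, IsMeasurement (K l)) :
      IsLOCC HA HB KA KB' (Σ l, κ l) (fun p => S p.1) (fun p => K p.1 p.2 ∘L T p.1)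

/-- An LOCC protocol with its final systems `KA`, `KB` and its set `ι` of classical records. -/
structure LOCC (HA HB : Type u)
    [NormedAddCommGroup HA] [InnerProductSpace ℂ HA] [CompleteSpace HA]
    [NormedAddCommGroup HB] [InnerProductSpace ℂ HB] [CompleteSpace HB] where
  KA : Type u
  KB : Type u
  [normedA : NormedAddCommGroup KA]
  [innerA : InnerProductSpace ℂ KA]
  [completeA : CompleteSpace KA]
  [normedB : NormedAddCommGroup KB]
  [innerB : InnerProductSpace ℂ KB]
  [completeB : CompleteSpace KB]
  ι : Type u
  opA : ι → (HA →L[ℂ] KA)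
  opB : ι → (HB →L[ℂ] KB)
  isLOCC : IsLOCC HA HB KA KB ι opA opB

attribute [instance] LOCC.normedA LOCC.innerA LOCC.completeA LOCC.normedB LOCC.innerB
  LOCC.completeB

variable {HA HB : Type u}
  [NormedAddCommGroup HA] [InnerProductSpace ℂ HA] [CompleteSpace HA]
  [NormedAddCommGroup HB] [InnerProductSpace ℂ HB] [CompleteSpace HB]

namespace LOCC

/-- The unnormalized final vector for the record `l` when the initial state is `Φ`. -/
def branch (C : LOCC HA HB) (Φ : HTensor HA HB) (l : C.ι) : HTensor C.KA C.KB :=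
  opTensor (C.opA l) (C.opB l) Φ

/-- The unnormalized final state `I_S(Φ) = ∑_{l ∈ S} |v_l⟩⟨v_l|` for the event that the record lies
in `S`; for a partition of the records the maps `I_S` form an LOCC instrument, and for `S = univ`
this is the output `C(Φ)` of the LOCC operation. -/
def state (C : LOCC HA HB) (S : Set C.ι) (Φ : HTensor HA HB) :
    HTensor C.KA C.KB →L[ℂ] HTensor C.KA C.KB :=
  ∑' l : S, InnerProductSpace.rankOne ℂ (C.branch Φ l) (C.branch Φ l)

/-- The probability `Tr I_S(Φ) = ∑_{l ∈ S} Tr |v_l⟩⟨v_l|` of the event `S`. -/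
def prob (C : LOCC HA HB) (S : Set C.ι) (Φ : HTensor HA HB) : ℝ≥0∞ :=
  ∑' l : S, ‖C.branch Φ l‖ₑ ^ 2

end LOCC

/-- A deterministic fixed-length entanglement concentration `(C, Ψ)`: an LOCC operation together
with a maximally entangled state on the output systems. -/
structure DFLEC (HA HB : Type u)
    [NormedAddCommGroup HA] [InnerProductSpace ℂ HA] [CompleteSpace HA]
    [NormedAddCommGroup HB] [InnerProductSpace ℂ HB] [CompleteSpace HB] where
  C : LOCC HA HB
  Ψ : MaxEnt C.KA C.KB

/-- The fidelity `⟨Ψ| C(Φ) |Ψ⟩`. -/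
def DFLEC.fidelity (P : DFLEC HA HB) (Φ : HTensor HA HB) : ℝ :=
  RCLike.re (inner ℂ P.Ψ.vec (P.C.state Set.univ Φ P.Ψ.vec))

/-- A probabilistic fixed-length entanglement concentration of `Φ`: a two-valued LOCC instrument
`{I₀, I₁}`, where `I₁` belongs to the set `success` of records and `I₀` to its complement, such
that `I₁(Φ) / Tr I₁(Φ)` is a maximally entangled state `|Ψ⟩⟨Ψ|`. -/
structure PFLEC (Φ : HTensor HA HB) where
  C : LOCC HA HB
  success : Set C.ι
  Ψ : MaxEnt C.KA C.KB
  prob_ne_zero : C.prob success Φ ≠ 0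
  state_eq : (((C.prob success Φ).toReal : ℂ)⁻¹) • C.state success Φ =
    InnerProductSpace.rankOne ℂ Ψ.vec Ψ.vec

/-- The success probability `Tr I₁(Φ)`. -/
def PFLEC.succProb {Φ : HTensor HA HB} (P : PFLEC Φ) : ℝ≥0∞ := P.C.prob P.success Φ

/-- The failure probability `Tr I₀(Φ)`. -/
def PFLEC.failProb {Φ : HTensor HA HB} (P : PFLEC Φ) : ℝ≥0∞ := P.C.prob P.successᶜ Φ

end LOCC

/-- `(-1/n) log p`, with value `+∞` for `p = 0`. -/
def exponent (n : ℕ) (p : ℝ≥0∞) : EReal := -ENNReal.log p / n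

/-- The asymptotic rate `liminf (1/n) log Lₙ`. -/
def rate (L : ℕ → ℕ) : EReal := liminf (fun n => ((Real.log (L n) / n : ℝ) : EReal)) atTop

section Rates

variable {HA HB : ℕ → Type u}
  [∀ n, NormedAddCommGroup (HA n)] [∀ n, InnerProductSpace ℂ (HA n)] [∀ n, CompleteSpace (HA n)]
  [∀ n, NormedAddCommGroup (HB n)] [∀ n, InnerProductSpace ℂ (HB n)] [∀ n, CompleteSpace (HB n)]

/-- `B_P(ε)`. -/
def BP (Φ : ∀ n, HTensor (HA n) (HB n)) (ε : ℝ) : EReal :=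
  sSup {R | ∃ I : ∀ n, PFLEC (Φ n), R = rate (fun n => (I n).Ψ.size) ∧
    limsup (fun n => (I n).failProb) atTop ≤ ENNReal.ofReal ε}

/-- `B_{e,P}(r)`. -/
def BeP (Φ : ∀ n, HTensor (HA n) (HB n)) (r : ℝ) : EReal :=
  sSup {R | ∃ I : ∀ n, PFLEC (Φ n), R = rate (fun n => (I n).Ψ.size) ∧
    (r : EReal) ≤ liminf (fun n => exponent n (I n).failProb) atTop}

/-- `B*_{e,P}(r)`. -/
def BePstar (Φ : ∀ n, HTensor (HA n) (HB n)) (r : ℝ) : EReal :=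
  sSup {R | ∃ I : ∀ n, PFLEC (Φ n), R = rate (fun n => (I n).Ψ.size) ∧
    limsup (fun n => exponent n (I n).succProb) atTop ≤ (r : EReal)}

/-- `B_D(ε)`. -/
def BD (Φ : ∀ n, HTensor (HA n) (HB n)) (ε : ℝ) : EReal :=
  sSup {R | ∃ P : ∀ n, DFLEC (HA n) (HB n), R = rate (fun n => (P n).Ψ.size) ∧
    ((1 - ε : ℝ) : EReal) ≤ liminf (fun n => (((P n).fidelity (Φ n) : ℝ) : EReal)) atTop}

/-- `B_{e,D}(r)`. -/
def BeD (Φ : ∀ n, HTensor (HA n) (HB n)) (r : ℝ) : EReal :=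
  sSup {R | ∃ P : ∀ n, DFLEC (HA n) (HB n), R = rate (fun n => (P n).Ψ.size) ∧
    (r : EReal) ≤
      liminf (fun n => exponent n (ENNReal.ofReal (1 - (P n).fidelity (Φ n)))) atTop}

/-- `B*_{e,D}(r)`. -/
def BeDstar (Φ : ∀ n, HTensor (HA n) (HB n)) (r : ℝ) : EReal :=
  sSup {R | ∃ P : ∀ n, DFLEC (HA n) (HB n), R = rate (fun n => (P n).Ψ.size) ∧
    limsup (fun n => exponent n (ENNReal.ofReal ((P n).fidelity (Φ n)))) atTop ≤ (r : EReal)}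

/-- `ψₙ(s) = log Tr ρₙ ^ s`, with `ρₙ` the reduced density of `Φₙ`; extended real valued. -/
def psi (Φ : ∀ n, HTensor (HA n) (HB n)) (n : ℕ) (s : ℝ) : EReal :=
  ENNReal.log (trPow (reducedDensity (Φ n)) s)

end Rates

/-- `(s r + ψ(s)) / (1 - s)`. -/
def strongFun (ψ : ℝ → EReal) (r s : ℝ) : EReal :=
  (((s * r : ℝ) : EReal) + ψ s) / ((1 - s : ℝ) : EReal)

end

end EntConc

namespace EntConc

section HilbertTensor

variable {A B C D E F : Type u}
  [NormedAddCommGroup A] [InnerProductSpace ℂ A]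
  [NormedAddCommGroup B] [InnerProductSpace ℂ B]
  [NormedAddCommGroup C] [InnerProductSpace ℂ C]
  [NormedAddCommGroup D] [InnerProductSpace ℂ D]
  [NormedAddCommGroup E] [InnerProductSpace ℂ E]
  [NormedAddCommGroup F] [InnerProductSpace ℂ F]

theorem inner_prodVec (a a' : A) (b b' : B) :
    ⟪prodVec a b, prodVec a' b'⟫_ℂ = ⟪a, a'⟫_ℂ * ⟪b, b'⟫_ℂ := by
  simp [prodVec]

theorem norm_prodVec (a : A) (b : B) : ‖prodVec a b‖ = ‖a‖ * ‖b‖ := by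
  simp [prodVec]

theorem prodVec_smul_left (c : ℂ) (a : A) (b : B) : prodVec (c • a) b = c • prodVec a b := by
  simp only [prodVec, ← UniformSpace.Completion.coe_smul, TensorProduct.smul_tmul']

theorem prodVec_smul_right (c : ℂ) (a : A) (b : B) : prodVec a (c • b) = c • prodVec a b := by
  simp only [prodVec, ← UniformSpace.Completion.coe_smul, TensorProduct.tmul_smul]

theorem prodVec_zero_left (b : B) : prodVec (0 : A) b = 0 := by
  simp [prodVec]

@[simp]
theorem opTensor_prodVec (S : A →L[ℂ] C) (T : B →L[ℂ] D) (a : A) (b : B) :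
    opTensor S T (prodVec a b) = prodVec (S a) (T b) := by
  unfold opTensor prodVec
  have h := ContinuousLinearMap.extend_eq
    ((UniformSpace.Completion.toComplL : (C ⊗[ℂ] D) →L[ℂ] HTensor C D) ∘L TensorProduct.mapL S T)
    (e := (UniformSpace.Completion.toComplL : (A ⊗[ℂ] B) →L[ℂ] HTensor A B))
    (by simpa using UniformSpace.Completion.denseRange_coe)
    (by simpa using (UniformSpace.Completion.isUniformInducing_coe _)) (a ⊗ₜ[ℂ] b)
  simpa using h

/-- Continuous linear maps on the Hilbert tensor product are determined by product vectors. -/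
theorem htensor_ext {G : Type*} [NormedAddCommGroup G] [NormedSpace ℂ G]
    {f g : HTensor A B →L[ℂ] G}
    (h : ∀ a b, f (prodVec a b) = g (prodVec a b)) : f = g := by
  have key : ∀ z : A ⊗[ℂ] B, f (z : HTensor A B) = g (z : HTensor A B) := by
    intro z
    induction z using TensorProduct.induction_on with
    | zero => rw [UniformSpace.Completion.coe_zero, map_zero, map_zero]
    | tmul a b => exact h a b
    | add x y hx hy => rw [UniformSpace.Completion.coe_add, map_add, map_add, hx, hy]
  ext z
  exact congrFun (UniformSpace.Completion.denseRange_coe.equalizer f.continuous g.continuous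
    (funext key)) z

theorem opTensor_comp (S' : C →L[ℂ] E) (T' : D →L[ℂ] F) (S : A →L[ℂ] C) (T : B →L[ℂ] D)
    (Φ : HTensor A B) :
    opTensor S' T' (opTensor S T Φ) = opTensor (S' ∘L S) (T' ∘L T) Φ := by
  have : (opTensor S' T') ∘L (opTensor S T) = opTensor (S' ∘L S) (T' ∘L T) :=
    htensor_ext fun a b => by simp
  exact DFunLike.congr_fun this Φ

@[simp]
theorem opTensor_id (Φ : HTensor A B) :
    opTensor (ContinuousLinearMap.id ℂ A) (ContinuousLinearMap.id ℂ B) Φ = Φ := by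
  have : opTensor (ContinuousLinearMap.id ℂ A) (ContinuousLinearMap.id ℂ B) =
      ContinuousLinearMap.id ℂ (HTensor A B) := htensor_ext fun a b => by simp
  simpa using DFunLike.congr_fun this Φ

/-- `b ↦ a ⊗ b`. -/
noncomputable def tensorLeft (a : A) : B →L[ℂ] HTensor A B :=
  (UniformSpace.Completion.toComplL : (A ⊗[ℂ] B) →L[ℂ] HTensor A B) ∘L TensorProduct.mkL ℂ A B a

theorem tensorLeft_apply (a : A) (b : B) : tensorLeft a b = prodVec a b := rfl

theorem tensorRight_apply (a : A) (b : B) : tensorRight b a = prodVec a b := rfl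

/-- The partial inner product `⟨a|Φ⟩ ∈ B`. -/
noncomputable def leftInner [CompleteSpace B] (a : A) : HTensor A B →L[ℂ] B :=
  ContinuousLinearMap.adjoint (tensorLeft (B := B) a)

/-- The partial inner product with `b`, as a continuous linear map. -/
noncomputable def rightInner [CompleteSpace A] (b : B) : HTensor A B →L[ℂ] A :=
  ContinuousLinearMap.adjoint (tensorRight (A := A) b)

theorem inner_rightInner [CompleteSpace A] (a : A) (b : B) (Φ : HTensor A B) :
    ⟪a, rightInner b Φ⟫_ℂ = ⟪prodVec a b, Φ⟫_ℂ := by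
  rw [rightInner, ContinuousLinearMap.adjoint_inner_right, tensorRight_apply]

theorem inner_leftInner [CompleteSpace B] (a : A) (b : B) (Φ : HTensor A B) :
    ⟪b, leftInner a Φ⟫_ℂ = ⟪prodVec a b, Φ⟫_ℂ := by
  rw [leftInner, ContinuousLinearMap.adjoint_inner_right, tensorLeft_apply]

theorem rightInner_prodVec [CompleteSpace A] (a : A) (b c : B) :
    rightInner c (prodVec a b) = ⟪c, b⟫_ℂ • a := by
  refine ext_inner_left ℂ fun x => ?_
  rw [inner_rightInner, inner_prodVec, inner_smul_right, mul_comm]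

theorem leftInner_prodVec [CompleteSpace B] (a c : A) (b : B) :
    leftInner c (prodVec a b) = ⟪c, a⟫_ℂ • b := by
  refine ext_inner_left ℂ fun x => ?_
  rw [inner_leftInner, inner_prodVec, inner_smul_right]

theorem rightInner_opTensor_id [CompleteSpace A] [CompleteSpace C] (K : A →L[ℂ] C) (b : B)
    (Φ : HTensor A B) :
    rightInner b (opTensor K (ContinuousLinearMap.id ℂ B) Φ) = K (rightInner b Φ) := by
  have : rightInner b ∘L opTensor K (ContinuousLinearMap.id ℂ B) = K ∘L rightInner b :=
    htensor_ext fun a b => by simp [rightInner_prodVec]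
  exact DFunLike.congr_fun this Φ

theorem leftInner_id_opTensor [CompleteSpace B] [CompleteSpace D] (K : B →L[ℂ] D) (a : A)
    (Φ : HTensor A B) :
    leftInner a (opTensor (ContinuousLinearMap.id ℂ A) K Φ) = K (leftInner a Φ) := by
  have : leftInner a ∘L opTensor (ContinuousLinearMap.id ℂ A) K = K ∘L leftInner a :=
    htensor_ext fun a b => by simp [leftInner_prodVec]
  exact DFunLike.congr_fun this Φ

theorem eq_zero_of_inner_prodVec {Φ : HTensor A B} (h : ∀ a b, ⟪prodVec a b, Φ⟫_ℂ = 0) :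
    Φ = 0 := by
  have : innerSL ℂ Φ = (0 : HTensor A B →L[ℂ] ℂ) := htensor_ext fun a b => by
    simpa using inner_eq_zero_symm.1 (h a b)
  simpa using DFunLike.congr_fun this Φ

theorem HilbertBasis_eq_zero {ι : Type*} (b : HilbertBasis ι ℂ A) {x : A}
    (h : ∀ i, ⟪b i, x⟫_ℂ = 0) : x = 0 := by
  apply b.repr.injective
  ext i
  simp [b.repr_apply_apply, h]

/-- The product of two Hilbert bases. -/
noncomputable def prodBasis [CompleteSpace A] [CompleteSpace B] {ι κ : Type*}
    (a : HilbertBasis ι ℂ A) (b : HilbertBasis κ ℂ B) :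
    HilbertBasis (ι × κ) ℂ (HTensor A B) :=
  HilbertBasis.mkOfOrthogonalEqBot (v := fun k : ι × κ => prodVec (a k.1) (b k.2))
    (by
      classical
      rw [orthonormal_iff_ite]
      rintro ⟨i, j⟩ ⟨i', j'⟩
      rw [inner_prodVec, orthonormal_iff_ite.1 a.orthonormal, orthonormal_iff_ite.1 b.orthonormal]
      by_cases h1 : i = i' <;> by_cases h2 : j = j' <;> simp [h1, h2])
    (by
      rw [Submodule.eq_bot_iff]
      intro Φ hΦ
      rw [Submodule.mem_orthogonal] at hΦ
      have h0 : ∀ i j, ⟪prodVec (a i) (b j), Φ⟫_ℂ = 0 := fun i j =>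
        hΦ _ (Submodule.subset_span ⟨(i, j), rfl⟩)
      have h1 : ∀ j, rightInner (b j) Φ = 0 := fun j =>
        HilbertBasis_eq_zero a fun i => by rw [inner_rightInner, h0]
      have h2 : ∀ x, leftInner x Φ = 0 := fun x =>
        HilbertBasis_eq_zero b fun j => by
          rw [inner_leftInner, ← inner_rightInner, h1, inner_zero_right]
      exact eq_zero_of_inner_prodVec fun x y => by
        rw [← inner_leftInner, h2, inner_zero_right])

theorem prodBasis_apply [CompleteSpace A] [CompleteSpace B] {ι κ : Type*}
    (a : HilbertBasis ι ℂ A) (b : HilbertBasis κ ℂ B) (k : ι × κ) :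
    prodBasis a b k = prodVec (a k.1) (b k.2) := by
  simp [prodBasis]

theorem enorm_sq_eq_ofReal {X : Type*} [SeminormedAddCommGroup X] (x : X) :
    ‖x‖ₑ ^ 2 = ENNReal.ofReal (‖x‖ ^ 2) := by
  rw [← ofReal_norm, ENNReal.ofReal_pow (norm_nonneg _)]

theorem HilbertBasis_hasSum_sq {ι : Type*} (b : HilbertBasis ι ℂ A) (x : A) :
    HasSum (fun i => ‖⟪b i, x⟫_ℂ‖ ^ 2) (‖x‖ ^ 2) := by
  have h := b.hasSum_inner_mul_inner x x
  have h2 := (Complex.hasSum_iff _ _).1 h |>.1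
  convert h2 using 1
  · ext i
    rw [← inner_conj_symm x (b i), ← Complex.normSq_eq_conj_mul_self, Complex.normSq_eq_norm_sq,
      Complex.ofReal_re]
  · rw [inner_self_eq_norm_sq_to_K]
    norm_cast

theorem tsum_ofReal_of_hasSum {ι : Type*} {f : ι → ℝ} {c : ℝ} (hf : ∀ i, 0 ≤ f i)
    (h : HasSum f c) : ∑' i, ENNReal.ofReal (f i) = ENNReal.ofReal c := by
  rw [← h.tsum_eq, ENNReal.ofReal_tsum_of_nonneg hf h.summable]

theorem HilbertBasis_tsum_enorm_sq {ι : Type*} (b : HilbertBasis ι ℂ A) (x : A) :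
    ∑' i, ‖⟪b i, x⟫_ℂ‖ₑ ^ 2 = ‖x‖ₑ ^ 2 := by
  simp_rw [enorm_sq_eq_ofReal]
  exact tsum_ofReal_of_hasSum (fun i => by positivity) (HilbertBasis_hasSum_sq b x)

theorem tsum_enorm_rightInner [CompleteSpace A] [CompleteSpace B] {κ : Type*}
    (b : HilbertBasis κ ℂ B) (Φ : HTensor A B) :
    ∑' j, ‖rightInner (b j) Φ‖ₑ ^ 2 = ‖Φ‖ₑ ^ 2 := by
  obtain ⟨w, a, -⟩ := exists_hilbertBasis ℂ A
  rw [← HilbertBasis_tsum_enorm_sq (prodBasis a b) Φ, ENNReal.tsum_prod', ENNReal.tsum_comm]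
  refine tsum_congr fun j => ?_
  rw [← HilbertBasis_tsum_enorm_sq a]
  refine tsum_congr fun i => ?_
  rw [prodBasis_apply, inner_rightInner]

theorem tsum_enorm_leftInner [CompleteSpace A] [CompleteSpace B] {κ : Type*}
    (a : HilbertBasis κ ℂ A) (Φ : HTensor A B) :
    ∑' j, ‖leftInner (a j) Φ‖ₑ ^ 2 = ‖Φ‖ₑ ^ 2 := by
  obtain ⟨w, b, -⟩ := exists_hilbertBasis ℂ B
  rw [← HilbertBasis_tsum_enorm_sq (prodBasis a b) Φ, ENNReal.tsum_prod']
  refine tsum_congr fun j => ?_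
  rw [← HilbertBasis_tsum_enorm_sq b]
  refine tsum_congr fun i => ?_
  rw [prodBasis_apply, inner_leftInner]

theorem IsMeasurement.tsum_enorm_sq {κ : Type u} {K : κ → (A →L[ℂ] C)} (hK : IsMeasurement K)
    (x : A) : ∑' i, ‖K i x‖ₑ ^ 2 = ‖x‖ₑ ^ 2 := by
  simp_rw [enorm_sq_eq_ofReal]
  exact tsum_ofReal_of_hasSum (fun i => by positivity) (hK x)

theorem IsMeasurement.tsum_opTensor_left [CompleteSpace A] [CompleteSpace B] [CompleteSpace C]
    {κ : Type u} {K : κ → (A →L[ℂ] C)} (hK : IsMeasurement K) (Φ : HTensor A B) :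
    ∑' i, ‖opTensor (K i) (ContinuousLinearMap.id ℂ B) Φ‖ₑ ^ 2 = ‖Φ‖ₑ ^ 2 := by
  obtain ⟨w, b, -⟩ := exists_hilbertBasis ℂ B
  simp_rw [← tsum_enorm_rightInner b, rightInner_opTensor_id]
  rw [ENNReal.tsum_comm]
  exact tsum_congr fun j => hK.tsum_enorm_sq _

theorem IsMeasurement.tsum_opTensor_right [CompleteSpace A] [CompleteSpace B] [CompleteSpace D]
    {κ : Type u} {K : κ → (B →L[ℂ] D)} (hK : IsMeasurement K) (Φ : HTensor A B) :
    ∑' i, ‖opTensor (ContinuousLinearMap.id ℂ A) (K i) Φ‖ₑ ^ 2 = ‖Φ‖ₑ ^ 2 := by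
  obtain ⟨w, b, -⟩ := exists_hilbertBasis ℂ A
  simp_rw [← tsum_enorm_leftInner b, leftInner_id_opTensor]
  rw [ENNReal.tsum_comm]
  exact tsum_congr fun j => hK.tsum_enorm_sq _

end HilbertTensor

section TotalProbability

variable {HA HB : Type u}
  [NormedAddCommGroup HA] [InnerProductSpace ℂ HA] [CompleteSpace HA]
  [NormedAddCommGroup HB] [InnerProductSpace ℂ HB] [CompleteSpace HB]

/-- The probabilities of the records of an LOCC protocol add up to one. -/
theorem IsLOCC.tsum_enorm_sq {KA KB ι : Type u}
    [NormedAddCommGroup KA] [InnerProductSpace ℂ KA] [CompleteSpace KA]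
    [NormedAddCommGroup KB] [InnerProductSpace ℂ KB] [CompleteSpace KB]
    {S : ι → (HA →L[ℂ] KA)} {T : ι → (HB →L[ℂ] KB)} (h : IsLOCC HA HB KA KB ι S T)
    (Φ : HTensor HA HB) : ∑' l, ‖opTensor (S l) (T l) Φ‖ₑ ^ 2 = ‖Φ‖ₑ ^ 2 := by
  induction h with
  | start => simp
  | alice h K hK ih =>
    rw [ENNReal.tsum_sigma', ← ih]
    refine tsum_congr fun l => ?_
    rw [← (hK l).tsum_opTensor_left]
    refine tsum_congr fun i => ?_
    rw [opTensor_comp, ContinuousLinearMap.id_comp]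
  | bob h K hK ih =>
    rw [ENNReal.tsum_sigma', ← ih]
    refine tsum_congr fun l => ?_
    rw [← (hK l).tsum_opTensor_right]
    refine tsum_congr fun i => ?_
    rw [opTensor_comp, ContinuousLinearMap.id_comp]

theorem LOCC.tsum_enorm_branch (C : LOCC HA HB) (Φ : HTensor HA HB) :
    ∑' l, ‖C.branch Φ l‖ₑ ^ 2 = ‖Φ‖ₑ ^ 2 := C.isLOCC.tsum_enorm_sq Φ

end TotalProbability

end EntConc

namespace EntConc

section Schmidt

variable {A B : Type u}
  [NormedAddCommGroup A] [InnerProductSpace ℂ A] [CompleteSpace A]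
  [NormedAddCommGroup B] [InnerProductSpace ℂ B] [CompleteSpace B]

/-- A Schmidt decomposition `Φ = ∑ⱼ √pⱼ aⱼ ⊗ bⱼ`, the `pⱼ` being the positive eigenvalues of the
reduced density counted with multiplicity. -/
structure Schmidt (Φ : HTensor A B) where
  J : Type
  p : J → ℝ
  p_pos : ∀ j, 0 < p j
  a : J → A
  b : J → B
  orthonormal_a : Orthonormal ℂ a
  orthonormal_b : Orthonormal ℂ b
  hasSum : HasSum (fun j => ((√(p j) : ℝ) : ℂ) • prodVec (a j) (b j)) Φ
  trPow_eq : ∀ s, trPow (reducedDensity Φ) s = ∑' j, ENNReal.ofReal (p j ^ s)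

theorem orthonormal_prodVec {A B : Type u} [NormedAddCommGroup A] [InnerProductSpace ℂ A]
    [NormedAddCommGroup B] [InnerProductSpace ℂ B] {J : Type*} {a : J → A} {b : J → B}
    (ha : Orthonormal ℂ a)
    (hb : Orthonormal ℂ b) : Orthonormal ℂ fun j => prodVec (a j) (b j) := by
  classical
  rw [orthonormal_iff_ite] at *
  intro i j
  rw [inner_prodVec, ha, hb]
  split_ifs <;> simp

theorem hasSum_reducedDensity (Φ : HTensor A B) :
    HasSum (fun j : (exists_hilbertBasis ℂ B).choose =>
      InnerProductSpace.rankOne ℂ (rightInner (j : B) Φ) (rightInner (j : B) Φ))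
      (reducedDensity Φ) := by
  obtain ⟨b, hb⟩ := (exists_hilbertBasis ℂ B).choose_spec
  refine Summable.hasSum (Summable.of_norm ?_)
  have h := tsum_enorm_rightInner b Φ
  rw [hb] at h
  have h2 : ∑' j : (exists_hilbertBasis ℂ B).choose, ‖rightInner (j : B) Φ‖ₑ ^ 2 ≠ ⊤ := by
    rw [h]; simp
  simp_rw [enorm_sq_eq_ofReal] at h2
  have h3 := ENNReal.summable_toReal h2
  simp_rw [ENNReal.toReal_ofReal (sq_nonneg _)] at h3
  simpa only [InnerProductSpace.norm_rankOne, ← pow_two] using h3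

theorem inner_reducedDensity (Φ : HTensor A B) (x y : A) :
    ⟪x, reducedDensity Φ y⟫_ℂ = ⟪leftInner y Φ, leftInner x Φ⟫_ℂ := by
  obtain ⟨b, hb⟩ := (exists_hilbertBasis ℂ B).choose_spec
  have h1 : HasSum (fun j : (exists_hilbertBasis ℂ B).choose =>
      ⟪x, ⟪rightInner (j : B) Φ, y⟫_ℂ • rightInner (j : B) Φ⟫_ℂ) ⟪x, reducedDensity Φ y⟫_ℂ :=
    (hasSum_reducedDensity Φ).mapL ((innerSL ℂ x) ∘L (ContinuousLinearMap.apply ℂ A y))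
  have h2 := b.hasSum_inner_mul_inner (leftInner y Φ) (leftInner x Φ)
  refine h1.unique ((congrArg (fun f => HasSum f _) (funext fun j => ?_)).mpr h2)
  have e1 : ⟪leftInner y Φ, b j⟫_ℂ = ⟪rightInner (j : B) Φ, y⟫_ℂ := by
    rw [← inner_conj_symm, inner_leftInner, ← inner_rightInner, inner_conj_symm, hb]
  have e2 : ⟪b j, leftInner x Φ⟫_ℂ = ⟪x, rightInner (j : B) Φ⟫_ℂ := by
    rw [inner_leftInner, ← inner_rightInner, hb]
  rw [inner_smul_right, e1, e2]

theorem isCompactOperator_reducedDensity (Φ : HTensor A B) :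
    IsCompactOperator (reducedDensity Φ) := by
  refine isCompactOperator_of_tendsto (hasSum_reducedDensity Φ)
    (Eventually.of_forall fun s => ?_)
  refine Submodule.sum_mem (compactOperator (RingHom.id ℂ) A A) fun j _ => ?_
  change IsCompactOperator (InnerProductSpace.rankOne ℂ _ _)
  rw [InnerProductSpace.rankOne_def']
  exact (isCompactOperator_of_locallyCompactSpace_dom
    (innerSL ℂ (rightInner (j : B) Φ) : A →L[ℂ] ℂ)).clm_comp
      (ContinuousLinearMap.toSpanSingleton ℂ (rightInner (j : B) Φ))

theorem isSymmetric_reducedDensity (Φ : HTensor A B) : (reducedDensity Φ).IsSymmetric := by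
  intro x y
  change ⟪reducedDensity Φ x, y⟫_ℂ = ⟪x, reducedDensity Φ y⟫_ℂ
  rw [← inner_conj_symm, inner_reducedDensity, inner_reducedDensity, inner_conj_symm]

theorem exists_schmidt (Φ : HTensor A B) : Nonempty (Schmidt Φ) := by
  set ρ := reducedDensity Φ with hρ
  have hc : IsCompactOperator ρ := isCompactOperator_reducedDensity Φ
  have hs : ρ.IsSymmetric := isSymmetric_reducedDensity Φ
  let V : Set.Ioi (0 : ℝ) → Submodule ℂ A := fun x =>
    Module.End.eigenspace (ρ : A →ₗ[ℂ] A) ((x : ℝ) : ℂ)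
  have hfd : ∀ x, FiniteDimensional ℂ (V x) := fun x =>
    ContinuousLinearMap.finite_dimensional_eigenspace hc _ (by
      have := x.2; simp only [Set.mem_Ioi] at this; exact_mod_cast this.ne')
  have hof : OrthogonalFamily ℂ (fun x => V x) fun x => (V x).subtypeₗᵢ :=
    hs.orthogonalFamily_eigenspaces.comp (f := fun x : Set.Ioi (0 : ℝ) => ((x : ℝ) : ℂ))
      (fun x y h => Subtype.ext (by simpa using h))
  let J : Type := Σ x : Set.Ioi (0 : ℝ), Fin (Module.finrank ℂ (V x))
  let a : J → A := fun j => (stdOrthonormalBasis ℂ (V j.1) j.2 : A)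
  have ha : Orthonormal ℂ a := hof.orthonormal_sigma_orthonormal
    (v_family := fun x => stdOrthonormalBasis ℂ (V x))
    (fun x => (stdOrthonormalBasis ℂ (V x)).orthonormal)
  let p : J → ℝ := fun j => j.1
  have hp : ∀ j, 0 < p j := fun j => j.1.2
  have hpa : ∀ j, ρ (a j) = ((p j : ℝ) : ℂ) • a j := fun j =>
    Module.End.mem_eigenspace_iff.1 (stdOrthonormalBasis ℂ (V j.1) j.2).2
  let M : A → B := fun x => leftInner x Φ
  have hM : ∀ x y, ⟪M x, M y⟫_ℂ = ⟪y, ρ x⟫_ℂ := fun x y => (inner_reducedDensity Φ y x).symm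
  have hsq : ∀ j, ((√(p j) : ℝ) : ℂ) ≠ 0 := fun j => by
    have := (Real.sqrt_pos.2 (hp j)).ne'
    exact_mod_cast this
  have hsq2 : ∀ j, ((√(p j) : ℝ) : ℂ) * ((√(p j) : ℝ) : ℂ) = (p j : ℂ) := fun j => by
    rw [← Complex.ofReal_mul, Real.mul_self_sqrt (hp j).le]
  let b : J → B := fun j => ((√(p j) : ℝ) : ℂ)⁻¹ • M (a j)
  have hb : Orthonormal ℂ b := by
    classical
    rw [orthonormal_iff_ite] at ha ⊢
    intro i j
    simp only [b, inner_smul_left, inner_smul_right, hM, hpa, ha]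
    by_cases h : i = j
    · subst h
      simp only [if_true, mul_one, map_inv₀, Complex.conj_ofReal]
      rw [← hsq2 i]
      field_simp [hsq i]
    · simp [h, Ne.symm h]
  have hMa : ∀ j, M (a j) = ((√(p j) : ℝ) : ℂ) • b j := fun j => by
    simp only [b, smul_smul]
    rw [mul_inv_cancel₀ (hsq j), one_smul]
  have hv := orthonormal_prodVec ha hb
  have hcoef : ∀ j, ⟪prodVec (a j) (b j), Φ⟫_ℂ = ((√(p j) : ℝ) : ℂ) := fun j => by
    rw [← inner_leftInner]
    change ⟪b j, M (a j)⟫_ℂ = _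
    rw [hMa, inner_smul_right, inner_self_eq_norm_sq_to_K, hb.1]
    simp
  have hsum : Summable fun j => ((√(p j) : ℝ) : ℂ) • prodVec (a j) (b j) := by
    have h1 := (hv.orthogonalFamily.summable_iff_norm_sq_summable
      (fun j => ((√(p j) : ℝ) : ℂ))).2 (by
        have := hv.inner_products_summable (x := Φ)
        simpa only [hcoef] using this)
    simpa using h1
  obtain ⟨Φ', hΦ'⟩ := hsum
  have hinner : ∀ x y, HasSum (fun j => ⟪x, a j⟫_ℂ * ⟪y, M (a j)⟫_ℂ) ⟪prodVec x y, Φ'⟫_ℂ := by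
    intro x y
    have h1 : HasSum (fun j => ⟪prodVec x y, ((√(p j) : ℝ) : ℂ) • prodVec (a j) (b j)⟫_ℂ)
      ⟪prodVec x y, Φ'⟫_ℂ := hΦ'.mapL (innerSL ℂ (prodVec x y))
    convert h1 using 1
    ext j
    rw [inner_smul_right, inner_prodVec, hMa, inner_smul_right]
    ring
  have heq : Φ - Φ' = 0 := by
    refine eq_zero_of_inner_prodVec fun x y => ?_
    rw [← inner_rightInner]
    suffices h : rightInner y (Φ - Φ') = 0 by rw [h, inner_zero_right]
    have hbot := ContinuousLinearMap.orthogonalComplement_iSup_eigenspaces_eq_bot hc hs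
    rw [Submodule.eq_bot_iff] at hbot
    apply hbot
    rw [← Submodule.iInf_orthogonal, Submodule.mem_iInf]
    intro μ
    rw [Submodule.mem_orthogonal]
    intro x hx
    rw [inner_rightInner, inner_sub_right, sub_eq_zero, ← inner_leftInner]
    change ⟪y, M x⟫_ℂ = _
    by_cases hx0 : x = 0
    · subst hx0
      have : M 0 = 0 := by
        rw [← inner_self_eq_zero (𝕜 := ℂ), hM, inner_zero_left]
      rw [this, prodVec_zero_left]; simp
    have hev : Module.End.HasEigenvalue (ρ : A →ₗ[ℂ] A) μ :=
      Module.End.hasEigenvalue_of_hasEigenvector ⟨hx, hx0⟩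
    have hreal : ((μ.re : ℝ) : ℂ) = μ := by
      rw [← Complex.conj_eq_iff_re]; exact hs.conj_eigenvalue_eq_self hev
    have hρx : ρ x = μ • x := Module.End.mem_eigenspace_iff.1 hx
    have hnn : 0 ≤ μ.re := by
      have h1 := hM x x
      rw [hρx, inner_smul_right, inner_self_eq_norm_sq_to_K, inner_self_eq_norm_sq_to_K,
        ← hreal] at h1
      have h2 : ‖M x‖ ^ 2 = μ.re * ‖x‖ ^ 2 := by
        apply Complex.ofReal_injective
        push_cast
        exact h1
      have h3 : 0 < ‖x‖ ^ 2 := by positivity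
      by_contra hneg
      push Not at hneg
      nlinarith [sq_nonneg ‖M x‖, mul_neg_of_neg_of_pos hneg h3]
    rcases hnn.eq_or_lt with h0 | h0
    · have hμ : μ = 0 := by rw [← hreal, ← h0]; simp
      have hMx : M x = 0 := by
        rw [← inner_self_eq_zero (𝕜 := ℂ), hM, hρx, hμ, zero_smul, inner_zero_right]
      rw [hMx, inner_zero_right]
      refine hasSum_zero.unique
        ((congrArg (fun f => HasSum f _) (funext fun j => ?_)).mpr (hinner x y))
      symm
      have h1 : ⟪x, ρ (a j)⟫_ℂ = ⟪ρ x, a j⟫_ℂ := (hs x (a j)).symm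
      rw [hρx, hμ, zero_smul, inner_zero_left, hpa, inner_smul_right] at h1
      have h2 : ((p j : ℝ) : ℂ) ≠ 0 := by exact_mod_cast (hp j).ne'
      rw [(mul_eq_zero.1 h1).resolve_left h2, zero_mul]
    · let z : Set.Ioi (0 : ℝ) := ⟨μ.re, h0⟩
      have hxz : x ∈ V z := by
        change x ∈ Module.End.eigenspace (ρ : A →ₗ[ℂ] A) ((μ.re : ℝ) : ℂ)
        rwa [hreal]
      have hbase : ∀ j, ⟪prodVec (a j) y, Φ - Φ'⟫_ℂ = 0 := fun j => by
        rw [inner_sub_right, sub_eq_zero, ← inner_leftInner]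
        refine HasSum.unique ?_ (hinner (a j) y)
        have := hasSum_single (f := fun k => ⟪a j, a k⟫_ℂ * ⟪y, M (a k)⟫_ℂ) j
          (fun k hk => by rw [ha.2 hk.symm, zero_mul])
        rwa [inner_self_eq_norm_sq_to_K, ha.1, RCLike.ofReal_one, one_pow, one_mul] at this
      have hxs : x = ∑ k, (stdOrthonormalBasis ℂ (V z)).repr ⟨x, hxz⟩ k • a ⟨z, k⟩ := by
        have := (stdOrthonormalBasis ℂ (V z)).sum_repr ⟨x, hxz⟩
        refine (congrArg Subtype.val this).symm.trans ?_
        simp [a]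
      have h3 : ⟪prodVec x y, Φ - Φ'⟫_ℂ = 0 := by
        rw [← inner_rightInner, hxs, sum_inner]
        refine Finset.sum_eq_zero fun k _ => ?_
        rw [inner_smul_left, inner_rightInner, hbase, mul_zero]
      rw [inner_sub_right, sub_eq_zero, ← inner_leftInner] at h3
      exact h3
  have hΦeq : Φ = Φ' := sub_eq_zero.1 heq
  refine ⟨⟨J, p, hp, a, b, ha, hb, hΦeq ▸ hΦ', fun s => ?_⟩⟩
  rw [trPow, ENNReal.tsum_sigma' (β := fun x : Set.Ioi (0 : ℝ) => Fin (Module.finrank ℂ (V x)))]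
  refine tsum_congr fun x => ?_
  change _ = ∑' _ : Fin (Module.finrank ℂ (V x)), ENNReal.ofReal ((x : ℝ) ^ s)
  rw [tsum_fintype, Finset.sum_const, Finset.card_univ, Fintype.card_fin, nsmul_eq_mul]

theorem Schmidt.inner_prodVec {Φ : HTensor A B} (D : Schmidt Φ) (j : D.J) :
    ⟪prodVec (D.a j) (D.b j), Φ⟫_ℂ = ((√(D.p j) : ℝ) : ℂ) := by
  have hv := orthonormal_prodVec D.orthonormal_a D.orthonormal_b
  have h1 := D.hasSum.mapL (innerSL ℂ (prodVec (D.a j) (D.b j)))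
  refine h1.unique ?_
  have h2 := hasSum_single (f := fun k => innerSL ℂ (prodVec (D.a j) (D.b j))
      (((√(D.p k) : ℝ) : ℂ) • prodVec (D.a k) (D.b k))) j
    (fun k hk => by
      simp only [innerSL_apply_apply, inner_smul_right]
      rw [hv.2 hk.symm, mul_zero])
  simp only [innerSL_apply_apply, inner_smul_right] at h2 ⊢
  rwa [inner_self_eq_norm_sq_to_K, hv.1, RCLike.ofReal_one, one_pow, mul_one] at h2

theorem Schmidt.hasSum_p {Φ : HTensor A B} (D : Schmidt Φ) (hΦ : ‖Φ‖ = 1) : HasSum D.p 1 := by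
  have h1 := D.hasSum.mapL (innerSL ℂ Φ)
  have h2 := (Complex.hasSum_iff _ _).1 h1 |>.1
  convert h2 using 1
  · ext j
    simp only [innerSL_apply_apply, inner_smul_right]
    rw [← inner_conj_symm, D.inner_prodVec, Complex.conj_ofReal, ← Complex.ofReal_mul,
      Complex.ofReal_re, Real.mul_self_sqrt (D.p_pos j).le]
  · simp only [innerSL_apply_apply]
    rw [inner_self_eq_norm_sq_to_K, hΦ]; simp

/-- The part of `Φ` that belongs to the Schmidt vectors with indices in `G`. -/
noncomputable def Schmidt.trunc {Φ : HTensor A B} (D : Schmidt Φ) (G : Finset D.J) :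
    HTensor A B :=
  ∑ j ∈ G, ((√(D.p j) : ℝ) : ℂ) • prodVec (D.a j) (D.b j)

theorem Schmidt.norm_sub_trunc_sq {Φ : HTensor A B} (D : Schmidt Φ) (hΦ : ‖Φ‖ = 1)
    (G : Finset D.J) : ‖Φ - D.trunc G‖ ^ 2 = 1 - ∑ j ∈ G, D.p j := by
  have hv := orthonormal_prodVec D.orthonormal_a D.orthonormal_b
  have h1 : ⟪Φ, D.trunc G⟫_ℂ = ((∑ j ∈ G, D.p j : ℝ) : ℂ) := by
    rw [Schmidt.trunc, inner_sum, Complex.ofReal_sum]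
    refine Finset.sum_congr rfl fun j _ => ?_
    rw [inner_smul_right, ← inner_conj_symm, D.inner_prodVec, Complex.conj_ofReal,
      ← Complex.ofReal_mul, Real.mul_self_sqrt (D.p_pos j).le]
  have h2 : ⟪D.trunc G, D.trunc G⟫_ℂ = ((∑ j ∈ G, D.p j : ℝ) : ℂ) := by
    rw [Schmidt.trunc, hv.inner_sum, Complex.ofReal_sum]
    refine Finset.sum_congr rfl fun j _ => ?_
    rw [Complex.conj_ofReal, ← Complex.ofReal_mul, Real.mul_self_sqrt (D.p_pos j).le]
  have h3 := norm_sub_sq (𝕜 := ℂ) Φ (D.trunc G)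
  have h4 : ‖D.trunc G‖ ^ 2 = ∑ j ∈ G, D.p j := by
    rw [inner_self_eq_norm_sq_to_K] at h2
    apply Complex.ofReal_injective
    rw [← h2]; push_cast; rfl
  rw [h3, h1, h4, hΦ]
  simp only [RCLike.re_to_complex, Complex.ofReal_re]
  ring

theorem Schmidt.sum_le_one {Φ : HTensor A B} (D : Schmidt Φ) (hΦ : ‖Φ‖ = 1)
    (G : Finset D.J) : ∑ j ∈ G, D.p j ≤ 1 :=
  sum_le_hasSum G (fun j _ => (D.p_pos j).le) (D.hasSum_p hΦ)

end Schmidt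

end EntConc

namespace EntConc

section MaxEnt

variable {A B : Type u}
  [NormedAddCommGroup A] [InnerProductSpace ℂ A]
  [NormedAddCommGroup B] [InnerProductSpace ℂ B]

theorem MaxEnt.inner_vec (Ψ : MaxEnt A B) (x : A) (y : B) :
    ⟪Ψ.vec, prodVec x y⟫_ℂ =
      (((√(Ψ.size : ℝ))⁻¹ : ℝ) : ℂ) * ∑ i, ⟪Ψ.e i, x⟫_ℂ * ⟪Ψ.f i, y⟫_ℂ := by
  rw [MaxEnt.vec, inner_smul_left, sum_inner, Complex.conj_ofReal]
  simp_rw [inner_prodVec]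

theorem MaxEnt.size_pos' (Ψ : MaxEnt A B) : (0 : ℝ) < Ψ.size := by exact_mod_cast Ψ.size_pos

theorem MaxEnt.norm_vec (Ψ : MaxEnt A B) : ‖Ψ.vec‖ = 1 := by
  have hv := orthonormal_prodVec Ψ.orthonormal_e Ψ.orthonormal_f
  have h : ‖∑ i, prodVec (Ψ.e i) (Ψ.f i)‖ ^ 2 = Ψ.size := by
    have h2 := hv.inner_sum (fun _ => (1 : ℂ)) (fun _ => (1 : ℂ)) Finset.univ
    simp only [one_smul] at h2
    rw [inner_self_eq_norm_sq_to_K] at h2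
    apply Complex.ofReal_injective
    push_cast
    refine h2.trans ?_
    simp
  have h2 : ‖∑ i, prodVec (Ψ.e i) (Ψ.f i)‖ = √(Ψ.size : ℝ) := by
    rw [← h, Real.sqrt_sq (norm_nonneg _)]
  rw [MaxEnt.vec, norm_smul, h2, Complex.norm_real, Real.norm_eq_abs,
    abs_of_nonneg (by positivity)]
  exact inv_mul_cancel₀ (Real.sqrt_pos.2 Ψ.size_pos').ne'

/-- A product vector has squared overlap at most `1 / L` with a maximally entangled state. -/
theorem MaxEnt.norm_inner_prodVec_sq_le (Ψ : MaxEnt A B) (x : A) (y : B) :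
    ‖⟪Ψ.vec, prodVec x y⟫_ℂ‖ ^ 2 ≤ ‖prodVec x y‖ ^ 2 / Ψ.size := by
  have h1 : ‖∑ i, ⟪Ψ.e i, x⟫_ℂ * ⟪Ψ.f i, y⟫_ℂ‖ ^ 2 ≤ ‖x‖ ^ 2 * ‖y‖ ^ 2 := by
    calc ‖∑ i, ⟪Ψ.e i, x⟫_ℂ * ⟪Ψ.f i, y⟫_ℂ‖ ^ 2
        ≤ (∑ i, ‖⟪Ψ.e i, x⟫_ℂ‖ * ‖⟪Ψ.f i, y⟫_ℂ‖) ^ 2 := by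
          gcongr
          refine (norm_sum_le _ _).trans (le_of_eq ?_)
          simp only [norm_mul]
      _ ≤ (∑ i, ‖⟪Ψ.e i, x⟫_ℂ‖ ^ 2) * ∑ i, ‖⟪Ψ.f i, y⟫_ℂ‖ ^ 2 :=
          Finset.sum_mul_sq_le_sq_mul_sq _ _ _
      _ ≤ _ := by
          gcongr
          · exact Ψ.orthonormal_e.sum_inner_products_le x
          · exact Ψ.orthonormal_f.sum_inner_products_le y
  rw [Ψ.inner_vec, norm_mul, mul_pow, Complex.norm_real, Real.norm_eq_abs, sq_abs, inv_pow,
    Real.sq_sqrt Ψ.size_pos'.le, norm_prodVec, mul_pow, inv_mul_eq_div]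
  gcongr

theorem norm_opTensor_id_le [CompleteSpace A] [CompleteSpace B] {Q : A →L[ℂ] A}
    (hQ : ∀ x, ‖Q x‖ ≤ ‖x‖) (Φ : HTensor A B) :
    ‖opTensor Q (ContinuousLinearMap.id ℂ B) Φ‖ ≤ ‖Φ‖ := by
  obtain ⟨w, b, -⟩ := exists_hilbertBasis ℂ B
  have h : ‖opTensor Q (ContinuousLinearMap.id ℂ B) Φ‖ₑ ^ 2 ≤ ‖Φ‖ₑ ^ 2 := by
    simp_rw [← tsum_enorm_rightInner b, rightInner_opTensor_id]
    refine ENNReal.tsum_le_tsum fun j => ?_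
    gcongr
    exact enorm_le_iff_norm_le.2 (hQ _)
  rw [enorm_sq_eq_ofReal, enorm_sq_eq_ofReal, ENNReal.ofReal_le_ofReal_iff (by positivity)] at h
  exact le_of_sq_le_sq h (norm_nonneg _)

/-- A vector of Schmidt rank at most `#G` has squared distance at least `|c|² (1 - #G / L)` from
`c Ψ`. -/
theorem MaxEnt.le_norm_sub_sq [CompleteSpace A] [CompleteSpace B] (Ψ : MaxEnt A B) {J : Type*}
    (G : Finset J) (x : J → A) (y : J → B) (c : ℂ) :
    ‖c‖ ^ 2 * (1 - (G.card : ℝ) / Ψ.size) ≤ ‖c • Ψ.vec - ∑ j ∈ G, prodVec (x j) (y j)‖ ^ 2 := by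
  classical
  let W : Submodule ℂ A := Submodule.span ℂ (x '' (G : Set J))
  have hfin : (x '' (G : Set J)).Finite := G.finite_toSet.image x
  have : FiniteDimensional ℂ W := FiniteDimensional.span_of_finite ℂ hfin
  have hrank : Module.finrank ℂ W ≤ G.card := by
    have h1 : (x '' (G : Set J)) = ((G.image x : Finset A) : Set A) := by simp
    refine le_trans ?_ (Finset.card_image_le (s := G) (f := x))
    change Module.finrank ℂ (Submodule.span ℂ (x '' (G : Set J))) ≤ _
    rw [h1]
    exact finrank_span_finset_le_card _
  let Q : A →L[ℂ] A := Wᗮ.starProjection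
  have hQ : ∀ z, ‖Q z‖ ≤ ‖z‖ := fun z => Wᗮ.norm_starProjection_apply_le z
  have hQx : ∀ j ∈ G, Q (x j) = 0 := fun j hj => by
    rw [Submodule.starProjection_apply_eq_zero_iff, Submodule.orthogonal_orthogonal]
    exact Submodule.subset_span ⟨j, hj, rfl⟩
  have h1 := norm_opTensor_id_le (B := B) hQ (c • Ψ.vec - ∑ j ∈ G, prodVec (x j) (y j))
  have h2 : opTensor Q (ContinuousLinearMap.id ℂ B) (c • Ψ.vec - ∑ j ∈ G, prodVec (x j) (y j)) =
      (c * (((√(Ψ.size : ℝ))⁻¹ : ℝ) : ℂ)) • ∑ i, prodVec (Q (Ψ.e i)) (Ψ.f i) := by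
    rw [map_sub, map_sum, map_smul, MaxEnt.vec, map_smul, map_sum]
    simp only [opTensor_prodVec]
    rw [Finset.sum_eq_zero (s := G), sub_zero, smul_smul]
    · rfl
    · intro j hj
      rw [hQx j hj, prodVec_zero_left]
  have h3 : ‖∑ i, prodVec (Q (Ψ.e i)) (Ψ.f i)‖ ^ 2 = ∑ i, ‖Q (Ψ.e i)‖ ^ 2 := by
    have h4 : ⟪∑ i, prodVec (Q (Ψ.e i)) (Ψ.f i), ∑ i, prodVec (Q (Ψ.e i)) (Ψ.f i)⟫_ℂ =
        ((∑ i, ‖Q (Ψ.e i)‖ ^ 2 : ℝ) : ℂ) := by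
      rw [sum_inner, Complex.ofReal_sum]
      refine Finset.sum_congr rfl fun i _ => ?_
      rw [inner_sum, Finset.sum_eq_single i]
      · rw [inner_prodVec, inner_self_eq_norm_sq_to_K, inner_self_eq_norm_sq_to_K,
          Ψ.orthonormal_f.1]
        simp
      · intro k _ hk
        rw [inner_prodVec, Ψ.orthonormal_f.2 hk.symm, mul_zero]
      · simp
    rw [inner_self_eq_norm_sq_to_K] at h4
    apply Complex.ofReal_injective
    rw [← h4]; push_cast; rfl
  let q := stdOrthonormalBasis ℂ W
  have h5 : ∑ i, ‖W.starProjection (Ψ.e i)‖ ^ 2 ≤ (G.card : ℝ) := by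
    have h6 : ∀ z : A, ‖W.starProjection z‖ ^ 2 = ∑ m, ‖⟪(q m : A), z⟫_ℂ‖ ^ 2 := fun z => by
      refine (q.sum_sq_norm_inner_right (W.orthogonalProjectionOnto z)).symm.trans ?_
      refine Finset.sum_congr rfl fun m _ => ?_
      rw [W.inner_orthogonalProjectionOnto_eq_of_mem_left]
    simp_rw [h6]
    rw [Finset.sum_comm]
    calc ∑ m, ∑ i, ‖⟪(q m : A), Ψ.e i⟫_ℂ‖ ^ 2 ≤ ∑ m : Fin (Module.finrank ℂ W), (1 : ℝ) := by
          refine Finset.sum_le_sum fun m _ => ?_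
          have h8 := Ψ.orthonormal_e.sum_inner_products_le (q m : A) (s := Finset.univ)
          have h9 : ‖(q m : A)‖ = 1 := q.orthonormal.1 m
          rw [h9, one_pow] at h8
          simp_rw [norm_inner_symm (q m : A)]
          exact h8
      _ ≤ _ := by simpa using hrank
  have h10 : (Ψ.size : ℝ) - G.card ≤ ∑ i, ‖Q (Ψ.e i)‖ ^ 2 := by
    have h11 : ∀ i, ‖Q (Ψ.e i)‖ ^ 2 = 1 - ‖W.starProjection (Ψ.e i)‖ ^ 2 := fun i => by
      have := W.norm_sq_eq_add_norm_sq_starProjection (Ψ.e i)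
      rw [Ψ.orthonormal_e.1] at this
      linarith
    simp_rw [h11]
    rw [Finset.sum_sub_distrib]
    simp only [Finset.sum_const, Finset.card_univ, Fintype.card_fin, nsmul_eq_mul, mul_one]
    linarith
  have hL := Ψ.size_pos'
  calc ‖c‖ ^ 2 * (1 - (G.card : ℝ) / Ψ.size) = ‖c‖ ^ 2 * (Ψ.size : ℝ)⁻¹ * (Ψ.size - G.card) := by
        field_simp
    _ ≤ ‖c‖ ^ 2 * (Ψ.size : ℝ)⁻¹ * ∑ i, ‖Q (Ψ.e i)‖ ^ 2 := by gcongr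
    _ = ‖opTensor Q (ContinuousLinearMap.id ℂ B)
          (c • Ψ.vec - ∑ j ∈ G, prodVec (x j) (y j))‖ ^ 2 := by
        rw [h2, norm_smul, mul_pow, h3, norm_mul, mul_pow, Complex.norm_real, Real.norm_eq_abs,
          sq_abs, inv_pow, Real.sq_sqrt hL.le]
    _ ≤ _ := by gcongr

end MaxEnt

section Converse

variable {HA HB : Type u}
  [NormedAddCommGroup HA] [InnerProductSpace ℂ HA] [CompleteSpace HA]
  [NormedAddCommGroup HB] [InnerProductSpace ℂ HB] [CompleteSpace HB]

theorem LOCC.hasSum_norm_branch_sq (C : LOCC HA HB) (Φ : HTensor HA HB) :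
    HasSum (fun l => ‖C.branch Φ l‖ ^ 2) (‖Φ‖ ^ 2) := by
  have h := C.tsum_enorm_branch Φ
  simp_rw [enorm_sq_eq_ofReal] at h
  have hne : ∑' l, ENNReal.ofReal (‖C.branch Φ l‖ ^ 2) ≠ ⊤ := by rw [h]; simp
  have h1 := ENNReal.summable_toReal hne
  simp_rw [ENNReal.toReal_ofReal (sq_nonneg _)] at h1
  have h2 := congrArg ENNReal.toReal h
  rw [ENNReal.tsum_toReal_eq (fun _ => ENNReal.ofReal_ne_top),
    ENNReal.toReal_ofReal (sq_nonneg _)] at h2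
  simp_rw [ENNReal.toReal_ofReal (sq_nonneg _)] at h2
  exact h2 ▸ h1.hasSum

theorem LOCC.hasSum_state (C : LOCC HA HB) (S : Set C.ι) (Φ : HTensor HA HB) :
    HasSum (fun l : S => InnerProductSpace.rankOne ℂ (C.branch Φ l) (C.branch Φ l))
      (C.state S Φ) := by
  refine Summable.hasSum (Summable.of_norm ?_)
  simp only [InnerProductSpace.norm_rankOne, ← pow_two]
  exact (C.hasSum_norm_branch_sq Φ).summable.subtype S

theorem LOCC.hasSum_overlap (C : LOCC HA HB) (S : Set C.ι) (Φ : HTensor HA HB)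
    (x : HTensor C.KA C.KB) :
    HasSum (fun l : S => ‖⟪x, C.branch Φ l⟫_ℂ‖ ^ 2) (RCLike.re ⟪x, C.state S Φ x⟫_ℂ) := by
  have h1 : HasSum (fun l : S => ⟪x, ⟪C.branch Φ l, x⟫_ℂ • C.branch Φ l⟫_ℂ)
      ⟪x, C.state S Φ x⟫_ℂ :=
    (C.hasSum_state S Φ).mapL
      ((innerSL ℂ x) ∘L (ContinuousLinearMap.apply ℂ (HTensor C.KA C.KB) x))
  have h2 := (Complex.hasSum_iff _ _).1 h1 |>.1
  refine (congrArg (fun f => HasSum f _) (funext fun l => ?_)).mpr h2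
  rw [inner_smul_right, ← inner_conj_symm (C.branch Φ l), ← Complex.normSq_eq_conj_mul_self,
    Complex.normSq_eq_norm_sq, Complex.ofReal_re]

theorem LOCC.prob_eq (C : LOCC HA HB) (S : Set C.ι) (Φ : HTensor HA HB) :
    C.prob S Φ = ENNReal.ofReal (∑' l : S, ‖C.branch Φ l‖ ^ 2) := by
  have h : Summable fun l : S => ‖C.branch Φ l‖ ^ 2 :=
    (C.hasSum_norm_branch_sq Φ).summable.subtype S
  rw [LOCC.prob, ENNReal.ofReal_tsum_of_nonneg (fun _ => by positivity) h]
  simp_rw [enorm_sq_eq_ofReal]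

theorem LOCC.prob_add_prob_compl (C : LOCC HA HB) (S : Set C.ι) (Φ : HTensor HA HB) :
    C.prob S Φ + C.prob Sᶜ Φ = ‖Φ‖ₑ ^ 2 := by
  rw [← C.tsum_enorm_branch Φ]
  exact Summable.tsum_add_tsum_compl (f := fun l => ‖C.branch Φ l‖ₑ ^ 2) (s := S)
    ENNReal.summable ENNReal.summable

theorem DFLEC.hasSum_fidelity (P : DFLEC HA HB) (Φ : HTensor HA HB) :
    HasSum (fun l => ‖⟪P.Ψ.vec, P.C.branch Φ l⟫_ℂ‖ ^ 2) (P.fidelity Φ) := by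
  have h := P.C.hasSum_overlap Set.univ Φ P.Ψ.vec
  exact (Equiv.Set.univ P.C.ι).symm.hasSum_iff.2 h

theorem DFLEC.fidelity_nonneg (P : DFLEC HA HB) (Φ : HTensor HA HB) : 0 ≤ P.fidelity Φ :=
  (P.hasSum_fidelity Φ).nonneg fun _ => by positivity

theorem DFLEC.fidelity_le (P : DFLEC HA HB) (Φ : HTensor HA HB) : P.fidelity Φ ≤ ‖Φ‖ ^ 2 := by
  refine hasSum_le (fun l => ?_) (P.hasSum_fidelity Φ) (P.C.hasSum_norm_branch_sq Φ)
  have := norm_inner_le_norm (𝕜 := ℂ) P.Ψ.vec (P.C.branch Φ l)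
  rw [P.Ψ.norm_vec, one_mul] at this
  gcongr

theorem DFLEC.fidelity_prodVec_le (P : DFLEC HA HB) (a : HA) (b : HB) :
    P.fidelity (prodVec a b) ≤ ‖prodVec a b‖ ^ 2 / P.Ψ.size := by
  refine hasSum_le (fun l => ?_) (P.hasSum_fidelity _)
    ((P.C.hasSum_norm_branch_sq _).div_const _)
  rw [LOCC.branch, opTensor_prodVec]
  exact P.Ψ.norm_inner_prodVec_sq_le _ _

/-- The overlaps of the final vectors with the target state, as a square summable family. -/
noncomputable def DFLEC.overlap (P : DFLEC HA HB) :
    HTensor HA HB →ₗ[ℂ] lp (fun _ : P.C.ι => ℂ) 2 where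
  toFun Φ := ⟨fun l => ⟪P.Ψ.vec, P.C.branch Φ l⟫_ℂ,
    memℓp_gen (by simpa using (P.hasSum_fidelity Φ).summable)⟩
  map_add' x y := by
    ext l
    simp only [LOCC.branch, map_add, inner_add_right]
    rfl
  map_smul' c x := by
    ext l
    simp only [LOCC.branch, map_smul, inner_smul_right]
    rfl

theorem DFLEC.norm_overlap (P : DFLEC HA HB) (Φ : HTensor HA HB) :
    ‖P.overlap Φ‖ = √(P.fidelity Φ) := by
  have h := lp.norm_rpow_eq_tsum (p := 2) (by norm_num) (P.overlap Φ)
  have h2 : ‖P.overlap Φ‖ ^ 2 = P.fidelity Φ := by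
    rw [← (P.hasSum_fidelity Φ).tsum_eq]
    simp only [ENNReal.toReal_ofNat, Real.rpow_ofNat] at h
    exact h
  rw [← h2, Real.sqrt_sq (norm_nonneg _)]

theorem DFLEC.sqrt_fidelity_le (P : DFLEC HA HB) {Φ : HTensor HA HB} (hΦ : ‖Φ‖ = 1)
    (D : Schmidt Φ) (G : Finset D.J) :
    √(P.fidelity Φ) ≤ √(1 - ∑ j ∈ G, D.p j) + (∑ j ∈ G, √(D.p j)) / √(P.Ψ.size : ℝ) := by
  have h1 : P.overlap Φ = P.overlap (Φ - D.trunc G) +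
      ∑ j ∈ G, ((√(D.p j) : ℝ) : ℂ) • P.overlap (prodVec (D.a j) (D.b j)) := by
    conv_lhs => rw [← sub_add_cancel Φ (D.trunc G), map_add]
    rw [Schmidt.trunc, map_sum]
    simp only [map_smul]
  rw [← P.norm_overlap, h1]
  refine (norm_add_le _ _).trans (add_le_add ?_ ?_)
  · rw [P.norm_overlap, ← D.norm_sub_trunc_sq hΦ G]
    exact Real.sqrt_le_sqrt (P.fidelity_le _)
  · rw [Finset.sum_div]
    refine (norm_sum_le _ _).trans (Finset.sum_le_sum fun j _ => ?_)
    rw [norm_smul, Complex.norm_real, Real.norm_eq_abs, abs_of_nonneg (Real.sqrt_nonneg _),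
      div_eq_mul_inv]
    gcongr
    rw [P.norm_overlap, ← Real.sqrt_inv]
    refine Real.sqrt_le_sqrt ((P.fidelity_prodVec_le _ _).trans (le_of_eq ?_))
    rw [norm_prodVec, D.orthonormal_a.1, D.orthonormal_b.1]
    simp

variable {Φ : HTensor HA HB}

theorem PFLEC.succProb_add_failProb (I : PFLEC Φ) (hΦ : ‖Φ‖ = 1) :
    I.succProb + I.failProb = 1 := by
  rw [PFLEC.succProb, PFLEC.failProb, LOCC.prob_add_prob_compl, enorm_sq_eq_ofReal, hΦ]
  simp

theorem PFLEC.succProb_ne_top (I : PFLEC Φ) : I.succProb ≠ ⊤ := by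
  rw [PFLEC.succProb, LOCC.prob_eq]; exact ENNReal.ofReal_ne_top

/-- The deterministic concentration given by ignoring the success flag. -/
def PFLEC.toDFLEC (I : PFLEC Φ) : DFLEC HA HB := ⟨I.C, I.Ψ⟩

theorem PFLEC.hasSum_overlap (I : PFLEC Φ) :
    HasSum (fun l : I.success => ‖⟪I.Ψ.vec, I.C.branch Φ l⟫_ℂ‖ ^ 2) I.succProb.toReal := by
  have h := I.C.hasSum_overlap I.success Φ I.Ψ.vec
  have hne : ((I.succProb.toReal : ℝ) : ℂ) ≠ 0 := by
    have := ENNReal.toReal_ne_zero.2 ⟨I.prob_ne_zero, I.succProb_ne_top⟩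
    exact_mod_cast this
  have h1 : I.C.state I.success Φ =
      ((I.succProb.toReal : ℝ) : ℂ) • InnerProductSpace.rankOne ℂ I.Ψ.vec I.Ψ.vec := by
    rw [← I.state_eq, smul_smul]
    change _ = (((I.succProb.toReal : ℝ) : ℂ) * ((I.succProb.toReal : ℝ) : ℂ)⁻¹) • _
    rw [mul_inv_cancel₀ hne, one_smul]
  rw [h1] at h
  convert h using 1
  rw [_root_.smul_apply, InnerProductSpace.rankOne_apply, inner_smul_right,
    inner_smul_right, inner_self_eq_norm_sq_to_K, I.Ψ.norm_vec]
  simp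

theorem PFLEC.succProb_le_fidelity (I : PFLEC Φ) :
    I.succProb.toReal ≤ I.toDFLEC.fidelity Φ := by
  have h2 : HasSum (fun l => ‖⟪I.Ψ.vec, I.C.branch Φ l⟫_ℂ‖ ^ 2) (I.toDFLEC.fidelity Φ) :=
    I.toDFLEC.hasSum_fidelity Φ
  rw [← I.hasSum_overlap.tsum_eq, ← h2.tsum_eq]
  exact h2.summable.tsum_subtype_le _ I.success (fun _ => by positivity)

theorem PFLEC.ofReal_one_sub_fidelity_le (I : PFLEC Φ) (hΦ : ‖Φ‖ = 1) :
    ENNReal.ofReal (1 - I.toDFLEC.fidelity Φ) ≤ I.failProb := by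
  have h := I.succProb_add_failProb hΦ
  have hf : I.failProb ≠ ⊤ := by
    intro hf; rw [hf] at h; simp at h
  have h2 := congrArg ENNReal.toReal h
  rw [ENNReal.toReal_add I.succProb_ne_top hf, ENNReal.toReal_one] at h2
  rw [← ENNReal.ofReal_toReal hf]
  exact ENNReal.ofReal_le_ofReal (by linarith [I.succProb_le_fidelity])

theorem PFLEC.branch_eq (I : PFLEC Φ) (l : I.success) :
    I.C.branch Φ l = ⟪I.Ψ.vec, I.C.branch Φ l⟫_ℂ • I.Ψ.vec := by
  have h1 := I.hasSum_overlap
  have h2 : HasSum (fun l : I.success => ‖I.C.branch Φ l‖ ^ 2) I.succProb.toReal := by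
    rw [PFLEC.succProb, LOCC.prob_eq,
      ENNReal.toReal_ofReal (tsum_nonneg fun _ => by positivity)]
    exact ((I.C.hasSum_norm_branch_sq Φ).summable.subtype I.success).hasSum
  have h3 : ∀ v : HTensor I.C.KA I.C.KB,
      ‖v - ⟪I.Ψ.vec, v⟫_ℂ • I.Ψ.vec‖ ^ 2 = ‖v‖ ^ 2 - ‖⟪I.Ψ.vec, v⟫_ℂ‖ ^ 2 := fun v => by
    rw [norm_sub_sq (𝕜 := ℂ), inner_smul_right, ← inner_conj_symm v, Complex.mul_conj,
      norm_smul, I.Ψ.norm_vec, Complex.normSq_eq_norm_sq, RCLike.re_to_complex, Complex.ofReal_re]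
    ring
  have h4 := h2.sub h1
  rw [sub_self] at h4
  simp_rw [← h3] at h4
  have h5 := (hasSum_zero_iff_of_nonneg (fun _ => by positivity)).1 h4
  have h6 := congrFun h5 l
  simp only [Pi.zero_apply, ne_eq, OfNat.ofNat_ne_zero, not_false_eq_true, pow_eq_zero_iff,
    norm_eq_zero] at h6
  exact sub_eq_zero.1 h6

theorem PFLEC.succProb_mul_le (I : PFLEC Φ) (hΦ : ‖Φ‖ = 1) (D : Schmidt Φ) (G : Finset D.J) :
    I.succProb.toReal * (1 - (G.card : ℝ) / I.Ψ.size) ≤ 1 - ∑ j ∈ G, D.p j := by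
  have h1 := I.hasSum_overlap.mul_right (1 - (G.card : ℝ) / I.Ψ.size)
  have h2 := I.C.hasSum_norm_branch_sq (Φ - D.trunc G)
  rw [← D.norm_sub_trunc_sq hΦ G]
  rw [← h1.tsum_eq, ← h2.tsum_eq]
  refine le_trans ?_ (h2.summable.tsum_subtype_le _ I.success (fun _ => by positivity))
  refine h1.summable.tsum_le_tsum (fun l => ?_) (h2.summable.subtype _)
  have h3 : I.C.branch (Φ - D.trunc G) l = ⟪I.Ψ.vec, I.C.branch Φ l⟫_ℂ • I.Ψ.vec -
      ∑ j ∈ G, prodVec (I.C.opA l (((√(D.p j) : ℝ) : ℂ) • D.a j)) (I.C.opB l (D.b j)) := by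
    rw [← I.branch_eq l]
    simp only [LOCC.branch, map_sub, Schmidt.trunc, map_sum, map_smul, opTensor_prodVec,
      prodVec_smul_left]
  change _ ≤ ‖I.C.branch (Φ - D.trunc G) l‖ ^ 2
  rw [h3]
  exact I.Ψ.le_norm_sub_sq G _ _ _

end Converse

end EntConc

namespace EntConc

section Combinatorics

/-- A probability distribution on `G` whose weights are at most `1 / L` is a mixture of uniform
distributions on subsets of `G` with `L` elements. -/
theorem exists_uniform_decomposition {J : Type} [DecidableEq J] (G : Finset J) (q : J → ℝ)
    (L : ℕ) (hL : 0 < L) (hq : ∀ i ∈ G, 0 ≤ q i) (hsum : ∑ i ∈ G, q i = 1)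
    (hqL : ∀ i ∈ G, L * q i ≤ 1) :
    ∃ (κ : Type) (_ : Fintype κ) (t : κ → ℝ) (S : κ → Finset J) (τ : κ → J → Fin L),
      (∀ k, 0 ≤ t k) ∧ ∑ k, t k = 1 ∧ (∀ k, S k ⊆ G) ∧
      (∀ k, Set.BijOn (τ k) (S k) Set.univ) ∧
      ∀ i ∈ G, ∑ k, (if i ∈ S k then t k else 0) = L * q i := by
  have hLG : L ≤ G.card := by
    have h1 : ∑ i ∈ G, (L * q i) ≤ ∑ i ∈ G, (1 : ℝ) := Finset.sum_le_sum hqL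
    rw [← Finset.mul_sum, hsum] at h1
    simp only [mul_one, Finset.sum_const, nsmul_eq_mul] at h1
    exact_mod_cast h1
  have hne : Nonempty G := by
    have : 0 < G.card := hL.trans_le hLG
    obtain ⟨x, hx⟩ := Finset.card_pos.1 this
    exact ⟨⟨x, hx⟩⟩
  obtain ⟨H, -, hH⟩ := Finset.exists_subset_card_eq (s := (Finset.univ : Finset G)) (n := L)
    (by simpa using hLG)
  let e : H ≃ Fin L := H.equivFinOfCardEq hH
  let D : Matrix G G ℝ := fun i j =>
    if j ∈ H then q i else (1 - L * q i) / ((G.card : ℝ) - L)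
  have hHc : (Hᶜ.card : ℝ) = (G.card : ℝ) - L := by
    rw [Finset.card_compl, Fintype.card_coe, hH, Nat.cast_sub hLG]
  have hsum' : ∑ i : G, q i = 1 := by rw [Finset.sum_coe_sort G q, hsum]
  have hD : D ∈ doublyStochastic ℝ G := by
    rw [mem_doublyStochastic_iff_sum]
    refine ⟨fun i j => ?_, fun i => ?_, fun j => ?_⟩
    · simp only [D]
      split_ifs
      · exact hq i i.2
      · refine div_nonneg (by linarith [hqL i i.2]) ?_
        have : (L : ℝ) ≤ G.card := by exact_mod_cast hLG
        linarith
    · have h1 : ∑ j, D i j = ∑ j ∈ H, q i + ∑ j ∈ Hᶜ, (1 - L * q i) / ((G.card : ℝ) - L) := by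
        rw [← Finset.sum_add_sum_compl H]
        congr 1
        · exact Finset.sum_congr rfl fun j hj => by simp [D, hj]
        · exact Finset.sum_congr rfl fun j hj => by simp [D, Finset.mem_compl.1 hj]
      rw [h1, Finset.sum_const, Finset.sum_const, nsmul_eq_mul, nsmul_eq_mul, hHc, hH]
      by_cases hz : (G.card : ℝ) - L = 0
      · rw [hz, zero_mul, add_zero]
        have h2 : ∑ i ∈ G, (1 - L * q i) = 0 := by
          rw [Finset.sum_sub_distrib, ← Finset.mul_sum, hsum]
          simpa using hz
        have h3 := (Finset.sum_eq_zero_iff_of_nonneg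
          (fun i hi => by linarith [hqL i hi])).1 h2 i i.2
        linarith
      · field_simp
        ring
    · by_cases hj : j ∈ H
      · simp [D, hj, hsum', -Finset.univ_eq_attach]
      · have hpos : (G.card : ℝ) - L ≠ 0 := by
          rw [← hHc]
          have : 0 < Hᶜ.card := Finset.card_pos.2 ⟨j, Finset.mem_compl.2 hj⟩
          positivity
        simp only [D, hj, if_false]
        rw [← Finset.sum_div, Finset.sum_sub_distrib, ← Finset.mul_sum, hsum']
        simp only [Finset.sum_const, Finset.card_univ, Fintype.card_coe, nsmul_eq_mul, mul_one]
        exact div_self hpos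
  obtain ⟨t, ht, ht1, htD⟩ := exists_eq_sum_perm_of_mem_doublyStochastic hD
  let τ₀ : G → Fin L := fun j => if h : j ∈ H then e ⟨j, h⟩ else ⟨0, hL⟩
  have hτ₀ : Set.BijOn τ₀ H Set.univ := by
    refine ⟨fun _ _ => Set.mem_univ _, fun x hx y hy hxy => ?_, fun l _ => ?_⟩
    · have hx' : x ∈ H := hx
      have hy' : y ∈ H := hy
      simp only [τ₀, hx', hy', dif_pos] at hxy
      exact congrArg Subtype.val (e.injective hxy)
    · refine ⟨(e.symm l : G), (e.symm l).2, ?_⟩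
      simp [τ₀]
  refine ⟨Equiv.Perm G, inferInstance, t,
    fun σ => (Finset.univ.filter fun i : G => σ i ∈ H).map (Function.Embedding.subtype _),
    fun σ i => if h : i ∈ G then τ₀ (σ ⟨i, h⟩) else ⟨0, hL⟩, ht, ht1, ?_, ?_, ?_⟩
  · intro σ i hi
    obtain ⟨x, -, rfl⟩ := Finset.mem_map.1 hi
    exact x.2
  · intro σ
    refine ⟨fun _ _ => Set.mem_univ _, ?_, fun l _ => ?_⟩
    · intro x hx y hy hxy
      simp only [Finset.coe_map, Set.mem_image, Finset.mem_coe, Finset.mem_filter] at hx hy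
      obtain ⟨x, ⟨-, hx⟩, rfl⟩ := hx
      obtain ⟨y, ⟨-, hy⟩, rfl⟩ := hy
      simp only [Function.Embedding.subtype_apply, Finset.coe_mem, dif_pos, Subtype.coe_eta] at hxy
      exact congrArg Subtype.val (σ.injective (hτ₀.injOn hx hy hxy))
    · obtain ⟨j, hj, rfl⟩ := hτ₀.surjOn (Set.mem_univ l)
      refine ⟨(σ.symm j : G), ?_, by simp⟩
      simp only [Finset.coe_map, Set.mem_image, Finset.mem_coe, Finset.mem_filter]
      exact ⟨σ.symm j, ⟨Finset.mem_univ _, by simpa using hj⟩, rfl⟩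
  · intro i hi
    have h1 : ∀ j, D ⟨i, hi⟩ j = ∑ σ : Equiv.Perm G, if σ ⟨i, hi⟩ = j then t σ else 0 := by
      intro j
      rw [← htD, Matrix.sum_apply]
      refine Finset.sum_congr rfl fun σ _ => ?_
      simp [Equiv.Perm.permMatrix, PEquiv.toMatrix_apply, eq_comm]
    have h2 : ∑ j ∈ H, D ⟨i, hi⟩ j = L * q i := by
      rw [Finset.sum_congr rfl fun j hj => show D ⟨i, hi⟩ j = q i by simp [D, hj]]
      rw [Finset.sum_const, hH, nsmul_eq_mul]
    rw [← h2]
    simp_rw [h1]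
    rw [Finset.sum_comm]
    refine Finset.sum_congr rfl fun σ _ => ?_
    rw [Finset.sum_ite_eq H (σ ⟨i, hi⟩) (fun _ => t σ)]
    refine if_congr ?_ rfl rfl
    simp [hi]

end Combinatorics

section Measurements

/-- The standard space of dimension `L`. -/
abbrev Target (L : ℕ) : Type u := EuclideanSpace ℂ (ULift.{u} (Fin L))

/-- The standard basis vectors of `Target L`. -/
noncomputable def targetVec {L : ℕ} (i : Fin L) : Target.{u} L :=
  EuclideanSpace.single (ULift.up i) (1 : ℂ)

theorem orthonormal_targetVec (L : ℕ) :
    Orthonormal ℂ (targetVec : Fin L → Target.{u} L) := by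
  have h := (EuclideanSpace.basisFun (ULift.{u} (Fin L)) ℂ).orthonormal
  have h2 : (targetVec : Fin L → Target.{u} L) =
      EuclideanSpace.basisFun (ULift.{u} (Fin L)) ℂ ∘ ULift.up := by
    funext i
    simp [targetVec]
  rw [h2]
  exact h.comp ULift.up ULift.up_injective

variable {H : Type u} [NormedAddCommGroup H] [InnerProductSpace ℂ H]

/-- The operator `∑_{i ∈ G} cᵢ |g_{τ i}⟩⟨aᵢ|`. -/
noncomputable def transfer {J : Type} {L : ℕ} (a : J → H) (G : Finset J) (c : J → ℝ)
    (τ : J → Fin L) : H →L[ℂ] Target.{u} L :=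
  ∑ i ∈ G, ((c i : ℝ) : ℂ) • InnerProductSpace.rankOne ℂ (targetVec (τ i)) (a i)

theorem transfer_apply {J : Type} {L : ℕ} (a : J → H) (G : Finset J) (c : J → ℝ)
    (τ : J → Fin L) (x : H) :
    transfer a G c τ x = ∑ i ∈ G, (((c i : ℝ) : ℂ) * ⟪a i, x⟫_ℂ) • targetVec (τ i) := by
  simp only [transfer, _root_.sum_apply]
  refine Finset.sum_congr rfl fun i _ => ?_
  rw [_root_.smul_apply, InnerProductSpace.rankOne_apply, smul_smul]

theorem norm_transfer_sq {J : Type} {L : ℕ} (a : J → H) (G : Finset J) (c : J → ℝ)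
    (τ : J → Fin L) (hτ : Set.InjOn τ G) (x : H) :
    ‖transfer a G c τ x‖ ^ 2 = ∑ i ∈ G, c i ^ 2 * ‖⟪a i, x⟫_ℂ‖ ^ 2 := by
  have hg := orthonormal_targetVec.{u} L
  have h4 : ⟪transfer a G c τ x, transfer a G c τ x⟫_ℂ =
      ((∑ i ∈ G, c i ^ 2 * ‖⟪a i, x⟫_ℂ‖ ^ 2 : ℝ) : ℂ) := by
    rw [transfer_apply, sum_inner, Complex.ofReal_sum]
    refine Finset.sum_congr rfl fun i hi => ?_
    rw [inner_sum, Finset.sum_eq_single i]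
    · rw [inner_smul_left, inner_smul_right, inner_self_eq_norm_sq_to_K, hg.1, map_mul,
        Complex.conj_ofReal]
      have : (starRingEnd ℂ) ⟪a i, x⟫_ℂ * ⟪a i, x⟫_ℂ = ((‖⟪a i, x⟫_ℂ‖ ^ 2 : ℝ) : ℂ) := by
        rw [← Complex.normSq_eq_conj_mul_self, Complex.normSq_eq_norm_sq]
      push_cast at this ⊢
      linear_combination ((c i : ℂ)) ^ 2 * this
    · intro k hk hki
      rw [inner_smul_left, inner_smul_right, hg.2 (fun h => hki (hτ hi hk h).symm), mul_zero,
        mul_zero]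
    · exact fun h => absurd hi h
  rw [inner_self_eq_norm_sq_to_K] at h4
  apply Complex.ofReal_injective
  rw [← h4]; push_cast; rfl

/-- Finitely many operators whose squares add up to the projection to the span of finitely many
orthonormal vectors can be completed to a measurement. -/
theorem exists_measurement [CompleteSpace H] {J : Type} {a : J → H} (ha : Orthonormal ℂ a)
    (G : Finset J)
    {L : ℕ} (hL : 0 < L) {κ : Type} [Fintype κ] (K : κ → (H →L[ℂ] Target.{u} L))
    (hK : ∀ x, ∑ k, ‖K k x‖ ^ 2 = ∑ i ∈ G, ‖⟪a i, x⟫_ℂ‖ ^ 2) :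
    ∃ (κ' : Type u) (K' : κ' → (H →L[ℂ] Target.{u} L)),
      IsMeasurement (Sum.elim (fun k : ULift.{u} κ => K k.down) K') := by
  let W : Submodule ℂ H := (Submodule.span ℂ (a '' (G : Set J)))ᗮ
  obtain ⟨w, b, -⟩ := exists_hilbertBasis ℂ W
  refine ⟨w, fun c => InnerProductSpace.rankOne ℂ (targetVec ⟨0, hL⟩) (b c : H), fun x => ?_⟩
  let y : H := x - ∑ i ∈ G, ⟪a i, x⟫_ℂ • a i
  have hay : ∀ i ∈ G, ⟪a i, y⟫_ℂ = 0 := fun i hi => by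
    simp only [y, inner_sub_right]
    rw [ha.inner_right_sum _ hi, sub_self]
  have hyW : y ∈ W := by
    rw [Submodule.mem_orthogonal]
    intro u hu
    induction hu using Submodule.span_induction with
    | mem u hu => obtain ⟨i, hi, rfl⟩ := hu; exact hay i hi
    | zero => simp
    | add u v _ _ h1 h2 => rw [inner_add_left, h1, h2, add_zero]
    | smul c u _ h1 => rw [inner_smul_left, h1, mul_zero]
  have hbx : ∀ c, ⟪(b c : H), x⟫_ℂ = ⟪b c, (⟨y, hyW⟩ : W)⟫_ℂ := fun c => by
    have h1 : x = y + ∑ i ∈ G, ⟪a i, x⟫_ℂ • a i := by simp [y]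
    rw [Submodule.coe_inner]
    conv_lhs => rw [h1]
    rw [inner_add_right, inner_sum, Finset.sum_eq_zero, add_zero]
    intro i hi
    have h2 : a i ∈ Submodule.span ℂ (a '' (G : Set J)) := Submodule.subset_span ⟨i, hi, rfl⟩
    rw [inner_smul_right, Submodule.inner_left_of_mem_orthogonal h2 (b c).2, mul_zero]
  have hnorm : ‖x‖ ^ 2 = ∑ i ∈ G, ‖⟪a i, x⟫_ℂ‖ ^ 2 + ‖y‖ ^ 2 := by
    have h1 : x = ∑ i ∈ G, ⟪a i, x⟫_ℂ • a i + y := by simp [y]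
    have h2 : ⟪∑ i ∈ G, ⟪a i, x⟫_ℂ • a i, y⟫_ℂ = 0 := by
      rw [sum_inner]
      refine Finset.sum_eq_zero fun i hi => ?_
      rw [inner_smul_left, hay i hi, mul_zero]
    have h3 : ‖∑ i ∈ G, ⟪a i, x⟫_ℂ • a i‖ ^ 2 = ∑ i ∈ G, ‖⟪a i, x⟫_ℂ‖ ^ 2 := by
      have h4 := ha.inner_sum (fun i => ⟪a i, x⟫_ℂ) (fun i => ⟪a i, x⟫_ℂ) G
      rw [inner_self_eq_norm_sq_to_K] at h4
      apply Complex.ofReal_injective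
      push_cast
      refine h4.trans (Finset.sum_congr rfl fun i _ => ?_)
      rw [← Complex.normSq_eq_conj_mul_self, Complex.normSq_eq_norm_sq]
      push_cast; rfl
    conv_lhs => rw [h1]
    rw [norm_add_sq (𝕜 := ℂ), h2, h3]
    simp
  have hb := HilbertBasis_hasSum_sq b (⟨y, hyW⟩ : W)
  rw [hnorm, ← hK x]
  refine HasSum.sum ?_ ?_
  · have h5 := hasSum_fintype (fun k : ULift.{u} κ => ‖K k.down x‖ ^ 2)
    have h6 : ∑ k : ULift.{u} κ, ‖K k.down x‖ ^ 2 = ∑ k, ‖K k x‖ ^ 2 :=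
      Fintype.sum_equiv Equiv.ulift _ _ fun _ => rfl
    rw [h6] at h5
    exact h5
  · refine (congrArg (fun f => HasSum f _) (funext fun c => ?_)).mpr hb
    simp only [Function.comp_apply, Sum.elim_inr, InnerProductSpace.rankOne_apply]
    rw [norm_smul, (orthonormal_targetVec L).1, mul_one, hbx]

end Measurements

section Achievability

variable {HA HB : Type u}
  [NormedAddCommGroup HA] [InnerProductSpace ℂ HA] [CompleteSpace HA]
  [NormedAddCommGroup HB] [InnerProductSpace ℂ HB] [CompleteSpace HB] {Φ : HTensor HA HB}

theorem transfer_self {H : Type u} [NormedAddCommGroup H] [InnerProductSpace ℂ H]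
    {J : Type} {L : ℕ} {a : J → H} (ha : Orthonormal ℂ a) (G : Finset J)
    (c : J → ℝ) (τ : J → Fin L) [DecidableEq J] (j : J) :
    transfer.{u} a G c τ (a j) = if j ∈ G then ((c j : ℝ) : ℂ) • targetVec (τ j) else 0 := by
  rw [transfer_apply]
  split_ifs with h
  · rw [Finset.sum_eq_single j]
    · rw [inner_self_eq_norm_sq_to_K, ha.1]; simp
    · intro i _ hi
      rw [ha.2 hi, mul_zero, zero_smul]
    · exact fun h' => absurd h h'
  · refine Finset.sum_eq_zero fun i hi => ?_
    rw [ha.2 (fun h' : i = j => h (h' ▸ hi)), mul_zero, zero_smul]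

/-- A one-way protocol: Alice performs a measurement which selects Schmidt vectors with given
amplitudes, announces her outcome, and Bob relabels his vectors accordingly. -/
theorem exists_protocol (D : Schmidt Φ) {L : ℕ} (hL : 0 < L) (G : Finset D.J) {κ : Type}
    [Fintype κ] [Nonempty κ] [DecidableEq D.J] (S : κ → Finset D.J) (c : κ → D.J → ℝ)
    (τ : κ → D.J → Fin L)
    (hS : ∀ k, S k ⊆ G) (hτ : ∀ k, Set.InjOn (τ k) (S k))
    (hc : ∀ i ∈ G, ∑ k, (if i ∈ S k then c k i ^ 2 else 0) = 1) :
    ∃ (ι : Type u) (SA : ι → (HA →L[ℂ] Target.{u} L)) (SB : ι → (HB →L[ℂ] Target.{u} L)),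
      IsLOCC HA HB (Target.{u} L) (Target.{u} L) ι SA SB ∧ ∃ record : κ → ι,
        Function.Injective record ∧ ∀ k, opTensor (SA (record k)) (SB (record k)) Φ =
          ∑ i ∈ S k, ((√(D.p i) * c k i : ℝ) : ℂ) •
            prodVec (targetVec.{u} (τ k i)) (targetVec.{u} (τ k i)) := by
  obtain ⟨κA, KA, hKA⟩ := exists_measurement D.orthonormal_a G hL
    (fun k => transfer D.a (S k) (c k) (τ k)) (fun x => by
      simp_rw [norm_transfer_sq D.a _ _ _ (hτ _)]
      have h1 : ∀ k, ∑ i ∈ S k, c k i ^ 2 * ‖⟪D.a i, x⟫_ℂ‖ ^ 2 =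
          ∑ i ∈ G, (if i ∈ S k then c k i ^ 2 else 0) * ‖⟪D.a i, x⟫_ℂ‖ ^ 2 := fun k => by
        rw [← Finset.sum_subset (hS k)]
        · exact Finset.sum_congr rfl fun i hi => by rw [if_pos hi]
        · intro i _ hi
          rw [if_neg hi, zero_mul]
      simp_rw [h1]
      rw [Finset.sum_comm]
      refine Finset.sum_congr rfl fun i hi => ?_
      rw [← Finset.sum_mul, hc i hi, one_mul])
  have hB := fun k => exists_measurement D.orthonormal_b (S k) hL
    (fun _ : Unit => transfer D.b (S k) (fun _ => 1) (τ k)) (fun x => by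
      simp [norm_transfer_sq D.b _ _ _ (hτ k)])
  choose κB KB hKB using hB
  let kk : (Σ _ : PUnit.{u + 1}, ULift.{u} κ ⊕ κA) → κ := fun l =>
    Sum.elim ULift.down (fun _ => Classical.arbitrary κ) l.2
  refine ⟨_, _, _, (IsLOCC.start.alice (fun _ => _) (fun _ => hKA)).bob
    (fun l => _) (fun l => hKB (kk l)),
    fun k => ⟨⟨PUnit.unit, Sum.inl ⟨k⟩⟩, Sum.inl ⟨()⟩⟩, ?_, ?_⟩
  · intro k k' h
    have h1 := congrArg (fun z => kk z.1) h
    exact h1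
  · intro k
    change opTensor ((transfer D.a (S k) (c k) (τ k)) ∘L ContinuousLinearMap.id ℂ HA)
      ((transfer D.b (S k) (fun _ => 1) (τ k)) ∘L ContinuousLinearMap.id ℂ HB) Φ = _
    rw [ContinuousLinearMap.comp_id, ContinuousLinearMap.comp_id]
    have h1 := D.hasSum.mapL (opTensor (transfer D.a (S k) (c k) (τ k))
      (transfer D.b (S k) (fun _ => 1) (τ k)))
    refine h1.unique ?_
    have h2 : ∀ j, opTensor (transfer D.a (S k) (c k) (τ k))
        (transfer D.b (S k) (fun _ => 1) (τ k))
          (((√(D.p j) : ℝ) : ℂ) • prodVec (D.a j) (D.b j)) = if j ∈ S k then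
          ((√(D.p j) * c k j : ℝ) : ℂ) •
            prodVec (targetVec.{u} (τ k j)) (targetVec.{u} (τ k j)) else 0 := fun j => by
      rw [map_smul, opTensor_prodVec, transfer_self D.orthonormal_a,
        transfer_self D.orthonormal_b]
      split_ifs
      · rw [prodVec_smul_left, prodVec_smul_right, smul_smul, smul_smul]
        simp
      · rw [prodVec_zero_left, smul_zero]
    simp_rw [h2]
    have h3 := hasSum_sum_of_ne_finset_zero (L := .unconditional _) (s := S k)
      (f := fun j => if j ∈ S k then
          ((√(D.p j) * c k j : ℝ) : ℂ) •
            prodVec (targetVec.{u} (τ k j)) (targetVec.{u} (τ k j)) else 0)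
      (fun j hj => if_neg hj)
    convert h3 using 1
    exact Finset.sum_congr rfl fun i hi => by rw [if_pos hi]

/-- The standard maximally entangled state. -/
noncomputable def stdMaxEnt {L : ℕ} (hL : 0 < L) : MaxEnt (Target.{u} L) (Target.{u} L) where
  size := L
  size_pos := hL
  e := targetVec
  f := targetVec
  orthonormal_e := orthonormal_targetVec L
  orthonormal_f := orthonormal_targetVec L

theorem inner_stdMaxEnt {L : ℕ} (hL : 0 < L) (i : Fin L) :
    ⟪(stdMaxEnt.{u} hL).vec, prodVec (targetVec.{u} i) (targetVec.{u} i)⟫_ℂ =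
      (((√(L : ℝ))⁻¹ : ℝ) : ℂ) := by
  have hg := orthonormal_targetVec.{u} L
  rw [MaxEnt.inner_vec]
  change _ * ∑ k : Fin L,
    ⟪targetVec.{u} k, targetVec.{u} i⟫_ℂ * ⟪targetVec.{u} k, targetVec.{u} i⟫_ℂ
    = _
  rw [Finset.sum_eq_single i]
  · rw [inner_self_eq_norm_sq_to_K, hg.1]
    simp [stdMaxEnt]
  · intro k _ hk
    rw [hg.2 hk, mul_zero]
  · simp

theorem exists_dflec (D : Schmidt Φ) {L : ℕ} (hL : 0 < L) (G : Finset D.J) (hG : G.card ≤ L) :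
    ∃ P : DFLEC HA HB, P.Ψ.size = L ∧ (∑ j ∈ G, √(D.p j)) ^ 2 / L ≤ P.fidelity Φ := by
  classical
  let τ : D.J → Fin L := fun j =>
    if h : j ∈ G then Fin.castLE hG (G.equivFin ⟨j, h⟩) else ⟨0, hL⟩
  have hτ : Set.InjOn τ G := by
    intro x hx y hy hxy
    have hx' : x ∈ G := hx
    have hy' : y ∈ G := hy
    simp only [τ, hx', hy', dif_pos] at hxy
    simpa using hxy
  obtain ⟨ι, SA, SB, hS, record, -, hrec⟩ := exists_protocol D hL G (fun _ : Unit => G)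
    (fun _ _ => 1) (fun _ => τ) (fun _ => subset_rfl) (fun _ => hτ)
    (fun i hi => by simp [hi])
  let P : DFLEC HA HB := ⟨⟨_, _, ι, SA, SB, hS⟩, stdMaxEnt hL⟩
  refine ⟨P, rfl, ?_⟩
  refine le_trans (le_of_eq ?_) (le_hasSum (P.hasSum_fidelity Φ) (record ())
    (fun _ _ => by positivity))
  change _ = ‖⟪(stdMaxEnt.{u} hL).vec, opTensor (SA (record ())) (SB (record ())) Φ⟫_ℂ‖ ^ 2
  rw [hrec, inner_sum]
  simp_rw [inner_smul_right, inner_stdMaxEnt]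
  rw [← Finset.sum_mul, ← Complex.ofReal_sum, ← Complex.ofReal_mul, Complex.norm_real,
    Real.norm_eq_abs, sq_abs, mul_pow, inv_pow, Real.sq_sqrt (by positivity)]
  simp [div_eq_mul_inv]

theorem LOCC.normalized_state_eq (C : LOCC HA HB) (S : Set C.ι) (Ψ : MaxEnt C.KA C.KB)
    (hP : C.prob S Φ ≠ 0) (c : C.ι → ℂ) (h : ∀ l ∈ S, C.branch Φ l = c l • Ψ.vec) :
    (((C.prob S Φ).toReal : ℂ)⁻¹) • C.state S Φ = InnerProductSpace.rankOne ℂ Ψ.vec Ψ.vec := by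
  have hs : HasSum (fun l : S => ‖C.branch Φ l‖ ^ 2) (C.prob S Φ).toReal := by
    rw [LOCC.prob_eq, ENNReal.toReal_ofReal (tsum_nonneg fun _ => by positivity)]
    exact ((C.hasSum_norm_branch_sq Φ).summable.subtype S).hasSum
  have hne : ((C.prob S Φ).toReal : ℂ) ≠ 0 := by
    have : (C.prob S Φ).toReal ≠ 0 := by
      refine ENNReal.toReal_ne_zero.2 ⟨hP, ?_⟩
      rw [LOCC.prob_eq]; exact ENNReal.ofReal_ne_top
    exact_mod_cast this
  have h1 : C.state S Φ =
      ((C.prob S Φ).toReal : ℂ) • InnerProductSpace.rankOne ℂ Ψ.vec Ψ.vec := by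
    have h2 := (((Complex.hasSum_ofReal).2 hs).smul_const
      (InnerProductSpace.rankOne ℂ Ψ.vec Ψ.vec))
    refine (C.hasSum_state S Φ).unique
      ((congrArg (fun f => HasSum f _) (funext fun l => ?_)).mpr h2)
    rw [h l l.2, norm_smul, Ψ.norm_vec, mul_one]
    ext z
    simp only [InnerProductSpace.rankOne_apply, _root_.smul_apply, inner_smul_left, smul_smul]
    congr 1
    have : (starRingEnd ℂ) (c l) * c l = ((‖c l‖ ^ 2 : ℝ) : ℂ) := by
      rw [← Complex.normSq_eq_conj_mul_self, Complex.normSq_eq_norm_sq]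
    linear_combination ⟪Ψ.vec, z⟫_ℂ * this
  rw [h1, smul_smul, inv_mul_cancel₀ hne, one_smul]

theorem exists_pflec (D : Schmidt Φ) {L : ℕ} (hL : 0 < L) (G : Finset D.J)
    (hG : G.Nonempty) (hLG : ∀ i ∈ G, L * D.p i ≤ ∑ j ∈ G, D.p j) :
    ∃ I : PFLEC Φ, I.Ψ.size = L ∧ I.succProb = ENNReal.ofReal (∑ j ∈ G, D.p j) := by
  classical
  set w := ∑ j ∈ G, D.p j with hw
  have hwpos : 0 < w := Finset.sum_pos (fun j _ => D.p_pos j) hG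
  have hL' : (0 : ℝ) < L := by exact_mod_cast hL
  obtain ⟨κ, hκ, t, S, τ, ht, ht1, hS, hτ, hsum⟩ := exists_uniform_decomposition G
    (fun j => D.p j / w) L hL (fun i _ => div_nonneg (D.p_pos i).le hwpos.le)
    (by rw [← Finset.sum_div, ← hw, div_self hwpos.ne'])
    (fun i hi => by rw [← mul_div_assoc, div_le_one hwpos]; exact hLG i hi)
  have hne : Nonempty κ := by
    by_contra h
    rw [not_nonempty_iff] at h
    simp at ht1
  obtain ⟨ι, SA, SB, hLOCC, record, hrinj, hrec⟩ := exists_protocol D hL G S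
    (fun k i => √(t k * w / (L * D.p i))) τ hS (fun k => (hτ k).injOn)
    (fun i hi => by
      have hp := D.p_pos i
      have h1 : ∀ k, (if i ∈ S k then √(t k * w / (L * D.p i)) ^ 2 else 0) =
          (if i ∈ S k then t k else 0) * (w / (L * D.p i)) := fun k => by
        split_ifs
        · rw [Real.sq_sqrt (by have := ht k; positivity), mul_div_assoc]
        · rw [zero_mul]
      simp_rw [h1]
      rw [← Finset.sum_mul, hsum i hi]
      field_simp)
  have hv : ∀ k, opTensor (SA (record k)) (SB (record k)) Φ =
      ((√(t k * w) : ℝ) : ℂ) • (stdMaxEnt.{u} hL).vec := fun k => by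
    have h1 : ∀ i, √(D.p i) * √(t k * w / (L * D.p i)) = √(t k * w) * (√(L : ℝ))⁻¹ := fun i => by
      have hp := D.p_pos i
      rw [← Real.sqrt_mul hp.le, ← Real.sqrt_inv, ← Real.sqrt_mul (mul_nonneg (ht k) hwpos.le)]
      congr 1
      field_simp
    rw [hrec]
    simp_rw [h1]
    rw [← Finset.smul_sum, Complex.ofReal_mul, mul_smul, MaxEnt.vec]
    congr 2
    refine Finset.sum_bij (fun i _ => τ k i) (fun _ _ => Finset.mem_univ _)
      (fun i hi j hj h => (hτ k).injOn hi hj h) (fun l _ => ?_) (fun i _ => rfl)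
    obtain ⟨i, hi, h⟩ := (hτ k).surjOn (Set.mem_univ l)
    exact ⟨i, hi, h⟩
  let C : LOCC HA HB := ⟨_, _, ι, SA, SB, hLOCC⟩
  let Ψ : MaxEnt C.KA C.KB := stdMaxEnt hL
  have hbr : ∀ k, C.branch Φ (record k) = ((√(t k * w) : ℝ) : ℂ) • Ψ.vec := hv
  have hprob : C.prob (Set.range record) Φ = ENNReal.ofReal w := by
    rw [LOCC.prob, ← (Equiv.ofInjective record hrinj).tsum_eq]
    simp only [Equiv.ofInjective_apply]
    rw [tsum_fintype]
    have h1 : ∀ k, ‖C.branch Φ (record k)‖ₑ ^ 2 = ENNReal.ofReal (t k * w) := fun k => by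
      rw [hbr, enorm_sq_eq_ofReal, norm_smul, Ψ.norm_vec, mul_one, Complex.norm_real,
        Real.norm_eq_abs, sq_abs, Real.sq_sqrt (mul_nonneg (ht k) hwpos.le)]
    simp_rw [h1]
    rw [← ENNReal.ofReal_sum_of_nonneg (fun k _ => mul_nonneg (ht k) hwpos.le), ← Finset.sum_mul,
      ht1, one_mul]
  have hprob0 : C.prob (Set.range record) Φ ≠ 0 := by
    rw [hprob]; simpa using hwpos
  refine ⟨⟨C, Set.range record, Ψ, hprob0, C.normalized_state_eq _ Ψ hprob0
    (fun l => ⟪Ψ.vec, C.branch Φ l⟫_ℂ) ?_⟩, rfl, hprob⟩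
  rintro _ ⟨k, rfl⟩
  rw [hbr, inner_smul_right, inner_self_eq_norm_sq_to_K, Ψ.norm_vec]
  simp

end Achievability

end EntConc

namespace EntConc

section LogScale

theorem log_ofReal_exp (t : ℝ) : ENNReal.log (ENNReal.ofReal (Real.exp t)) = (t : EReal) := by
  rw [ENNReal.log_ofReal_of_pos (Real.exp_pos t), Real.log_exp]

theorem log_div_lt_iff {n : ℕ} (hn : 0 < n) (x : ℝ≥0∞) (c : ℝ) :
    ENNReal.log x / n < (c : EReal) ↔ x < ENNReal.ofReal (Real.exp (n * c)) := by
  have h0 : (0 : EReal) < (n : EReal) := by exact_mod_cast hn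
  have h1 : (n : EReal) ≠ ⊤ := EReal.natCast_ne_top n
  rw [EReal.div_lt_iff h0 h1, ← ENNReal.log_strictMono.lt_iff_lt (a := x), log_ofReal_exp]
  have : (c : EReal) * (n : EReal) = ((n * c : ℝ) : EReal) := by
    rw [mul_comm, EReal.coe_mul]; rfl
  rw [this]

theorem lt_log_div_iff {n : ℕ} (hn : 0 < n) (x : ℝ≥0∞) (c : ℝ) :
    (c : EReal) < ENNReal.log x / n ↔ ENNReal.ofReal (Real.exp (n * c)) < x := by
  have h0 : (0 : EReal) < (n : EReal) := by exact_mod_cast hn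
  have h1 : (n : EReal) ≠ ⊤ := EReal.natCast_ne_top n
  rw [EReal.lt_div_iff h0 h1, ← ENNReal.log_strictMono.lt_iff_lt (b := x), log_ofReal_exp]
  have : (c : EReal) * (n : EReal) = ((n * c : ℝ) : EReal) := by
    rw [mul_comm, EReal.coe_mul]; rfl
  rw [this]

theorem exponent_eq (n : ℕ) (q : ℝ≥0∞) : exponent n q = -(ENNReal.log q / n) := by
  rw [exponent, div_eq_mul_inv, EReal.neg_mul, ← div_eq_mul_inv]

theorem exponent_lt_iff {n : ℕ} (hn : 0 < n) (q : ℝ≥0∞) (r : ℝ) :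
    exponent n q < (r : EReal) ↔ ENNReal.ofReal (Real.exp (-(n * r))) < q := by
  rw [exponent_eq, EReal.neg_lt_comm, ← EReal.coe_neg, lt_log_div_iff hn, mul_neg]

theorem lt_exponent_iff {n : ℕ} (hn : 0 < n) (q : ℝ≥0∞) (r : ℝ) :
    (r : EReal) < exponent n q ↔ q < ENNReal.ofReal (Real.exp (-(n * r))) := by
  rw [exponent_eq, EReal.lt_neg_comm, ← EReal.coe_neg, log_div_lt_iff hn, mul_neg]

theorem le_of_forall_sub_le {x : EReal} {r : ℝ} (h : ∀ ε > 0, ((r - ε : ℝ) : EReal) ≤ x) :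
    (r : EReal) ≤ x := by
  refine le_of_forall_lt fun y hy => ?_
  obtain ⟨z, hz1, hz2⟩ := EReal.lt_iff_exists_real_btwn.1 hy
  have hz : z < r := by exact_mod_cast hz2
  have := h (r - z) (by linarith)
  rw [sub_sub_cancel] at this
  exact hz1.trans_le this

theorem le_of_forall_le_add {x : EReal} {r : ℝ} (h : ∀ ε > 0, x ≤ ((r + ε : ℝ) : EReal)) :
    x ≤ (r : EReal) := by
  refine le_of_forall_gt fun y hy => ?_
  obtain ⟨z, hz1, hz2⟩ := EReal.lt_iff_exists_real_btwn.1 hy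
  have hz : r < z := by exact_mod_cast hz1
  have := h (z - r) (by linarith)
  rw [add_sub_cancel] at this
  exact this.trans_lt hz2

theorem le_liminf_exponent_iff (q : ℕ → ℝ≥0∞) (r : ℝ) :
    (r : EReal) ≤ liminf (fun n => exponent n (q n)) atTop ↔
      ∀ ε > 0, ∀ᶠ n : ℕ in atTop, q n ≤ ENNReal.ofReal (Real.exp (-(n * (r - ε)))) := by
  constructor
  · intro h ε hε
    have h1 : ((r - ε : ℝ) : EReal) < liminf (fun n => exponent n (q n)) atTop :=
      lt_of_lt_of_le (by exact_mod_cast sub_lt_self r hε) h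
    filter_upwards [eventually_lt_of_lt_liminf h1, eventually_gt_atTop 0] with n hn hn0
    exact ((lt_exponent_iff hn0 _ _).1 hn).le
  · intro h
    refine le_of_forall_sub_le fun ε hε => ?_
    refine le_liminf_of_le (by isBoundedDefault) ?_
    filter_upwards [h ε hε, eventually_gt_atTop 0] with n hn hn0
    by_contra hlt
    push Not at hlt
    exact absurd hn (not_le.2 ((exponent_lt_iff hn0 _ _).1 hlt))

theorem limsup_exponent_le_iff (q : ℕ → ℝ≥0∞) (r : ℝ) :
    limsup (fun n => exponent n (q n)) atTop ≤ (r : EReal) ↔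
      ∀ ε > 0, ∀ᶠ n : ℕ in atTop, ENNReal.ofReal (Real.exp (-(n * (r + ε)))) ≤ q n := by
  constructor
  · intro h ε hε
    have h1 : limsup (fun n => exponent n (q n)) atTop < ((r + ε : ℝ) : EReal) :=
      lt_of_le_of_lt h (by exact_mod_cast lt_add_of_pos_right r hε)
    filter_upwards [eventually_lt_of_limsup_lt h1, eventually_gt_atTop 0] with n hn hn0
    exact ((exponent_lt_iff hn0 _ _).1 hn).le
  · intro h
    refine le_of_forall_le_add fun ε hε => ?_
    refine limsup_le_of_le (by isBoundedDefault) ?_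
    filter_upwards [h ε hε, eventually_gt_atTop 0] with n hn hn0
    by_contra hlt
    push Not at hlt
    exact absurd hn (not_le.2 ((lt_exponent_iff hn0 _ _).1 hlt))

theorem le_rate {L : ℕ → ℕ} {c : ℝ}
    (h : ∀ ε > 0, ∀ᶠ n : ℕ in atTop, Real.exp (n * (c - ε)) ≤ L n) : (c : EReal) ≤ rate L := by
  refine le_of_forall_sub_le fun ε hε => ?_
  refine le_liminf_of_le (by isBoundedDefault) ?_
  filter_upwards [h ε hε, eventually_gt_atTop 0] with n hn hn0
  have hn' : (0 : ℝ) < n := by exact_mod_cast hn0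
  rw [EReal.coe_le_coe_iff, le_div_iff₀ hn', mul_comm, Real.le_log_iff_exp_le]
  · exact hn
  · exact (Real.exp_pos _).trans_le hn

theorem eventually_exp_le_of_lt_rate {L : ℕ → ℕ} (hL : ∀ n, 0 < L n) {c : ℝ}
    (h : (c : EReal) < rate L) : ∀ᶠ n : ℕ in atTop, Real.exp (n * c) ≤ L n := by
  filter_upwards [eventually_lt_of_lt_liminf h, eventually_gt_atTop 0] with n hn hn0
  have hn' : (0 : ℝ) < n := by exact_mod_cast hn0
  have hL' : (0 : ℝ) < L n := by exact_mod_cast hL n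
  have h1 : c < Real.log (L n) / n := by exact_mod_cast hn
  rw [lt_div_iff₀ hn'] at h1
  rw [← Real.le_log_iff_exp_le hL', mul_comm]
  exact h1.le

theorem eventually_const_le_exp (K : ℝ) {ε : ℝ} (hε : 0 < ε) :
    ∀ᶠ n : ℕ in atTop, K ≤ Real.exp (n * ε) := by
  have h : Tendsto (fun n : ℕ => Real.exp (n * ε)) atTop atTop :=
    Real.tendsto_exp_atTop.comp (tendsto_natCast_atTop_atTop.atTop_mul_const hε)
  exact h.eventually_ge_atTop K

theorem eventually_natCast_le_exp {ε : ℝ} (hε : 0 < ε) :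
    ∀ᶠ n : ℕ in atTop, (n : ℝ) ≤ Real.exp (n * ε) := by
  filter_upwards [eventually_const_le_exp (2 / ε) (half_pos hε)] with n hn
  have h1 : n * (ε / 2) ≤ Real.exp (n * (ε / 2)) := by linarith [Real.add_one_le_exp (n * (ε / 2))]
  have h2 : Real.exp (n * ε) = Real.exp (n * (ε / 2)) * Real.exp (n * (ε / 2)) := by
    rw [← Real.exp_add]; ring_nf
  rw [h2]
  have h3 : (n : ℝ) = 2 / ε * (n * (ε / 2)) := by field_simp
  calc (n : ℝ) = 2 / ε * (n * (ε / 2)) := h3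
    _ ≤ _ := by gcongr

end LogScale

/-- A sequence of discrete probability distributions `pₙ` with positive weights such that
`(1/n) log ∑ⱼ pₙ(j) ^ s` tends to `ψ s` for all `s ≥ 0`, with `ψ` regular off `1`. -/
structure SpectralLimit {J : ℕ → Type} (p : ∀ n, J n → ℝ) (ψ : ℝ → EReal) : Prop where
  pos : ∀ n j, 0 < p n j
  hasSum : ∀ n, HasSum (p n) 1
  tendsto : ∀ s : ℝ, 0 ≤ s →
    Tendsto (fun n : ℕ => ENNReal.log (∑' j, ENNReal.ofReal (p n j ^ s)) / n) atTop (𝓝 (ψ s))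
  fin : ∀ s ∈ Set.Ioo (0 : ℝ) 1 ∪ Set.Ioi 1, ψ s ≠ ⊥ ∧ ψ s ≠ ⊤
  diff : ∀ s ∈ Set.Ioo (0 : ℝ) 1 ∪ Set.Ioi 1, DifferentiableAt ℝ (fun t => (ψ t).toReal) s ∧
      DifferentiableAt ℝ (deriv fun t => (ψ t).toReal) s

namespace SpectralLimit

variable {J : ℕ → Type} {p : ∀ n, J n → ℝ} {ψ : ℝ → EReal}

theorem le_one (h : SpectralLimit p ψ) (n : ℕ) (j : J n) : p n j ≤ 1 :=
  le_hasSum (h.hasSum n) j fun k _ => (h.pos n k).le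

theorem sum_le_one (h : SpectralLimit p ψ) (n : ℕ) (F : Finset (J n)) : ∑ j ∈ F, p n j ≤ 1 :=
  sum_le_hasSum F (fun k _ => (h.pos n k).le) (h.hasSum n)

theorem eventually_sum_le (h : SpectralLimit p ψ) {s : ℝ} (hs : 0 ≤ s) {c : ℝ}
    (hc : ψ s < (c : EReal)) :
    ∀ᶠ n : ℕ in atTop, ∀ F : Finset (J n), ∑ j ∈ F, p n j ^ s ≤ Real.exp (n * c) := by
  filter_upwards [(h.tendsto s hs).eventually (gt_mem_nhds hc), eventually_gt_atTop 0]
    with n hn hn0 F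
  rw [log_div_lt_iff hn0] at hn
  have h1 := (ENNReal.sum_le_tsum (f := fun j => ENNReal.ofReal (p n j ^ s)) F).trans hn.le
  rw [← ENNReal.ofReal_sum_of_nonneg
    (fun j _ => Real.rpow_nonneg (h.pos n j).le s)] at h1
  exact (ENNReal.ofReal_le_ofReal_iff (Real.exp_pos _).le).1 h1

theorem eventually_exists_le_sum (h : SpectralLimit p ψ) {s : ℝ} (hs : 0 ≤ s) {c : ℝ}
    (hc : (c : EReal) < ψ s) :
    ∀ᶠ n : ℕ in atTop, ∃ F : Finset (J n), Real.exp (n * c) ≤ ∑ j ∈ F, p n j ^ s := by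
  filter_upwards [(h.tendsto s hs).eventually (lt_mem_nhds hc), eventually_gt_atTop 0]
    with n hn hn0
  rw [lt_log_div_iff hn0, ENNReal.tsum_eq_iSup_sum, lt_iSup_iff] at hn
  obtain ⟨F, hF⟩ := hn
  refine ⟨F, ?_⟩
  rw [← ENNReal.ofReal_sum_of_nonneg
    (fun j _ => Real.rpow_nonneg (h.pos n j).le s)] at hF
  exact ((ENNReal.ofReal_lt_ofReal_iff_of_nonneg (Real.exp_pos _).le).1 hF).le

/-- Eventual pointwise bounds on finite power sums carry over to the limit. -/
theorem le_of_bound (h : SpectralLimit p ψ) {s : ℝ} (hs : 0 ≤ s) {x : EReal}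
    (H : ∀ c : ℝ, x < c → ∀ᶠ n : ℕ in atTop, ∀ F : Finset (J n),
      ∑ j ∈ F, p n j ^ s ≤ Real.exp (n * c)) : ψ s ≤ x := by
  by_contra hlt
  push Not at hlt
  obtain ⟨c, hc1, hc2⟩ := EReal.lt_iff_exists_real_btwn.1 hlt
  obtain ⟨c', hc1', hc2'⟩ := EReal.lt_iff_exists_real_btwn.1 hc2
  have hcc : c < c' := by exact_mod_cast hc1'
  obtain ⟨n, ⟨hn1, hn2⟩, hn0⟩ := (((H c hc1).and (h.eventually_exists_le_sum hs hc2')).and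
    (eventually_gt_atTop 0)).exists
  obtain ⟨F, hF⟩ := hn2
  have h1 := hF.trans (hn1 F)
  rw [Real.exp_le_exp] at h1
  have hn' : (0 : ℝ) < n := by exact_mod_cast hn0
  nlinarith

theorem apply_one (h : SpectralLimit p ψ) : ψ 1 = 0 := by
  refine tendsto_nhds_unique (h.tendsto 1 zero_le_one) ?_
  have h1 : ∀ n, ∑' j, ENNReal.ofReal (p n j ^ (1 : ℝ)) = 1 := fun n => by
    simp_rw [Real.rpow_one]
    rw [tsum_ofReal_of_hasSum (fun j => (h.pos n j).le) (h.hasSum n), ENNReal.ofReal_one]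
  simp_rw [h1]
  simp

theorem coe_toReal (h : SpectralLimit p ψ) {s : ℝ} (hs : 0 < s) :
    (((ψ s).toReal : ℝ) : EReal) = ψ s := by
  rcases lt_trichotomy s 1 with h1 | h1 | h1
  · have := h.fin s (Or.inl ⟨hs, h1⟩)
    exact EReal.coe_toReal this.2 this.1
  · rw [h1, h.apply_one]; simp
  · have := h.fin s (Or.inr h1)
    exact EReal.coe_toReal this.2 this.1

theorem antitone (h : SpectralLimit p ψ) {s t : ℝ} (hs : 0 ≤ s) (hst : s ≤ t) : ψ t ≤ ψ s := by
  refine h.le_of_bound (hs.trans hst) fun c hc => ?_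
  filter_upwards [h.eventually_sum_le hs hc] with n hn F
  refine le_trans (Finset.sum_le_sum fun j _ => ?_) (hn F)
  exact Real.rpow_le_rpow_of_exponent_ge (h.pos n j) (h.le_one n j) hst

theorem eventually_sum_le_real (h : SpectralLimit p ψ) {s : ℝ} (hs : 0 < s) {c : ℝ}
    (hc : (ψ s).toReal < c) :
    ∀ᶠ n : ℕ in atTop, ∀ F : Finset (J n), ∑ j ∈ F, p n j ^ s ≤ Real.exp (n * c) :=
  h.eventually_sum_le hs.le (by rw [← h.coe_toReal hs]; exact_mod_cast hc)

theorem toReal_le_of_bound (h : SpectralLimit p ψ) {s : ℝ} (hs : 0 < s) {x : ℝ}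
    (H : ∀ c : ℝ, x < c → ∀ᶠ n : ℕ in atTop, ∀ F : Finset (J n),
      ∑ j ∈ F, p n j ^ s ≤ Real.exp (n * c)) : (ψ s).toReal ≤ x := by
  have := h.le_of_bound hs.le (x := (x : EReal)) (fun c hc => H c (by exact_mod_cast hc))
  rw [← h.coe_toReal hs] at this
  exact_mod_cast this

theorem convexOn (h : SpectralLimit p ψ) :
    ConvexOn ℝ (Set.Ioi 0) (fun t => (ψ t).toReal) := by
  refine ⟨convex_Ioi 0, fun s hs t ht θ η hθ hη hsum => ?_⟩
  have hs' : 0 < s := hs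
  have ht' : 0 < t := ht
  have hm : 0 < θ * s + η * t := by
    rcases hθ.eq_or_lt with h0 | h0
    · have : η = 1 := by linarith
      rw [← h0, this]; linarith
    · have : 0 ≤ η * t := by positivity
      nlinarith [mul_pos h0 hs']
  simp only [smul_eq_mul]
  refine h.toReal_le_of_bound hm fun c hc => ?_
  set δ := c - (θ * (ψ s).toReal + η * (ψ t).toReal) with hδ
  have hδ0 : 0 < δ := by linarith
  filter_upwards [h.eventually_sum_le_real hs' (c := (ψ s).toReal + δ) (by linarith),
    h.eventually_sum_le_real ht' (c := (ψ t).toReal + δ) (by linarith)] with n hn1 hn2 F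
  set a := n * ((ψ s).toReal + δ) with ha
  set b := n * ((ψ t).toReal + δ) with hb
  have key : ∀ j, p n j ^ (θ * s + η * t) ≤
      Real.exp (n * c) * (θ * (p n j ^ s * Real.exp (-a)) + η * (p n j ^ t * Real.exp (-b))) := by
    intro j
    have hp := h.pos n j
    have h1 := Real.geom_mean_le_arith_mean2_weighted hθ hη
      (p₁ := p n j ^ s * Real.exp (-a)) (p₂ := p n j ^ t * Real.exp (-b)) (by positivity)
      (by positivity) hsum
    have h2 : (p n j ^ s * Real.exp (-a)) ^ θ * (p n j ^ t * Real.exp (-b)) ^ η =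
        p n j ^ (θ * s + η * t) * Real.exp (-(n * c)) := by
      rw [Real.mul_rpow (by positivity) (by positivity), Real.mul_rpow (by positivity)
        (by positivity), ← Real.rpow_mul hp.le, ← Real.rpow_mul hp.le, ← Real.exp_mul,
        ← Real.exp_mul, Real.rpow_add hp, mul_comm s, mul_comm t]
      have h3 : Real.exp (-(n * c)) = Real.exp (-a * θ) * Real.exp (-b * η) := by
        rw [← Real.exp_add]
        congr 1
        rw [ha, hb]
        have h4 : c = θ * (ψ s).toReal + η * (ψ t).toReal + δ * (θ + η) := by
          rw [hsum, hδ]; ring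
        rw [h4]; ring
      rw [h3]; ring
    rw [h2] at h1
    calc p n j ^ (θ * s + η * t) = Real.exp (n * c) *
          (p n j ^ (θ * s + η * t) * Real.exp (-(n * c))) := by
          rw [Real.exp_neg]; field_simp
      _ ≤ _ := by gcongr
  calc ∑ j ∈ F, p n j ^ (θ * s + η * t)
      ≤ ∑ j ∈ F, Real.exp (n * c) *
          (θ * (p n j ^ s * Real.exp (-a)) + η * (p n j ^ t * Real.exp (-b))) :=
        Finset.sum_le_sum fun j _ => key j
    _ = Real.exp (n * c) * (θ * ((∑ j ∈ F, p n j ^ s) * Real.exp (-a)) +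
          η * ((∑ j ∈ F, p n j ^ t) * Real.exp (-b))) := by
        rw [← Finset.mul_sum, Finset.sum_add_distrib, ← Finset.mul_sum, ← Finset.mul_sum,
          ← Finset.sum_mul, ← Finset.sum_mul]
    _ ≤ Real.exp (n * c) * (θ * (Real.exp a * Real.exp (-a)) +
          η * (Real.exp b * Real.exp (-b))) := by
        gcongr
        · exact hn1 F
        · exact hn2 F
    _ = Real.exp (n * c) := by
        rw [← Real.exp_add, ← Real.exp_add, add_neg_cancel, add_neg_cancel, Real.exp_zero,
          mul_one, mul_one, hsum, mul_one]

theorem toReal_le_mul (h : SpectralLimit p ψ) {s t : ℝ} (hs : 0 < s) (hst : s ≤ t) :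
    (ψ t).toReal ≤ t / s * (ψ s).toReal := by
  have ht : 0 < t := hs.trans_le hst
  refine h.toReal_le_of_bound ht fun c hc => ?_
  have hc' : (ψ s).toReal < s / t * c := by
    rw [div_mul_eq_mul_div, lt_div_iff₀ ht]
    rw [div_mul_eq_mul_div, div_lt_iff₀ hs] at hc
    linarith
  filter_upwards [h.eventually_sum_le_real hs hc'] with n hn F
  set a := n * (s / t * c)
  have h1 : ∀ j, p n j ^ (t - s) ≤ Real.exp (a * ((t - s) / s)) := fun j => by
    have hp := h.pos n j
    have h2 : p n j ^ s ≤ Real.exp a := by simpa using hn {j}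
    have h3 : (p n j ^ s) ^ ((t - s) / s) ≤ (Real.exp a) ^ ((t - s) / s) :=
      Real.rpow_le_rpow (by positivity) h2 (div_nonneg (by linarith) hs.le)
    rwa [← Real.rpow_mul hp.le, mul_div_cancel₀ _ hs.ne', ← Real.exp_mul] at h3
  calc ∑ j ∈ F, p n j ^ t = ∑ j ∈ F, p n j ^ s * p n j ^ (t - s) :=
        Finset.sum_congr rfl fun j _ => by
          rw [← Real.rpow_add (h.pos n j)]; congr 1; ring
    _ ≤ ∑ j ∈ F, p n j ^ s * Real.exp (a * ((t - s) / s)) := by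
        gcongr with j
        · exact Real.rpow_nonneg (h.pos n j).le _
        · exact h1 j
    _ = (∑ j ∈ F, p n j ^ s) * Real.exp (a * ((t - s) / s)) := by rw [Finset.sum_mul]
    _ ≤ Real.exp a * Real.exp (a * ((t - s) / s)) := by gcongr; exact hn F
    _ = Real.exp (n * c) := by
        rw [← Real.exp_add]
        congr 1
        simp only [a]
        field_simp
        ring

/-- The tilted distributions concentrate at the slope of `ψ`. -/
theorem eventually_window (h : SpectralLimit p ψ) {s : ℝ}
    (hs : s ∈ Set.Ioo (0 : ℝ) 1 ∪ Set.Ioi 1) {δ : ℝ} (hδ : 0 < δ) :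
    ∀ᶠ n : ℕ in atTop, ∃ F : Finset (J n),
      (∀ j ∈ F, Real.exp (-(n * (-deriv (fun t => (ψ t).toReal) s + δ))) ≤ p n j ∧
        p n j ≤ Real.exp (-(n * (-deriv (fun t => (ψ t).toReal) s - δ)))) ∧
      Real.exp (n * ((ψ s).toReal - δ)) ≤ ∑ j ∈ F, p n j ^ s := by
  classical
  have hs0 : 0 < s := by
    rcases hs with hs | hs
    · exact hs.1
    · exact zero_lt_one.trans hs
  set f : ℝ → ℝ := fun t => (ψ t).toReal with hf
  set a := -deriv f s with ha
  have hd : HasDerivAt f (-a) s := by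
    rw [ha, neg_neg]; exact (h.diff s hs).1.hasDerivAt
  have hlo := hd.isLittleO.def (c := δ / 4) (by positivity)
  obtain ⟨ρ, hρ, hball⟩ := Metric.eventually_nhds_iff.1 hlo
  obtain ⟨t, ht0, ht1⟩ : ∃ t, 0 < t ∧ t < min (min ρ s) 1 :=
    exists_between (by positivity)
  have htρ : t < ρ := ht1.trans_le ((min_le_left _ _).trans (min_le_left _ _))
  have hts : t < s := ht1.trans_le ((min_le_left _ _).trans (min_le_right _ _))
  have ht1' : t < 1 := ht1.trans_le (min_le_right _ _)
  have hup : f (s + t) ≤ f s - t * a + t * δ / 4 := by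
    have := hball (y := s + t) (by simpa [Real.dist_eq, abs_of_pos ht0] using htρ)
    simp only [add_sub_cancel_left, smul_eq_mul, Real.norm_eq_abs, abs_of_pos ht0] at this
    linarith [le_abs_self (f (s + t) - f s - t * -a)]
  have hdn : f (s - t) ≤ f s + t * a + t * δ / 4 := by
    have := hball (y := s - t) (by simpa [Real.dist_eq, abs_of_pos ht0] using htρ)
    simp only [sub_sub_cancel_left, smul_eq_mul, Real.norm_eq_abs, abs_neg, abs_of_pos ht0] at this
    linarith [le_abs_self (f (s - t) - f s - -t * -a)]
  set η := t * δ / 8 with hη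
  have hη0 : 0 < η := by positivity
  have htδ : t * δ ≤ δ := by nlinarith
  have hlow : ((f s - η : ℝ) : EReal) < ψ s := by
    rw [← h.coe_toReal hs0]
    have : f s - η < (ψ s).toReal := by simp only [hf]; linarith
    exact_mod_cast this
  filter_upwards [h.eventually_exists_le_sum hs0.le hlow,
    h.eventually_sum_le_real (s := s + t) (by linarith) (c := f (s + t) + η)
      (by simp only [hf]; linarith),
    h.eventually_sum_le_real (s := s - t) (by linarith) (c := f (s - t) + η)
      (by simp only [hf]; linarith),
    eventually_const_le_exp 4 (ε := t * δ / 2) (by positivity),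
    eventually_const_le_exp 2 (ε := δ - η) (by linarith)] with n h1 h2 h3 h4 h5
  obtain ⟨F₀, hF₀⟩ := h1
  let hi := F₀.filter fun j => Real.exp (-(n * (a - δ))) < p n j
  let lo := F₀.filter fun j => p n j < Real.exp (-(n * (a + δ)))
  let F := F₀.filter fun j => Real.exp (-(n * (a + δ))) ≤ p n j ∧ p n j ≤ Real.exp (-(n * (a - δ)))
  refine ⟨F, fun j hj => (Finset.mem_filter.1 hj).2, ?_⟩
  have hhi : ∑ j ∈ hi, p n j ^ s ≤ Real.exp (n * (f s - η)) * Real.exp (-(n * (t * δ / 2))) := by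
    calc ∑ j ∈ hi, p n j ^ s ≤ ∑ j ∈ hi, p n j ^ (s + t) * Real.exp (n * (a - δ) * t) := by
          refine Finset.sum_le_sum fun j hj => ?_
          have hp := h.pos n j
          have h6 := (Finset.mem_filter.1 hj).2
          have h7 : Real.exp (-(n * (a - δ))) ^ t ≤ p n j ^ t :=
            Real.rpow_le_rpow (Real.exp_pos _).le h6.le ht0.le
          rw [← Real.exp_mul] at h7
          rw [Real.rpow_add hp]
          have h8 : 1 ≤ p n j ^ t * Real.exp (n * (a - δ) * t) := by
            calc (1 : ℝ) = Real.exp (-(n * (a - δ)) * t) * Real.exp (n * (a - δ) * t) := by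
                  rw [← Real.exp_add, ← Real.exp_zero]; congr 1; ring
              _ ≤ _ := by gcongr
          have h9 : 0 ≤ p n j ^ s := by positivity
          nlinarith
      _ = (∑ j ∈ hi, p n j ^ (s + t)) * Real.exp (n * (a - δ) * t) := by rw [Finset.sum_mul]
      _ ≤ Real.exp (n * (f (s + t) + η)) * Real.exp (n * (a - δ) * t) := by
          gcongr; exact h2 hi
      _ ≤ _ := by
          rw [← Real.exp_add, ← Real.exp_add, Real.exp_le_exp]
          have : (n : ℝ) * (f (s + t) + η + (a - δ) * t) ≤ n * (f s - η - t * δ / 2) :=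
            mul_le_mul_of_nonneg_left (by rw [hη]; linarith) n.cast_nonneg
          linarith
  have hlo' : ∑ j ∈ lo, p n j ^ s ≤ Real.exp (n * (f s - η)) * Real.exp (-(n * (t * δ / 2))) := by
    calc ∑ j ∈ lo, p n j ^ s ≤ ∑ j ∈ lo, p n j ^ (s - t) * Real.exp (-(n * (a + δ)) * t) := by
          refine Finset.sum_le_sum fun j hj => ?_
          have hp := h.pos n j
          have h6 := (Finset.mem_filter.1 hj).2
          have h7 : p n j ^ t ≤ Real.exp (-(n * (a + δ))) ^ t :=
            Real.rpow_le_rpow hp.le h6.le ht0.le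
          rw [← Real.exp_mul] at h7
          calc p n j ^ s = p n j ^ (s - t) * p n j ^ t := by
                rw [← Real.rpow_add hp]; congr 1; ring
            _ ≤ _ := by gcongr
      _ = (∑ j ∈ lo, p n j ^ (s - t)) * Real.exp (-(n * (a + δ)) * t) := by rw [Finset.sum_mul]
      _ ≤ Real.exp (n * (f (s - t) + η)) * Real.exp (-(n * (a + δ)) * t) := by
          gcongr; exact h3 lo
      _ ≤ _ := by
          rw [← Real.exp_add, ← Real.exp_add, Real.exp_le_exp]
          have : (n : ℝ) * (f (s - t) + η - (a + δ) * t) ≤ n * (f s - η - t * δ / 2) :=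
            mul_le_mul_of_nonneg_left (by rw [hη]; linarith) n.cast_nonneg
          linarith
  have hsplit : ∑ j ∈ F₀, p n j ^ s ≤
      ∑ j ∈ F, p n j ^ s + ∑ j ∈ hi, p n j ^ s + ∑ j ∈ lo, p n j ^ s := by
    have hnn : ∀ j, 0 ≤ p n j ^ s := fun j => Real.rpow_nonneg (h.pos n j).le s
    simp only [F, hi, lo, Finset.sum_filter, ← Finset.sum_add_distrib]
    refine Finset.sum_le_sum fun j _ => ?_
    have := hnn j
    split_ifs <;> first | linarith | (exfalso; grind)
  have hquarter : Real.exp (-(n * (t * δ / 2))) ≤ 1 / 4 := by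
    rw [Real.exp_neg, one_div]
    exact inv_anti₀ (by norm_num) h4
  have hE := Real.exp_pos (n * (f s - η))
  have hfin : Real.exp (n * (f s - δ)) ≤ Real.exp (n * (f s - η)) / 2 := by
    have h10 : Real.exp (n * (f s - η)) = Real.exp (n * (f s - δ)) * Real.exp (n * (δ - η)) := by
      rw [← Real.exp_add]; congr 1; ring
    rw [h10, le_div_iff₀ (by norm_num)]
    gcongr
  nlinarith [mul_le_mul_of_nonneg_left hquarter hE.le]

end SpectralLimit

end EntConc

namespace EntConc

namespace SpectralLimit

variable {J : ℕ → Type} {p : ∀ n, J n → ℝ} {ψ : ℝ → EReal}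

theorem pos_of_mem {s : ℝ} (hs : s ∈ Set.Ioo (0 : ℝ) 1 ∪ Set.Ioi 1) : 0 < s := by
  rcases hs with hs | hs
  · exact hs.1
  · exact zero_lt_one.trans hs

theorem toReal_one (h : SpectralLimit p ψ) : (ψ 1).toReal = 0 := by
  rw [h.apply_one]; rfl

theorem toReal_antitone (h : SpectralLimit p ψ) {s t : ℝ} (hs : 0 < s) (hst : s ≤ t) :
    (ψ t).toReal ≤ (ψ s).toReal := by
  have := h.antitone hs.le hst
  rw [← h.coe_toReal hs, ← h.coe_toReal (hs.trans_le hst)] at this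
  exact_mod_cast this

theorem tangent_le (h : SpectralLimit p ψ) {s t : ℝ} (hs : s ∈ Set.Ioo (0 : ℝ) 1 ∪ Set.Ioi 1)
    (ht : 0 < t) :
    (ψ s).toReal + deriv (fun t => (ψ t).toReal) s * (t - s) ≤ (ψ t).toReal := by
  have hs0 := pos_of_mem hs
  rcases lt_trichotomy s t with hst | hst | hst
  · have h1 := h.convexOn.deriv_le_slope (x := s) (y := t) hs0 ht hst (h.diff s hs).1
    rw [slope_def_field, le_div_iff₀ (by linarith)] at h1
    linarith
  · subst hst; simp
  · have h1 := h.convexOn.slope_le_deriv (x := t) (y := s) ht hs0 hst (h.diff s hs).1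
    rw [slope_def_field, div_le_iff₀ (by linarith)] at h1
    linarith

theorem deriv_mono (h : SpectralLimit p ψ) {s t : ℝ} (hs : s ∈ Set.Ioo (0 : ℝ) 1 ∪ Set.Ioi 1)
    (ht : t ∈ Set.Ioo (0 : ℝ) 1 ∪ Set.Ioi 1) (hst : s ≤ t) :
    deriv (fun t => (ψ t).toReal) s ≤ deriv (fun t => (ψ t).toReal) t := by
  rcases hst.eq_or_lt with rfl | hlt
  · exact le_rfl
  have h1 := h.tangent_le hs (pos_of_mem ht)
  have h2 := h.tangent_le ht (pos_of_mem hs)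
  by_contra hcon
  push Not at hcon
  nlinarith [mul_pos (sub_pos.2 hcon) (sub_pos.2 hlt)]

theorem deriv_nonpos (h : SpectralLimit p ψ) {s : ℝ} (hs : s ∈ Set.Ioo (0 : ℝ) 1 ∪ Set.Ioi 1) :
    deriv (fun t => (ψ t).toReal) s ≤ 0 := by
  have hs0 := pos_of_mem hs
  have h1 := h.tangent_le hs (t := s + 1) (by linarith)
  have h2 := h.toReal_antitone hs0 (t := s + 1) (by linarith)
  linarith

theorem exists_tendsto_nhdsGT_one (h : SpectralLimit p ψ) : ∃ H : ℝ,
    Tendsto (fun s => -deriv (fun t => (ψ t).toReal) s) (𝓝[>] 1) (𝓝 H) ∧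
    ∀ s > 1, -deriv (fun t => (ψ t).toReal) s ≤ H := by
  set d := deriv (fun t => (ψ t).toReal) with hd
  have hmono : MonotoneOn d (Set.Ioi 1) := fun s hs t ht hst =>
    h.deriv_mono (Or.inr hs) (Or.inr ht) hst
  have hbdd : BddBelow (d '' Set.Ioi 1) := by
    refine ⟨d (1 / 2), ?_⟩
    rintro _ ⟨s, hs, rfl⟩
    have hs' : 1 < s := hs
    exact h.deriv_mono (Or.inl (by norm_num)) (Or.inr hs) (by linarith)
  refine ⟨-sInf (d '' Set.Ioi 1), (hmono.tendsto_nhdsGT hbdd).neg, fun s hs => ?_⟩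
  exact neg_le_neg (csInf_le hbdd ⟨s, hs, rfl⟩)

theorem exists_tendsto_nhdsLT_one (h : SpectralLimit p ψ) : ∃ H : ℝ,
    Tendsto (fun s => -deriv (fun t => (ψ t).toReal) s) (𝓝[<] 1) (𝓝 H) ∧
    ∀ s ∈ Set.Ioo (0 : ℝ) 1, H ≤ -deriv (fun t => (ψ t).toReal) s := by
  set d := deriv (fun t => (ψ t).toReal) with hd
  have hmono : MonotoneOn d (Set.Ioo 0 1) := fun s hs t ht hst =>
    h.deriv_mono (Or.inl hs) (Or.inl ht) hst
  have hbdd : BddAbove (d '' Set.Ioo 0 1) := by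
    refine ⟨0, ?_⟩
    rintro _ ⟨s, hs, rfl⟩
    exact h.deriv_nonpos (Or.inl hs)
  refine ⟨-sSup (d '' Set.Ioo 0 1),
    (hmono.tendsto_nhdsWithin_Ioo_left (by simp) hbdd).neg, fun s hs => ?_⟩
  exact neg_le_neg (le_csSup hbdd ⟨s, hs, rfl⟩)

theorem exists_tendsto_nhdsGT_zero (h : SpectralLimit p ψ) : ∃ D : EReal,
    Tendsto (fun s => ((-deriv (fun t => (ψ t).toReal) s : ℝ) : EReal)) (𝓝[>] 0) (𝓝 D) ∧
    ∀ s ∈ Set.Ioo (0 : ℝ) 1, ((-deriv (fun t => (ψ t).toReal) s : ℝ) : EReal) ≤ D := by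
  set d : ℝ → EReal := fun s => ((-deriv (fun t => (ψ t).toReal) s : ℝ) : EReal) with hd
  have hanti : AntitoneOn d (Set.Ioo 0 1) := fun s hs t ht hst => by
    simp only [hd]
    exact_mod_cast neg_le_neg (h.deriv_mono (Or.inl hs) (Or.inl ht) hst)
  refine ⟨sSup (d '' Set.Ioo 0 1),
    hanti.tendsto_nhdsWithin_Ioo_right (by simp) (OrderTop.bddAbove _), fun s hs => ?_⟩
  exact le_sSup ⟨s, hs, rfl⟩

theorem exists_tendsto_atTop (h : SpectralLimit p ψ) : ∃ H : ℝ,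
    Tendsto (fun s => -(ψ s).toReal / s) atTop (𝓝 H) ∧
    Tendsto (fun s => -deriv (fun t => (ψ t).toReal) s) atTop (𝓝 H) ∧
    ∀ s > 1, -(ψ s).toReal ≤ s * H := by
  set f : ℝ → ℝ := fun t => (ψ t).toReal with hf
  set d := deriv f with hd
  have hanti : Antitone fun s => -d (max s 2) := fun s t hst => by
    refine neg_le_neg (h.deriv_mono (Or.inr ?_) (Or.inr ?_) (max_le_max_right 2 hst))
    · exact one_lt_two.trans_le (le_max_right s 2)
    · exact one_lt_two.trans_le (le_max_right t 2)
  have hbdd : BddBelow (Set.range fun s => -d (max s 2)) := by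
    refine ⟨0, ?_⟩
    rintro _ ⟨s, rfl⟩
    exact neg_nonneg.2 (h.deriv_nonpos (Or.inr (one_lt_two.trans_le (le_max_right s 2))))
  set H := ⨅ s, -d (max s 2) with hH
  have hlim1 : Tendsto (fun s => -d s) atTop (𝓝 H) := by
    refine (tendsto_atTop_ciInf hanti hbdd).congr' ?_
    filter_upwards [eventually_ge_atTop 2] with s hs
    rw [max_eq_left hs]
  have hHle : ∀ s, 2 ≤ s → H ≤ -d s := fun s hs => by
    have := ciInf_le hbdd s
    rwa [max_eq_left hs] at this
  have hlim2 : Tendsto (fun s => -f s / s) atTop (𝓝 H) := by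
    rw [tendsto_order]
    constructor
    · intro l hl
      filter_upwards [eventually_gt_atTop ((2 * H + f 2) / (H - l)), eventually_gt_atTop 2]
        with s hs hs2
      rw [div_lt_iff₀ (by linarith)] at hs
      rw [lt_div_iff₀ (by linarith)]
      have h1 := h.tangent_le (s := s) (t := 2) (Or.inr (one_lt_two.trans hs2)) (by norm_num)
      have h2 := hHle s hs2.le
      have h3 : H * (s - 2) ≤ -d s * (s - 2) := by gcongr
      have h4 : f s + d s * (2 - s) ≤ f 2 := h1
      linarith
    · intro u hu
      obtain ⟨s₀, hs₀, hs₀2⟩ := ((hlim1.eventually (gt_mem_nhds hu)).and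
        (eventually_gt_atTop 2)).exists
      filter_upwards [eventually_gt_atTop ((-f s₀ + d s₀ * s₀) / (u + d s₀)),
        eventually_gt_atTop s₀] with s hs hs2
      rw [div_lt_iff₀ (by linarith)] at hs
      rw [div_lt_iff₀ (by linarith)]
      have h1 : f s₀ + d s₀ * (s - s₀) ≤ f s :=
        h.tangent_le (s := s₀) (t := s) (Or.inr (one_lt_two.trans hs₀2)) (by linarith)
      linarith
  refine ⟨H, hlim2, hlim1, fun s hs => ?_⟩
  have hs0 : 0 < s := by linarith
  have h1 : -f s / s ≤ H := by
    refine ge_of_tendsto hlim2 ?_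
    filter_upwards [eventually_ge_atTop s] with t ht
    have h2 : f t ≤ t / s * f s := h.toReal_le_mul hs0 ht
    have ht0 : 0 < t := by linarith
    rw [div_le_div_iff₀ hs0 ht0]
    rw [div_mul_eq_mul_div, le_div_iff₀ hs0] at h2
    linarith
  rw [div_le_iff₀ hs0] at h1
  linarith

theorem continuousAt_deriv (h : SpectralLimit p ψ) {s : ℝ}
    (hs : s ∈ Set.Ioo (0 : ℝ) 1 ∪ Set.Ioi 1) :
    ContinuousAt (deriv fun t => (ψ t).toReal) s := (h.diff s hs).2.continuousAt

/-- The Legendre type duality behind the converse for the failure exponent. -/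
theorem exists_slope_lt (h : SpectralLimit p ψ) {r R Rs : ℝ} (hr : 0 < r)
    (hRs : ∀ s > 1, (r + (ψ s).toReal) / (1 - s) ≤ Rs) (hR : Rs < R) :
    ∃ s > 1, -deriv (fun t => (ψ t).toReal) s < R ∧
      -r < (s - 1) * -deriv (fun t => (ψ t).toReal) s + (ψ s).toReal := by
  set f : ℝ → ℝ := fun t => (ψ t).toReal with hf
  set d := deriv f with hd
  have hRs' : ∀ s > 1, (1 - s) * Rs ≤ r + f s := fun s hs => by
    have := hRs s hs
    rw [div_le_iff_of_neg (by linarith)] at this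
    linarith
  obtain ⟨H, hH1, hH2, -⟩ := h.exists_tendsto_atTop
  have hHR : H ≤ Rs := by
    by_contra hcon
    push Not at hcon
    obtain ⟨m, hm1, hm2⟩ := exists_between hcon
    obtain ⟨s, ⟨hs1, hs2⟩, hs3⟩ := (((hH1.eventually (lt_mem_nhds hm2)).and
      (eventually_gt_atTop 1)).and (eventually_gt_atTop ((r - Rs) / (m - Rs)))).exists
    rw [lt_div_iff₀ (by linarith)] at hs1
    rw [div_lt_iff₀ (by linarith)] at hs3
    have h1 : m * s < -f s := hs1
    have := hRs' s hs2
    nlinarith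
  obtain ⟨s₂, hs₂, hs₂1⟩ := ((hH2.eventually (gt_mem_nhds (hHR.trans_lt hR))).and
    (eventually_gt_atTop 1)).exists
  by_cases hall : ∀ s > 1, -d s < R
  · have hcont : ContinuousAt f 1 :=
      (h.convexOn.continuousOn isOpen_Ioi).continuousAt (Ioi_mem_nhds zero_lt_one)
    have hf1 : f 1 = 0 := h.toReal_one
    have hev : ∀ᶠ s in 𝓝[>] (1 : ℝ), -r < f s := by
      have h1 : ∀ᶠ s in 𝓝 (1 : ℝ), -r < f s :=
        hcont.eventually (lt_mem_nhds (by rw [hf1]; linarith))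
      exact h1.filter_mono nhdsWithin_le_nhds
    obtain ⟨s, hs1, hs2⟩ := (hev.and self_mem_nhdsWithin).exists
    have hs2' : 1 < s := hs2
    refine ⟨s, hs2, hall s hs2, ?_⟩
    have h1 := h.deriv_nonpos (s := s) (Or.inr hs2)
    have h2 : 0 ≤ (s - 1) * -d s := mul_nonneg (by linarith) (by simpa using h1)
    linarith
  · push Not at hall
    obtain ⟨s₁, hs₁1, hs₁⟩ := hall
    obtain ⟨y, hy1, hy2⟩ : ∃ y, max Rs (-d s₂) < y ∧ y < R := exists_between (max_lt hR hs₂)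
    have hle : s₁ ≤ s₂ := by
      by_contra hcon
      push Not at hcon
      have := h.deriv_mono (Or.inr hs₂1) (Or.inr hs₁1) hcon.le
      have h3 : d s₂ ≤ d s₁ := this
      linarith
    have hcont : ContinuousOn (fun s => -d s) (Set.Icc s₁ s₂) := fun s hs =>
      ((h.continuousAt_deriv (Or.inr (lt_of_lt_of_le hs₁1 hs.1))).neg).continuousWithinAt
    obtain ⟨s, hs, hsy⟩ := intermediate_value_Icc' hle hcont
      (⟨(le_max_right _ _).trans hy1.le, hy2.le.trans hs₁⟩ : y ∈ Set.Icc (-d s₂) (-d s₁))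
    have hs1 : 1 < s := lt_of_lt_of_le hs₁1 hs.1
    have hsy' : -d s = y := hsy
    refine ⟨s, hs1, by rw [hsy']; exact hy2, ?_⟩
    have h1 := hRs' s hs1
    have h2 : Rs < y := (le_max_left _ _).trans_lt hy1
    rw [hsy']
    change -r < (s - 1) * y + f s
    nlinarith [mul_pos (sub_pos.2 hs1) (sub_pos.2 h2)]

section StrongConverse

/-- The numerator of the derivative of `s ↦ (s r + ψ s) / (1 - s)`. -/
theorem hasDerivAt_strong (h : SpectralLimit p ψ) (r : ℝ) {s : ℝ} (hs : s ∈ Set.Ioo (0 : ℝ) 1) :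
    HasDerivAt (fun s => (s * r + (ψ s).toReal) / (1 - s))
      ((r + (ψ s).toReal + (1 - s) * deriv (fun t => (ψ t).toReal) s) / (1 - s) ^ 2) s := by
  have h1 : (1 - s) ≠ 0 := by linarith [hs.2]
  have h2 := ((hasDerivAt_id s).mul_const r).add (h.diff s (Or.inl hs)).1.hasDerivAt
  have h3 := (hasDerivAt_id s).const_sub 1
  refine (h2.div h3 h1).congr_deriv ?_
  simp only [id, Pi.add_apply]
  ring

theorem numerator_mono (h : SpectralLimit p ψ) (r : ℝ) {s t : ℝ} (hs : s ∈ Set.Ioo (0 : ℝ) 1)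
    (ht : t ∈ Set.Ioo (0 : ℝ) 1) (hst : s ≤ t) :
    r + (ψ s).toReal + (1 - s) * deriv (fun t => (ψ t).toReal) s ≤
      r + (ψ t).toReal + (1 - t) * deriv (fun t => (ψ t).toReal) t := by
  have h1 := h.tangent_le (Or.inl hs) ht.1
  have h2 := h.deriv_mono (Or.inl hs) (Or.inl ht) hst
  nlinarith [mul_le_mul_of_nonneg_left h2 (sub_nonneg.2 ht.2.le)]

theorem strong_antitone (h : SpectralLimit p ψ) (r : ℝ) {t : ℝ} (ht : t ∈ Set.Ioo (0 : ℝ) 1)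
    (hN : r + (ψ t).toReal + (1 - t) * deriv (fun t => (ψ t).toReal) t ≤ 0) {s : ℝ}
    (hs : 0 < s) (hst : s ≤ t) :
    (t * r + (ψ t).toReal) / (1 - t) ≤ (s * r + (ψ s).toReal) / (1 - s) := by
  have hmem : ∀ x ∈ Set.Icc s t, x ∈ Set.Ioo (0 : ℝ) 1 := fun x hx =>
    ⟨hs.trans_le hx.1, hx.2.trans_lt ht.2⟩
  refine antitoneOn_of_deriv_nonpos (convex_Icc s t)
    (fun x hx => (h.hasDerivAt_strong r (hmem x hx)).continuousAt.continuousWithinAt)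
    (fun x hx => ?_) (fun x hx => ?_) (Set.left_mem_Icc.2 hst) (Set.right_mem_Icc.2 hst) hst
  · rw [interior_Icc] at hx
    exact (h.hasDerivAt_strong r
      (hmem x (Set.Ioo_subset_Icc_self hx))).differentiableAt.differentiableWithinAt
  · rw [interior_Icc] at hx
    have hx' := hmem x (Set.Ioo_subset_Icc_self hx)
    rw [(h.hasDerivAt_strong r hx').deriv]
    exact div_nonpos_of_nonpos_of_nonneg ((h.numerator_mono r hx' ht hx.2.le).trans hN)
      (sq_nonneg _)

theorem strong_monotone (h : SpectralLimit p ψ) (r : ℝ) {t : ℝ} (ht : t ∈ Set.Ioo (0 : ℝ) 1)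
    (hN : 0 ≤ r + (ψ t).toReal + (1 - t) * deriv (fun t => (ψ t).toReal) t) {s : ℝ}
    (hs : s < 1) (hst : t ≤ s) :
    (t * r + (ψ t).toReal) / (1 - t) ≤ (s * r + (ψ s).toReal) / (1 - s) := by
  have hmem : ∀ x ∈ Set.Icc t s, x ∈ Set.Ioo (0 : ℝ) 1 := fun x hx =>
    ⟨ht.1.trans_le hx.1, hx.2.trans_lt hs⟩
  refine monotoneOn_of_deriv_nonneg (convex_Icc t s)
    (fun x hx => (h.hasDerivAt_strong r (hmem x hx)).continuousAt.continuousWithinAt)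
    (fun x hx => ?_) (fun x hx => ?_) (Set.left_mem_Icc.2 hst) (Set.right_mem_Icc.2 hst) hst
  · rw [interior_Icc] at hx
    exact (h.hasDerivAt_strong r
      (hmem x (Set.Ioo_subset_Icc_self hx))).differentiableAt.differentiableWithinAt
  · rw [interior_Icc] at hx
    have hx' := hmem x (Set.Ioo_subset_Icc_self hx)
    rw [(h.hasDerivAt_strong r hx').deriv]
    exact div_nonneg (hN.trans (h.numerator_mono r ht hx' hx.1.le)) (sq_nonneg _)

theorem exists_numerator_pos (h : SpectralLimit p ψ) {r : ℝ} (hr : 0 < r) :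
    ∃ s ∈ Set.Ioo (0 : ℝ) 1,
      0 < r + (ψ s).toReal + (1 - s) * deriv (fun t => (ψ t).toReal) s := by
  set d := deriv (fun t => (ψ t).toReal) with hd
  have hb : ∃ s, max (1 / 2) (1 + r / (d (1 / 2) - 1)) < s ∧ s < 1 := by
    refine exists_between (max_lt (by norm_num) ?_)
    have h1 : d (1 / 2) ≤ 0 := h.deriv_nonpos (Or.inl (by norm_num))
    have : r / (d (1 / 2) - 1) < 0 := div_neg_of_pos_of_neg hr (by linarith)
    linarith
  obtain ⟨s, hs1, hs2⟩ := hb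
  have hs3 : 1 / 2 < s := (le_max_left _ _).trans_lt hs1
  have hs4 := (le_max_right _ _).trans_lt hs1
  have h1 : d (1 / 2) ≤ 0 := h.deriv_nonpos (Or.inl (by norm_num))
  refine ⟨s, ⟨by linarith, hs2⟩, ?_⟩
  have h2 : d (1 / 2) ≤ d s :=
    h.deriv_mono (Or.inl (by norm_num)) (Or.inl ⟨by linarith, hs2⟩) hs3.le
  have h3 : 0 ≤ (ψ s).toReal := by
    rw [← h.toReal_one]; exact h.toReal_antitone (by linarith) hs2.le
  have h4 : r / (d (1 / 2) - 1) < s - 1 := by linarith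
  rw [div_lt_iff_of_neg (by linarith)] at h4
  have h5 : (1 - s) * d (1 / 2) ≤ (1 - s) * d s := by
    apply mul_le_mul_of_nonneg_left h2; linarith
  nlinarith

/-- Either the infimum of `(s r + ψ s) / (1 - s)` over `(0, 1)` is attained at a critical point, or
the function is increasing. -/
theorem numerator_dichotomy (h : SpectralLimit p ψ) {r : ℝ} (hr : 0 < r) :
    (∃ s ∈ Set.Ioo (0 : ℝ) 1,
      r + (ψ s).toReal + (1 - s) * deriv (fun t => (ψ t).toReal) s = 0) ∨
    ∀ s ∈ Set.Ioo (0 : ℝ) 1,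
      0 < r + (ψ s).toReal + (1 - s) * deriv (fun t => (ψ t).toReal) s := by
  by_cases hall : ∀ s ∈ Set.Ioo (0 : ℝ) 1,
      0 < r + (ψ s).toReal + (1 - s) * deriv (fun t => (ψ t).toReal) s
  · exact Or.inr hall
  left
  push Not at hall
  obtain ⟨s, hs, hsN⟩ := hall
  obtain ⟨t, ht, htN⟩ := h.exists_numerator_pos hr
  have hst : s ≤ t := by
    by_contra hcon
    push Not at hcon
    linarith [h.numerator_mono r ht hs hcon.le]
  have hcont : ContinuousOn (fun s => r + (ψ s).toReal +
      (1 - s) * deriv (fun t => (ψ t).toReal) s) (Set.Icc s t) := by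
    intro x hx
    have hx' : x ∈ Set.Ioo (0 : ℝ) 1 := ⟨hs.1.trans_le hx.1, hx.2.trans_lt ht.2⟩
    have h1 := (h.diff x (Or.inl hx')).1.continuousAt
    have h2 := h.continuousAt_deriv (Or.inl hx')
    exact ((continuousAt_const.add h1).add
      ((continuousAt_const.sub continuousAt_id).mul h2)).continuousWithinAt
  obtain ⟨x, hx, hx0⟩ := intermediate_value_Icc hst hcont (⟨hsN, htN.le⟩ : (0 : ℝ) ∈ Set.Icc _ _)
  exact ⟨x, ⟨hs.1.trans_le hx.1, hx.2.trans_lt ht.2⟩, hx0⟩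

theorem strongFun_eq (h : SpectralLimit p ψ) (r : ℝ) {s : ℝ} (hs : 0 < s) :
    strongFun ψ r s = (((s * r + (ψ s).toReal) / (1 - s) : ℝ) : EReal) := by
  rw [strongFun, ← h.coe_toReal hs, ← EReal.coe_add, ← EReal.coe_div, EReal.toReal_coe]

theorem strongFun_zero (ψ : ℝ → EReal) (r : ℝ) : strongFun ψ r 0 = ψ 0 := by
  simp [strongFun]

/-- A lower bound near `0` is also a lower bound at `0`. -/
theorem le_apply_zero (h : SpectralLimit p ψ) (r c : ℝ) {t : ℝ} (ht : 0 < t)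
    (hc : ∀ s, 0 < s → s ≤ t → c ≤ (s * r + (ψ s).toReal) / (1 - s)) : (c : EReal) ≤ ψ 0 := by
  by_contra hcon
  push Not at hcon
  obtain ⟨x, hx1, hx2⟩ := EReal.lt_iff_exists_real_btwn.1 hcon
  have hx2' : x < c := by exact_mod_cast hx2
  have hlim : Tendsto (fun s : ℝ => (s * r + x) / (1 - s)) (𝓝[>] 0) (𝓝 x) := by
    have : ContinuousAt (fun s : ℝ => (s * r + x) / (1 - s)) 0 := by
      refine ContinuousAt.div (by fun_prop) (by fun_prop) (by norm_num)
    have h2 := this.tendsto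
    simp only [zero_mul, zero_add, sub_zero, div_one] at h2
    exact h2.mono_left nhdsWithin_le_nhds
  obtain ⟨s, ⟨hs1, hs2⟩, hs3⟩ := (((hlim.eventually (gt_mem_nhds hx2')).and
    (Ioo_mem_nhdsGT (lt_min ht one_pos))).and self_mem_nhdsWithin).exists
  have hs3' : 0 < s := hs3
  have hs1' : s < 1 := hs2.2.trans_le (min_le_right _ _)
  have h1 := hc s hs3 (hs2.2.le.trans (min_le_left _ _))
  have h2 : (ψ s).toReal ≤ x := by
    have h3 := (h.antitone le_rfl hs3'.le).trans hx1.le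
    rw [← h.coe_toReal hs3'] at h3
    exact_mod_cast h3
  have h4 : (s * r + (ψ s).toReal) / (1 - s) ≤ (s * r + x) / (1 - s) := by
    have : 0 < 1 - s := by linarith
    gcongr
  linarith

end StrongConverse

end SpectralLimit

end EntConc

namespace EntConc

section Threshold

variable {J : Type} {p : J → ℝ}

open Classical in
/-- The indices `j` with `y ≤ p j`, if there are finitely many. -/
noncomputable def upper (p : J → ℝ) (y : ℝ) : Finset J :=
  if h : {j | y ≤ p j}.Finite then h.toFinset else ∅

theorem mem_upper (hp : Summable p) {y : ℝ} (hy : 0 < y) {j : J} : j ∈ upper p y ↔ y ≤ p j := by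
  have h : {j | y ≤ p j}.Finite := by
    have h1 := hp.tendsto_cofinite_zero.eventually (gt_mem_nhds hy)
    rw [Filter.eventually_cofinite] at h1
    simpa using h1
  rw [upper, dif_pos h]
  simp

theorem sum_rpow_le_of_le {T : Finset J} {y a s : ℝ} (hy : 0 < y) (hT : ∀ j ∈ T, y ≤ p j)
    (has : a ≤ s) : ∑ j ∈ T, p j ^ a ≤ y ^ (a - s) * ∑ j ∈ T, p j ^ s := by
  rw [Finset.mul_sum]
  refine Finset.sum_le_sum fun j hj => ?_
  have hp : 0 < p j := hy.trans_le (hT j hj)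
  have h1 : p j ^ a = p j ^ (a - s) * p j ^ s := by rw [← Real.rpow_add hp]; ring_nf
  rw [h1]
  exact mul_le_mul_of_nonneg_right (Real.rpow_le_rpow_of_nonpos hy (hT j hj) (by linarith))
    (Real.rpow_nonneg hp.le _)

theorem sum_rpow_le_of_ge {T : Finset J} {y a s : ℝ} (hp : ∀ j, 0 < p j)
    (hT : ∀ j ∈ T, p j ≤ y) (has : s ≤ a) :
    ∑ j ∈ T, p j ^ a ≤ y ^ (a - s) * ∑ j ∈ T, p j ^ s := by
  rw [Finset.mul_sum]
  refine Finset.sum_le_sum fun j hj => ?_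
  have h1 : p j ^ a = p j ^ (a - s) * p j ^ s := by rw [← Real.rpow_add (hp j)]; ring_nf
  rw [h1]
  exact mul_le_mul_of_nonneg_right (Real.rpow_le_rpow (hp j).le (hT j hj) (by linarith))
    (Real.rpow_nonneg (hp j).le _)

theorem one_sub_sum_le (hp : ∀ j, 0 < p j) (hs : HasSum p 1) (T : Finset J) {c : ℝ}
    (hc : ∀ G : Finset J, Disjoint G T → ∑ j ∈ G, p j ≤ c) : 1 - ∑ j ∈ T, p j ≤ c := by
  classical
  rw [sub_le_iff_le_add]
  refine hasSum_le_of_sum_le hs fun F => ?_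
  calc ∑ j ∈ F, p j ≤ ∑ j ∈ F \ T ∪ T, p j :=
        Finset.sum_le_sum_of_subset_of_nonneg (by simp)
          fun j _ _ => (hp j).le
    _ = ∑ j ∈ F \ T, p j + ∑ j ∈ T, p j := Finset.sum_union Finset.sdiff_disjoint
    _ ≤ c + ∑ j ∈ T, p j := by gcongr; exact hc _ Finset.sdiff_disjoint

theorem sum_le_one_sub_sum (hp : ∀ j, 0 < p j) (hs : HasSum p 1) {G T : Finset J}
    (h : Disjoint G T) : ∑ j ∈ G, p j ≤ 1 - ∑ j ∈ T, p j := by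
  classical
  have := sum_le_hasSum (G ∪ T) (fun j _ => (hp j).le) hs
  rw [Finset.sum_union h] at this
  linarith

/-- The weight of the indices with `p j < y`. -/
theorem one_sub_upper_le (hp : ∀ j, 0 < p j) (hs : HasSum p 1) {y s B : ℝ} (hy : 0 < y)
    (hs1 : s ≤ 1) (hB : ∀ F : Finset J, ∑ j ∈ F, p j ^ s ≤ B) :
    1 - ∑ j ∈ upper p y, p j ≤ y ^ (1 - s) * B := by
  refine one_sub_sum_le hp hs _ fun G hG => ?_
  have h1 := sum_rpow_le_of_ge (T := G) (y := y) (a := 1) hp (fun j hj => ?_) hs1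
  · simp only [Real.rpow_one] at h1
    refine h1.trans ?_
    gcongr
    exact hB G
  · have := Finset.disjoint_left.1 hG hj
    rw [mem_upper hs.summable hy, not_le] at this
    exact this.le

theorem sum_upper_rpow_le (hs : Summable p) {y a s B : ℝ} (hy : 0 < y)
    (has : a ≤ s) (hB : ∀ F : Finset J, ∑ j ∈ F, p j ^ s ≤ B) :
    ∑ j ∈ upper p y, p j ^ a ≤ y ^ (a - s) * B := by
  refine (sum_rpow_le_of_le hy (fun j hj => (mem_upper hs hy).1 hj) has).trans ?_
  gcongr
  exact hB _

theorem sum_upper_le (hs : Summable p) {y s B : ℝ} (hy : 0 < y)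
    (h1s : 1 ≤ s) (hB : ∀ F : Finset J, ∑ j ∈ F, p j ^ s ≤ B) :
    ∑ j ∈ upper p y, p j ≤ y ^ (1 - s) * B := by
  simpa using sum_upper_rpow_le hs hy h1s hB

theorem card_upper_le (hs : Summable p) {y s B : ℝ} (hy : 0 < y)
    (h0s : 0 ≤ s) (hB : ∀ F : Finset J, ∑ j ∈ F, p j ^ s ≤ B) :
    ((upper p y).card : ℝ) ≤ y ^ (-s) * B := by
  simpa using sum_upper_rpow_le hs hy h0s hB

theorem sum_upper_sqrt_le (hs : Summable p) {y s B : ℝ} (hy : 0 < y)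
    (h0s : 1 / 2 ≤ s) (hB : ∀ F : Finset J, ∑ j ∈ F, p j ^ s ≤ B) :
    ∑ j ∈ upper p y, √(p j) ≤ y ^ (1 / 2 - s) * B := by
  simpa only [Real.sqrt_eq_rpow] using sum_upper_rpow_le hs hy h0s hB

end Threshold

section OneShot

variable {HA HB : Type u}
  [NormedAddCommGroup HA] [InnerProductSpace ℂ HA] [CompleteSpace HA]
  [NormedAddCommGroup HB] [InnerProductSpace ℂ HB] [CompleteSpace HB]
  {Φ : HTensor HA HB}

/-- Discarding the Schmidt coefficients `p j ≥ x` leaves a probabilistic protocol for a maximally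
entangled state of size about `w / x`, where `w` is the remaining weight. -/
theorem exists_threshold_pflec (hΦ : ‖Φ‖ = 1) (D : Schmidt Φ) {x η : ℝ} (hx : 0 < x)
    (hη : 0 < η) : ∃ I : PFLEC Φ,
      ENNReal.ofReal (1 - ∑ j ∈ upper D.p x, D.p j - η) ≤ I.succProb ∧
      I.failProb ≤ ENNReal.ofReal (∑ j ∈ upper D.p x, D.p j + η) ∧
      1 - ∑ j ∈ upper D.p x, D.p j - η ≤ 2 * x * I.Ψ.size := by
  classical
  have hs := D.hasSum_p hΦ
  set T := upper D.p x with hT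
  rcases le_or_gt (1 - ∑ j ∈ T, D.p j - η) 0 with h0 | h0
  · have hne : Nonempty D.J := by
      by_contra hcon
      rw [not_nonempty_iff] at hcon
      exact one_ne_zero (hs.unique hasSum_empty)
    obtain ⟨j⟩ := hne
    obtain ⟨I, hI1, hI2⟩ := exists_pflec D (L := 1) one_pos {j} (by simp) (by simp)
    refine ⟨I, ?_, ?_, h0.trans (by positivity)⟩
    · rw [ENNReal.ofReal_of_nonpos h0]; exact zero_le
    · have h1 : I.failProb ≤ 1 := by
        rw [← I.succProb_add_failProb hΦ]; exact le_add_self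
      refine h1.trans ?_
      rw [← ENNReal.ofReal_one]
      exact ENNReal.ofReal_le_ofReal (by linarith)
  · obtain ⟨F, hF⟩ : ∃ F : Finset D.J, 1 - η < ∑ j ∈ F, D.p j :=
      (hs.eventually (lt_mem_nhds (by linarith))).exists
    set G := F \ T with hG
    set W := ∑ j ∈ G, D.p j with hW
    have hWF : ∑ j ∈ F, D.p j ≤ W + ∑ j ∈ T, D.p j := by
      rw [hW, hG, ← Finset.sum_union Finset.sdiff_disjoint]
      exact Finset.sum_le_sum_of_subset_of_nonneg (by simp) fun j _ _ => (D.p_pos j).le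
    have hW0 : 0 < W := by linarith
    have hGne : G.Nonempty := by
      by_contra hcon
      rw [Finset.not_nonempty_iff_eq_empty] at hcon
      rw [hW, hcon, Finset.sum_empty] at hW0
      exact lt_irrefl _ hW0
    have hGx : ∀ j ∈ G, D.p j ≤ x := fun j hj => by
      have h1 := (Finset.mem_sdiff.1 hj).2
      rw [hT, mem_upper hs.summable hx, not_le] at h1
      exact h1.le
    have hL : ∀ i ∈ G, ((max 1 ⌊W / x⌋₊ : ℕ) : ℝ) * D.p i ≤ W := fun i hi => by
      rcases le_total ⌊W / x⌋₊ 1 with h1 | h1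
      · rw [max_eq_left h1, Nat.cast_one, one_mul]
        exact Finset.single_le_sum (f := D.p) (fun j _ => (D.p_pos j).le) hi
      · rw [max_eq_right h1]
        calc (⌊W / x⌋₊ : ℝ) * D.p i ≤ (W / x) * x := by
              gcongr
              · exact (D.p_pos i).le
              · exact Nat.floor_le (by positivity)
              · exact hGx i hi
          _ = W := by field_simp
    obtain ⟨I, hI1, hI2⟩ := exists_pflec D (L := max 1 ⌊W / x⌋₊) (by positivity) G hGne hL
    have hWw : 1 - ∑ j ∈ T, D.p j - η ≤ W := by linarith
    refine ⟨I, ?_, ?_, ?_⟩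
    · rw [hI2]; exact ENNReal.ofReal_le_ofReal hWw
    · have h1 := I.succProb_add_failProb hΦ
      have h2 : I.failProb = 1 - I.succProb :=
        ENNReal.eq_sub_of_add_eq I.succProb_ne_top (by rw [add_comm]; exact h1)
      rw [h2, hI2, ← ENNReal.ofReal_one, ← ENNReal.ofReal_sub _ hW0.le]
      exact ENNReal.ofReal_le_ofReal (by linarith)
    · refine hWw.trans ?_
      rw [hI1]
      have h1 : W / x < ⌊W / x⌋₊ + 1 := Nat.lt_floor_add_one _
      have h2 : ((⌊W / x⌋₊ : ℕ) : ℝ) ≤ (max 1 ⌊W / x⌋₊ : ℕ) := by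
        exact_mod_cast le_max_right _ _
      have h3 : (1 : ℝ) ≤ (max 1 ⌊W / x⌋₊ : ℕ) := by exact_mod_cast le_max_left _ _
      have h4 : W = x * (W / x) := by field_simp
      nlinarith

theorem exists_threshold_pflec_half (hΦ : ‖Φ‖ = 1) (D : Schmidt Φ) {x : ℝ} (hx : 0 < x) :
    ∃ I : PFLEC Φ,
      ENNReal.ofReal ((1 - ∑ j ∈ upper D.p x, D.p j) / 2) ≤ I.succProb ∧
      1 - ∑ j ∈ upper D.p x, D.p j ≤ 4 * x * I.Ψ.size := by
  rcases le_or_gt (1 - ∑ j ∈ upper D.p x, D.p j) 0 with h0 | h0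
  · obtain ⟨I, -, -, -⟩ := exists_threshold_pflec hΦ D hx one_pos
    refine ⟨I, ?_, h0.trans (by positivity)⟩
    rw [ENNReal.ofReal_of_nonpos (by linarith)]
    exact zero_le
  · obtain ⟨I, hI, -, hI3⟩ := exists_threshold_pflec hΦ D hx (half_pos h0)
    refine ⟨I, ?_, by linarith⟩
    rwa [sub_half] at hI

theorem DFLEC.sqrt_fidelity_le_upper (P : DFLEC HA HB) (hΦ : ‖Φ‖ = 1) (D : Schmidt Φ) {m : ℝ}
    (hm : 0 < m) : √(P.fidelity Φ) ≤ √(1 - ∑ j ∈ upper D.p (m / P.Ψ.size), D.p j) +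
      (∑ j ∈ upper D.p (m / P.Ψ.size), D.p j) / √m := by
  have hL : (0 : ℝ) < P.Ψ.size := by exact_mod_cast P.Ψ.size_pos
  refine (P.sqrt_fidelity_le hΦ D (upper D.p (m / P.Ψ.size))).trans (add_le_add le_rfl ?_)
  rw [Finset.sum_div, Finset.sum_div]
  refine Finset.sum_le_sum fun j hj => ?_
  have h1 := (mem_upper (D.hasSum_p hΦ).summable (div_pos hm hL)).1 hj
  rw [div_le_iff₀ hL] at h1
  rw [div_le_div_iff₀ (Real.sqrt_pos.2 hL) (Real.sqrt_pos.2 hm), ← Real.sqrt_mul (D.p_pos j).le]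
  calc √(D.p j * m) ≤ √(D.p j ^ 2 * P.Ψ.size) := by
        refine Real.sqrt_le_sqrt ?_
        nlinarith [D.p_pos j]
    _ = D.p j * √(P.Ψ.size) := by
        rw [Real.sqrt_mul (sq_nonneg _), Real.sqrt_sq (D.p_pos j).le]

theorem DFLEC.sum_upper_le (P : DFLEC HA HB) (hΦ : ‖Φ‖ = 1) (D : Schmidt Φ) :
    (∑ j ∈ upper D.p (16 / P.Ψ.size), D.p j) / 4 ≤ 1 - P.fidelity Φ := by
  have h1 := P.sqrt_fidelity_le_upper hΦ D (m := 16) (by norm_num)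
  set t := ∑ j ∈ upper D.p (16 / P.Ψ.size), D.p j with ht
  have ht1 : t ≤ 1 := D.sum_le_one hΦ _
  have ht0 : 0 ≤ t := Finset.sum_nonneg fun j _ => (D.p_pos j).le
  have h16 : √(16 : ℝ) = 4 := by
    rw [show (16 : ℝ) = 4 ^ 2 by norm_num]; exact Real.sqrt_sq (by norm_num)
  rw [h16] at h1
  have h2 : √(1 - t) ≤ 1 - t / 2 := by
    rw [Real.sqrt_le_left (by linarith)]
    nlinarith
  have h3 : √(P.fidelity Φ) ≤ 1 - t / 4 := by linarith
  have h4 : P.fidelity Φ ≤ (1 - t / 4) ^ 2 := by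
    rwa [Real.sqrt_le_left (by linarith)] at h3
  nlinarith

end OneShot

end EntConc

namespace EntConc

theorem exp_neg_rpow (n Y a : ℝ) : Real.exp (-(n * Y)) ^ a = Real.exp (-(n * (Y * a))) := by
  rw [← Real.exp_mul]; ring_nf

theorem eventually_mul_exp_le (K : ℝ) {a b : ℝ} (hab : a < b) :
    ∀ᶠ n : ℕ in atTop, K * Real.exp (n * a) ≤ Real.exp (n * b) := by
  filter_upwards [eventually_const_le_exp K (sub_pos.2 hab)] with n hn
  calc K * Real.exp (n * a) ≤ Real.exp (n * (b - a)) * Real.exp (n * a) := by gcongr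
    _ = Real.exp (n * b) := by rw [← Real.exp_add]; ring_nf

theorem eventually_mul_exp_lt (K : ℝ) {a b : ℝ} (hab : a < b) :
    ∀ᶠ n : ℕ in atTop, K * Real.exp (n * a) < Real.exp (n * b) := by
  filter_upwards [eventually_mul_exp_le (K + 1) hab] with n hn
  have := Real.exp_pos (n * a)
  linarith

theorem le_of_forall_real_lt_le {x y : EReal} (h : ∀ c : ℝ, (c : EReal) < x → (c : EReal) ≤ y) :
    x ≤ y := by
  refine le_of_forall_lt fun z hz => ?_
  obtain ⟨c, hc1, hc2⟩ := EReal.lt_iff_exists_real_btwn.1 hz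
  exact hc1.trans_le (h c hc2)

/-- Upper bounds on rates may be checked on exponential lower bounds for the size. -/
theorem rate_le {L : ℕ → ℕ} (hL : ∀ n, 0 < L n) {x : EReal}
    (h : ∀ R : ℝ, x < R → ¬ ∀ᶠ n : ℕ in atTop, Real.exp (n * R) ≤ L n) : rate L ≤ x := by
  by_contra hcon
  push Not at hcon
  obtain ⟨R, hR1, hR2⟩ := EReal.lt_iff_exists_real_btwn.1 hcon
  exact h R hR1 (eventually_exp_le_of_lt_rate hL hR2)

section Rates

variable {HA HB : ℕ → Type u}
  [∀ n, NormedAddCommGroup (HA n)] [∀ n, InnerProductSpace ℂ (HA n)] [∀ n, CompleteSpace (HA n)]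
  [∀ n, NormedAddCommGroup (HB n)] [∀ n, InnerProductSpace ℂ (HB n)] [∀ n, CompleteSpace (HB n)]
  {Φ : ∀ n, HTensor (HA n) (HB n)} {ψ : ℝ → EReal}

theorem BP_le_BD (hΦ : ∀ n, ‖Φ n‖ = 1) {ε : ℝ} (hε : 0 ≤ ε) : BP Φ ε ≤ BD Φ ε := by
  refine sSup_le_sSup ?_
  rintro R ⟨I, rfl, hI⟩
  refine ⟨fun n => (I n).toDFLEC, rfl, ?_⟩
  refine le_of_forall_sub_le fun δ hδ => ?_
  have h1 : limsup (fun n => (I n).failProb) atTop < ENNReal.ofReal (ε + δ) :=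
    hI.trans_lt ((ENNReal.ofReal_lt_ofReal_iff (by linarith)).2 (by linarith))
  refine le_liminf_of_le (by isBoundedDefault) ?_
  filter_upwards [eventually_lt_of_limsup_lt h1] with n hn
  have h2 := ((I n).ofReal_one_sub_fidelity_le (hΦ n)).trans hn.le
  rw [ENNReal.ofReal_le_ofReal_iff (by linarith)] at h2
  rw [EReal.coe_le_coe_iff]
  linarith

theorem BeP_le_BeD (hΦ : ∀ n, ‖Φ n‖ = 1) (r : ℝ) : BeP Φ r ≤ BeD Φ r := by
  refine sSup_le_sSup ?_
  rintro R ⟨I, rfl, hI⟩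
  refine ⟨fun n => (I n).toDFLEC, rfl, ?_⟩
  rw [le_liminf_exponent_iff] at hI ⊢
  intro ε hε
  filter_upwards [hI ε hε] with n hn
  exact ((I n).ofReal_one_sub_fidelity_le (hΦ n)).trans hn

theorem BePstar_le_BeDstar (r : ℝ) : BePstar Φ r ≤ BeDstar Φ r := by
  refine sSup_le_sSup ?_
  rintro R ⟨I, rfl, hI⟩
  refine ⟨fun n => (I n).toDFLEC, rfl, ?_⟩
  rw [limsup_exponent_le_iff] at hI ⊢
  intro ε hε
  filter_upwards [hI ε hε] with n hn
  refine hn.trans ?_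
  rw [← ENNReal.ofReal_toReal (I n).succProb_ne_top]
  exact ENNReal.ofReal_le_ofReal (I n).succProb_le_fidelity

/-- Achievability for the failure exponent. -/
theorem SpectralLimit.exists_pflec_failProb_le (hΦ : ∀ n, ‖Φ n‖ = 1) (D : ∀ n, Schmidt (Φ n))
    (h : SpectralLimit (fun n => (D n).p) ψ) {r R s : ℝ} (hr : 0 < r) (hs : 1 < s)
    (hR : (ψ s).toReal + (s - 1) * R < -r) :
    ∃ I : ∀ n, PFLEC (Φ n), (R : EReal) ≤ rate (fun n => (I n).Ψ.size) ∧
      ∀ᶠ n : ℕ in atTop, (I n).failProb ≤ ENNReal.ofReal (2 * Real.exp (-(n * r))) := by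
  choose I hI1 hI2 hI3 using fun n : ℕ => exists_threshold_pflec (hΦ n) (D n)
    (Real.exp_pos (-(n * R))) (Real.exp_pos (-(n * r)))
  have hsum : ∀ᶠ n : ℕ in atTop,
      ∑ j ∈ upper (D n).p (Real.exp (-(n * R))), (D n).p j ≤ Real.exp (-(n * r)) := by
    have hc : (ψ s).toReal < -r - (s - 1) * R := by linarith
    filter_upwards [h.eventually_sum_le_real (zero_lt_one.trans hs) hc] with n hn
    have h1 := sum_upper_le (h.hasSum n).summable (Real.exp_pos (-(n * R))) hs.le hn
    refine h1.trans (le_of_eq ?_)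
    rw [exp_neg_rpow, ← Real.exp_add]
    ring_nf
  refine ⟨I, le_rate fun ε hε => ?_, ?_⟩
  · filter_upwards [hsum, eventually_const_le_exp 4 hr, eventually_const_le_exp 4 hε]
      with n hn h4 h4'
    have h1 := hI3 n
    have h2 : Real.exp (-(n * r)) ≤ 1 / 4 := by
      rw [Real.exp_neg, inv_le_comm₀ (Real.exp_pos _) (by norm_num)]
      simpa using h4
    have h3 : 1 / 2 ≤ 2 * Real.exp (-(n * R)) * (I n).Ψ.size := by linarith
    have h5 : Real.exp (n * (R - ε)) = Real.exp (n * R) / Real.exp (n * ε) := by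
      rw [← Real.exp_sub]; ring_nf
    rw [h5, div_le_iff₀ (Real.exp_pos _)]
    rw [Real.exp_neg] at h3
    have h6 := Real.exp_pos (n * R)
    have h7 : Real.exp (n * R) ≤ 4 * (I n).Ψ.size := by
      field_simp at h3
      linarith
    nlinarith [(Nat.cast_nonneg (I n).Ψ.size : (0 : ℝ) ≤ _)]
  · filter_upwards [hsum] with n hn
    refine (hI2 n).trans (ENNReal.ofReal_le_ofReal ?_)
    linarith

theorem SpectralLimit.le_BeP (hΦ : ∀ n, ‖Φ n‖ = 1) (D : ∀ n, Schmidt (Φ n))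
    (h : SpectralLimit (fun n => (D n).p) ψ) {r R s : ℝ} (hr : 0 < r) (hs : 1 < s)
    (hR : (ψ s).toReal + (s - 1) * R < -r) : (R : EReal) ≤ BeP Φ r := by
  obtain ⟨I, hI1, hI2⟩ := h.exists_pflec_failProb_le hΦ D hr hs hR
  refine hI1.trans (le_sSup ⟨I, rfl, ?_⟩)
  rw [le_liminf_exponent_iff]
  intro ε hε
  filter_upwards [hI2, eventually_const_le_exp 2 hε] with n hn h2
  refine hn.trans (ENNReal.ofReal_le_ofReal ?_)
  calc 2 * Real.exp (-(n * r)) ≤ Real.exp (n * ε) * Real.exp (-(n * r)) := by gcongr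
    _ = Real.exp (-(n * (r - ε))) := by rw [← Real.exp_add]; ring_nf

theorem SpectralLimit.le_BP (hΦ : ∀ n, ‖Φ n‖ = 1) (D : ∀ n, Schmidt (Φ n))
    (h : SpectralLimit (fun n => (D n).p) ψ) {R s : ℝ} (hs : 1 < s)
    (hR : (ψ s).toReal + (s - 1) * R < 0) (ε : ℝ) : (R : EReal) ≤ BP Φ ε := by
  obtain ⟨r, hr1, hr2⟩ := exists_between (neg_pos.2 hR)
  obtain ⟨I, hI1, hI2⟩ := h.exists_pflec_failProb_le hΦ D (r := r) (R := R) hr1 hs (by linarith)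
  refine hI1.trans (le_sSup ⟨I, rfl, ?_⟩)
  have hlim : Tendsto (fun n : ℕ => ENNReal.ofReal (2 * Real.exp (-(n * r)))) atTop (𝓝 0) := by
    rw [← ENNReal.ofReal_zero]
    refine ENNReal.tendsto_ofReal ?_
    have h1 : Tendsto (fun n : ℕ => (n : ℝ) * r) atTop atTop :=
      tendsto_natCast_atTop_atTop.atTop_mul_const hr1
    simpa using (Real.tendsto_exp_neg_atTop_nhds_zero.comp h1).const_mul 2
  have h2 : limsup (fun n => (I n).failProb) atTop ≤ 0 := by
    rw [← hlim.limsup_eq]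
    exact limsup_le_limsup hI2
  exact h2.trans zero_le

theorem BD_le_BP (hΦ : ∀ n, ‖Φ n‖ = 1) (D : ∀ n, Schmidt (Φ n)) {ε : ℝ} (hε : 0 ≤ ε)
    (hε1 : ε < 1) : BD Φ ε ≤ BP Φ ε := by
  refine sSup_le ?_
  rintro _ ⟨P, rfl, hP⟩
  have hL : ∀ n, (0 : ℝ) < (P n).Ψ.size := fun n => by exact_mod_cast (P n).Ψ.size_pos
  have hx : ∀ n : ℕ, (0 : ℝ) < n + 1 := fun n => by positivity
  choose I _ hI2 hI3 using fun n : ℕ => exists_threshold_pflec (hΦ n) (D n)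
    (div_pos (hx n) (hL n)) (one_div_pos.2 (hx n))
  set t : ℕ → ℝ := fun n => ∑ j ∈ upper (D n).p ((n + 1) / (P n).Ψ.size), (D n).p j with ht
  have hlim1 : Tendsto (fun n : ℕ => 1 / ((n : ℝ) + 1)) atTop (𝓝 0) :=
    tendsto_one_div_add_atTop_nhds_zero_nat
  have hlim2 : Tendsto (fun n : ℕ => 2 / √((n : ℝ) + 1)) atTop (𝓝 0) := by
    have h1 : Tendsto (fun n : ℕ => √((n : ℝ) + 1)) atTop atTop :=
      Real.tendsto_sqrt_atTop.comp
        (tendsto_atTop_add_const_right _ _ tendsto_natCast_atTop_atTop)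
    exact h1.const_div_atTop 2
  have hkey : ∀ n, t n ≤ 1 - (P n).fidelity (Φ n) + 2 / √((n : ℝ) + 1) := fun n => by
    have h1 := (P n).sqrt_fidelity_le_upper (hΦ n) (D n) (hx n)
    have ht1 : t n ≤ 1 := (D n).sum_le_one (hΦ n) _
    have hF1 : (P n).fidelity (Φ n) ≤ 1 := by simpa [hΦ n] using (P n).fidelity_le (Φ n)
    have hF0 := (P n).fidelity_nonneg (Φ n)
    have ha : 0 < 1 / √((n : ℝ) + 1) := one_div_pos.2 (Real.sqrt_pos.2 (hx n))
    have h2 : √((P n).fidelity (Φ n)) ≤ √(1 - t n) + 1 / √((n : ℝ) + 1) := by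
      refine h1.trans (add_le_add le_rfl ?_)
      gcongr
    have h3 : 2 / √((n : ℝ) + 1) = 2 * (1 / √((n : ℝ) + 1)) := by ring
    rw [h3]
    set a := 1 / √((n : ℝ) + 1)
    have h4 := Real.sq_sqrt hF0
    have h5 := Real.sq_sqrt (sub_nonneg.2 ht1)
    have h6 : √((P n).fidelity (Φ n)) ≤ 1 := by rwa [Real.sqrt_le_one]
    have h7 := Real.sqrt_nonneg ((P n).fidelity (Φ n))
    have h8 := Real.sqrt_nonneg (1 - t n)
    rcases le_total (√((P n).fidelity (Φ n))) a with h9 | h9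
    · nlinarith
    · have h10 : √((P n).fidelity (Φ n)) - a ≤ √(1 - t n) := by linarith
      have h11 := mul_self_le_mul_self (sub_nonneg.2 h9) h10
      nlinarith
  have hF : ∀ δ > 0, ∀ᶠ n in atTop, 1 - ε - δ < (P n).fidelity (Φ n) := fun δ hδ => by
    have h1 : ((1 - ε - δ : ℝ) : EReal) < ((1 - ε : ℝ) : EReal) := by
      exact_mod_cast sub_lt_self _ hδ
    filter_upwards [eventually_lt_of_lt_liminf (h1.trans_le hP)] with n hn
    exact_mod_cast hn
  have htε : ∀ δ > 0, ∀ᶠ n : ℕ in atTop, t n + 1 / ((n : ℝ) + 1) ≤ ε + δ := fun δ hδ => by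
    have hδ3 : 0 < δ / 3 := by linarith
    filter_upwards [hF _ hδ3, hlim1.eventually (gt_mem_nhds hδ3),
      hlim2.eventually (gt_mem_nhds hδ3)] with n h1 h2 h3
    linarith [hkey n]
  refine le_trans ?_ (le_sSup ⟨I, rfl, ?_⟩)
  · refine le_of_forall_real_lt_le fun c hc => le_rate fun δ hδ => ?_
    set κ := (1 - ε) / 2 with hκ
    have hκ0 : 0 < κ := by rw [hκ]; linarith
    filter_upwards [htε κ hκ0, eventually_exp_le_of_lt_rate (fun n => (P n).Ψ.size_pos) hc,
      eventually_natCast_le_exp (half_pos hδ), eventually_const_le_exp (4 / κ) (half_pos hδ),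
      eventually_ge_atTop 1] with n h1 h2 h3 h4 h5
    have h6 : κ ≤ 2 * ((n + 1) / (P n).Ψ.size) * (I n).Ψ.size := by
      refine le_trans ?_ (hI3 n)
      have : κ = 1 - (ε + κ) := by rw [hκ]; ring
      change κ ≤ 1 - t n - 1 / ((n : ℝ) + 1)
      linarith
    have h7 : κ * (P n).Ψ.size ≤ 2 * (n + 1) * (I n).Ψ.size := by
      have := mul_le_mul_of_nonneg_right h6 (hL n).le
      have h8 : 2 * (((n : ℝ) + 1) / (P n).Ψ.size) * (I n).Ψ.size * (P n).Ψ.size =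
        2 * (n + 1) * (I n).Ψ.size := by field_simp [(hL n).ne']
      rwa [h8] at this
    have h5' : (1 : ℝ) ≤ n := by exact_mod_cast h5
    have h9 : Real.exp (n * (c - δ)) * (Real.exp (n * (δ / 2)) * Real.exp (n * (δ / 2))) =
        Real.exp (n * c) := by
      rw [← Real.exp_add, ← Real.exp_add]; ring_nf
    set E := Real.exp (n * (δ / 2))
    have h10 : Real.exp (n * c) ≤ (E * E) * (I n).Ψ.size := by
      have hI0 : (0 : ℝ) ≤ (I n).Ψ.size := Nat.cast_nonneg _
      calc Real.exp (n * c) ≤ (P n).Ψ.size := h2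
        _ ≤ 2 * (n + 1) * (I n).Ψ.size / κ := by rw [le_div_iff₀ hκ0]; linarith
        _ ≤ 2 * (n + n) * (I n).Ψ.size / κ := by gcongr
        _ = (n * (4 / κ)) * (I n).Ψ.size := by ring
        _ ≤ (E * E) * (I n).Ψ.size := by gcongr
    have hE : 0 < E * E := mul_pos (Real.exp_pos _) (Real.exp_pos _)
    rw [← h9, mul_comm] at h10
    exact le_of_mul_le_mul_left h10 hE
  · refine ENNReal.le_of_forall_pos_le_add fun δ hδ _ => ?_
    refine limsup_le_of_le (by isBoundedDefault) ?_
    have hδ' : (0 : ℝ) < δ := by exact_mod_cast hδ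
    filter_upwards [htε δ hδ'] with n hn
    refine (hI2 n).trans ?_
    rw [← ENNReal.ofReal_coe_nnreal, ← ENNReal.ofReal_add hε hδ'.le]
    exact ENNReal.ofReal_le_ofReal hn

end Rates

end EntConc

namespace EntConc

namespace SpectralLimit

variable {HA HB : ℕ → Type u}
  [∀ n, NormedAddCommGroup (HA n)] [∀ n, InnerProductSpace ℂ (HA n)] [∀ n, CompleteSpace (HA n)]
  [∀ n, NormedAddCommGroup (HB n)] [∀ n, InnerProductSpace ℂ (HB n)] [∀ n, CompleteSpace (HB n)]
  {Φ : ∀ n, HTensor (HA n) (HB n)} {ψ : ℝ → EReal}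

/-- The strong converse for a constant fidelity. -/
theorem BD_le (hΦ : ∀ n, ‖Φ n‖ = 1) (D : ∀ n, Schmidt (Φ n))
    (h : SpectralLimit (fun n => (D n).p) ψ) {R s ε : ℝ} (hs0 : 0 < s) (hs1 : s < 1)
    (hε : ε < 1) (hR : (ψ s).toReal < (1 - s) * R) : BD Φ ε ≤ (R : EReal) := by
  refine sSup_le ?_
  rintro _ ⟨P, rfl, hP⟩
  refine rate_le (fun n => (P n).Ψ.size_pos) fun R' hRR' hL => ?_
  have hRR : R < R' := by exact_mod_cast hRR'
  obtain ⟨c, hc1, hc2⟩ := exists_between hR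
  set κ := (1 - ε) / 2 with hκ
  have hκ0 : 0 < κ := by rw [hκ]; linarith
  have hF : ∀ᶠ n in atTop, κ < (P n).fidelity (Φ n) := by
    have h1 : ((κ : ℝ) : EReal) < ((1 - ε : ℝ) : EReal) := by
      rw [EReal.coe_lt_coe_iff, hκ]; linarith
    filter_upwards [eventually_lt_of_lt_liminf (h1.trans_le hP)] with n hn
    exact_mod_cast hn
  have hup : Tendsto (fun n : ℕ => √(Real.exp (-(n * ((1 - s) * R - c)))) +
      √(Real.exp (-(n * (R' - R))))) atTop (𝓝 0) := by
    have key : ∀ a : ℝ, 0 < a →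
        Tendsto (fun n : ℕ => √(Real.exp (-(n * a)))) atTop (𝓝 0) := fun a ha => by
      have h1 : Tendsto (fun n : ℕ => (n : ℝ) * a) atTop atTop :=
        tendsto_natCast_atTop_atTop.atTop_mul_const ha
      have h2 := (Real.tendsto_exp_neg_atTop_nhds_zero.comp h1).sqrt
      rwa [Real.sqrt_zero] at h2
    simpa using (key ((1 - s) * R - c) (by linarith)).add (key (R' - R) (by linarith))
  obtain ⟨n, ⟨⟨h1, h2⟩, h3⟩, h4⟩ := (((hF.and hL).and
    (hup.eventually (gt_mem_nhds (Real.sqrt_pos.2 hκ0)))).and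
    (h.eventually_sum_le_real hs0 hc1)).exists
  have hy := Real.exp_pos (-(n * R))
  have h5 := (P n).sqrt_fidelity_le (hΦ n) (D n) (upper (D n).p (Real.exp (-(n * R))))
  have h6 : 1 - ∑ j ∈ upper (D n).p (Real.exp (-(n * R))), (D n).p j ≤
      Real.exp (-(n * ((1 - s) * R - c))) := by
    refine (one_sub_upper_le (D n).p_pos (h.hasSum n) hy hs1.le h4).trans (le_of_eq ?_)
    rw [exp_neg_rpow, ← Real.exp_add]; ring_nf
  have h7 : (∑ j ∈ upper (D n).p (Real.exp (-(n * R))), √((D n).p j)) /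
      √((P n).Ψ.size : ℝ) ≤ √(Real.exp (-(n * (R' - R)))) := by
    have h8 := sum_upper_sqrt_le (h.hasSum n).summable hy (s := 1) (by norm_num) (B := 1)
      (fun F => by simpa using h.sum_le_one n F)
    calc _ ≤ (Real.exp (-(n * R)) ^ ((1 : ℝ) / 2 - 1) * 1) / √(Real.exp (n * R')) := by gcongr
      _ = _ := by
        rw [exp_neg_rpow, Real.sqrt_eq_rpow, Real.sqrt_eq_rpow, ← Real.exp_mul, ← Real.exp_mul,
          mul_one, ← Real.exp_sub]
        ring_nf
  have h8 := Real.sqrt_lt_sqrt hκ0.le h1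
  have h9 := Real.sqrt_le_sqrt h6
  linarith

/-- The converse for the failure exponent. -/
theorem BeD_le (hΦ : ∀ n, ‖Φ n‖ = 1) (D : ∀ n, Schmidt (Φ n))
    (h : SpectralLimit (fun n => (D n).p) ψ) {r R s : ℝ} (hs : 1 < s)
    (hR : -deriv (fun t => (ψ t).toReal) s < R)
    (hr : -r < (s - 1) * -deriv (fun t => (ψ t).toReal) s + (ψ s).toReal) :
    BeD Φ r ≤ (R : EReal) := by
  refine sSup_le ?_
  rintro _ ⟨P, rfl, hP⟩
  refine rate_le (fun n => (P n).Ψ.size_pos) fun R' hRR' hL => ?_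
  have hRR : R < R' := by exact_mod_cast hRR'
  rw [le_liminf_exponent_iff] at hP
  set v := -deriv (fun t => (ψ t).toReal) s with hv
  set g := (s - 1) * v + (ψ s).toReal + r with hg
  have hg0 : 0 < g := by rw [hg]; linarith
  have hs0 : 0 < s := by linarith
  obtain ⟨δ, hδ0, hδ⟩ : ∃ δ, 0 < δ ∧ δ < min (R - v) (g / (2 * s)) :=
    exists_between (lt_min (by linarith) (by positivity))
  have hδ1 : v + δ < R := by linarith [hδ.trans_le (min_le_left _ _)]
  have hδ2 : s * δ ≤ g / 2 := by
    have := hδ.trans_le (min_le_right _ _)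
    rw [lt_div_iff₀ (by positivity)] at this
    linarith
  obtain ⟨n, ⟨⟨⟨h1, h2⟩, h3⟩, h4⟩, h5⟩ := ((((h.eventually_window (Or.inr hs) hδ0).and hL).and
    (hP (g / 4) (by positivity))).and
    (eventually_mul_exp_le 16 (hδ1.trans hRR))).and
    (eventually_mul_exp_lt 4 (show -(r - g / 4) < -(r - g / 2) by linarith)) |>.exists
  obtain ⟨F, hF1, hF2⟩ := h1
  have hL0 : (0 : ℝ) < (P n).Ψ.size := by exact_mod_cast (P n).Ψ.size_pos
  have hsub : F ⊆ upper (D n).p (16 / (P n).Ψ.size) := fun j hj => by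
    rw [mem_upper (h.hasSum n).summable (by positivity)]
    refine le_trans ?_ (hF1 j hj).1
    rw [div_le_iff₀ hL0, Real.exp_neg, ← div_eq_inv_mul, le_div_iff₀ (Real.exp_pos _)]
    exact h4.trans h2
  have hsum : Real.exp (-(n * (r - g / 2))) ≤ ∑ j ∈ F, (D n).p j := by
    have h6 := sum_rpow_le_of_ge (T := F) (a := s) (s := 1) (D n).p_pos
      (fun j hj => (hF1 j hj).2) hs.le
    simp only [Real.rpow_one] at h6
    have h7 := hF2.trans h6
    rw [exp_neg_rpow, Real.exp_neg, ← div_eq_inv_mul, le_div_iff₀ (Real.exp_pos _),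
      ← Real.exp_add] at h7
    refine le_trans (Real.exp_le_exp.2 ?_) h7
    have hn : (0 : ℝ) ≤ n := Nat.cast_nonneg n
    have : -(r - g / 2) ≤ (ψ s).toReal - δ + (v - δ) * (s - 1) := by
      rw [hg] at hδ2 ⊢
      linarith
    nlinarith [mul_le_mul_of_nonneg_left this hn]
  have h6 := (P n).sum_upper_le (hΦ n) (D n)
  have h7 : ∑ j ∈ F, (D n).p j ≤ ∑ j ∈ upper (D n).p (16 / (P n).Ψ.size), (D n).p j :=
    Finset.sum_le_sum_of_subset_of_nonneg hsub fun j _ _ => ((D n).p_pos j).le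
  rw [ENNReal.ofReal_le_ofReal_iff (Real.exp_pos _).le] at h3
  rw [mul_neg, mul_neg] at h5
  linarith

/-- The converse for the exponent of the success probability. -/
theorem BePstar_le (hΦ : ∀ n, ‖Φ n‖ = 1) (D : ∀ n, Schmidt (Φ n))
    (h : SpectralLimit (fun n => (D n).p) ψ) {r s : ℝ} (hs0 : 0 < s) (hs1 : s < 1) :
    BePstar Φ r ≤ (((s * r + (ψ s).toReal) / (1 - s) : ℝ) : EReal) := by
  refine sSup_le ?_
  rintro _ ⟨I, rfl, hI⟩
  refine rate_le (fun n => (I n).Ψ.size_pos) fun R hR hL => ?_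
  have hR' : (s * r + (ψ s).toReal) / (1 - s) < R := by exact_mod_cast hR
  rw [div_lt_iff₀ (by linarith)] at hR'
  rw [limsup_exponent_le_iff] at hI
  set g := R * (1 - s) - (s * r + (ψ s).toReal) with hg
  have hg0 : 0 < g := by rw [hg]; linarith
  set c := (ψ s).toReal + g / 4 with hc
  set Y := (R - g / 4 - c) / s with hY
  have hYs : Y * s = R - g / 4 - c := by rw [hY]; field_simp
  have hE : r + g / 2 ≤ Y * (1 - s) - c := by
    have h1 : Y * (1 - s) - c - (r + g / 2) =
        (R - g / 4 - c - s * (R - g / 4) - s * (r + g / 2)) / s := by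
      rw [hY]; field_simp; ring
    have h2 : 0 ≤ R - g / 4 - c - s * (R - g / 4) - s * (r + g / 2) := by
      have : R - g / 4 - c - s * (R - g / 4) - s * (r + g / 2) =
        g - g / 4 - g / 4 + s * (g / 4) - s * (g / 2) := by rw [hc, hg]; ring
      rw [this]
      nlinarith
    have h3 := div_nonneg h2 hs0.le
    rw [← h1] at h3
    linarith
  obtain ⟨n, ⟨⟨⟨h1, h2⟩, h3⟩, h4⟩, h5⟩ := ((((h.eventually_sum_le_real hs0
    (show (ψ s).toReal < c by rw [hc]; linarith)).and hL).and
    (hI (g / 4) (by positivity))).and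
    (eventually_mul_exp_le 2 (show R - g / 4 < R by linarith))).and
    (eventually_mul_exp_lt 2 (show -(r + g / 2) < -(r + g / 4) by linarith)) |>.exists
  have hL0 : (0 : ℝ) < (I n).Ψ.size := by exact_mod_cast (I n).Ψ.size_pos
  have hy := Real.exp_pos (-(n * Y))
  have hcard : ((upper (D n).p (Real.exp (-(n * Y)))).card : ℝ) ≤ Real.exp (n * (R - g / 4)) := by
    refine (card_upper_le (h.hasSum n).summable hy hs0.le h1).trans (le_of_eq ?_)
    rw [exp_neg_rpow, ← Real.exp_add, mul_neg, hYs]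
    ring_nf
  have hcard' : ((upper (D n).p (Real.exp (-(n * Y)))).card : ℝ) / (I n).Ψ.size ≤ 1 / 2 := by
    rw [div_le_iff₀ hL0]; linarith
  have h6 : 1 - ∑ j ∈ upper (D n).p (Real.exp (-(n * Y))), (D n).p j ≤
      Real.exp (-(n * (r + g / 2))) := by
    refine (one_sub_upper_le (D n).p_pos (h.hasSum n) hy hs1.le h1).trans ?_
    rw [exp_neg_rpow, ← Real.exp_add]
    refine Real.exp_le_exp.2 ?_
    nlinarith [mul_le_mul_of_nonneg_left hE (Nat.cast_nonneg n : (0 : ℝ) ≤ n)]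
  have h7 := (I n).succProb_mul_le (hΦ n) (D n) (upper (D n).p (Real.exp (-(n * Y))))
  have h8 : Real.exp (-(n * (r + g / 4))) ≤ (I n).succProb.toReal := by
    rwa [← ENNReal.ofReal_le_iff_le_toReal (I n).succProb_ne_top]
  rw [mul_neg, mul_neg] at h5
  nlinarith [Real.exp_pos (-(n * (r + g / 4)))]

/-- The size of a state obtained with positive probability is at most the rank. -/
theorem BePstar_le_apply_zero (hΦ : ∀ n, ‖Φ n‖ = 1) (D : ∀ n, Schmidt (Φ n))
    (h : SpectralLimit (fun n => (D n).p) ψ) {r : ℝ} : BePstar Φ r ≤ ψ 0 := by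
  refine sSup_le ?_
  rintro _ ⟨I, rfl, hI⟩
  refine rate_le (fun n => (I n).Ψ.size_pos) fun R hR hL => ?_
  obtain ⟨c, hc1, hc2⟩ := EReal.lt_iff_exists_real_btwn.1 hR
  have hc2' : c < R := by exact_mod_cast hc2
  obtain ⟨n, ⟨h1, h2⟩, h3⟩ := (((h.eventually_sum_le le_rfl hc1).and hL).and
    (eventually_mul_exp_le 2 hc2')).exists
  have hL0 : (0 : ℝ) < (I n).Ψ.size := by exact_mod_cast (I n).Ψ.size_pos
  have hP : 0 < (I n).succProb.toReal :=
    ENNReal.toReal_pos (I n).prob_ne_zero (I n).succProb_ne_top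
  obtain ⟨G, hG⟩ := ((h.hasSum n).eventually (lt_mem_nhds
    (show 1 - (I n).succProb.toReal / 2 < 1 by linarith))).exists
  have h4 := (I n).succProb_mul_le (hΦ n) (D n) G
  have h5 : (G.card : ℝ) / (I n).Ψ.size ≤ 1 / 2 := by
    rw [div_le_iff₀ hL0]
    have := h1 G
    simp only [Real.rpow_zero, Finset.sum_const, nsmul_eq_mul, mul_one] at this
    linarith
  nlinarith

/-- The converse for the exponent of the fidelity. -/
theorem BeDstar_le (hΦ : ∀ n, ‖Φ n‖ = 1) (D : ∀ n, Schmidt (Φ n))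
    (h : SpectralLimit (fun n => (D n).p) ψ) {r s : ℝ} (hs0 : 1 / 2 ≤ s) (hs1 : s < 1) :
    BeDstar Φ r ≤ (((s * r + (ψ s).toReal) / (1 - s) : ℝ) : EReal) := by
  have hs0' : 0 < s := by linarith
  refine sSup_le ?_
  rintro _ ⟨P, rfl, hP⟩
  refine rate_le (fun n => (P n).Ψ.size_pos) fun R hR hL => ?_
  have hR' : (s * r + (ψ s).toReal) / (1 - s) < R := by exact_mod_cast hR
  rw [div_lt_iff₀ (by linarith)] at hR'
  rw [limsup_exponent_le_iff] at hP
  set g := R * (1 - s) - (s * r + (ψ s).toReal) with hg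
  have hg0 : 0 < g := by rw [hg]; linarith
  set c := (ψ s).toReal + g / 4 with hc
  set Y := (R - c) / s with hY
  have hYs : Y * s = R - c := by rw [hY]; field_simp
  have hE : r + g / 2 ≤ Y * (1 - s) - c := by
    have h1 : Y * (1 - s) - c - (r + g / 2) = (R - c - s * R - s * (r + g / 2)) / s := by
      rw [hY]; field_simp; ring
    have h2 : 0 ≤ R - c - s * R - s * (r + g / 2) := by
      have : R - c - s * R - s * (r + g / 2) = g - g / 4 - s * (g / 2) := by rw [hc, hg]; ring
      rw [this]
      nlinarith
    have h3 := div_nonneg h2 hs0'.le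
    rw [← h1] at h3
    linarith
  set E := Y * (1 - s) - c with hEdef
  obtain ⟨n, ⟨⟨h1, h2⟩, h3⟩, h5⟩ := (((h.eventually_sum_le_real hs0'
    (show (ψ s).toReal < c by rw [hc]; linarith)).and hL).and
    (hP (g / 4) (by positivity))).and
    (eventually_mul_exp_lt 4 (show -E < -(r + g / 4) by linarith)) |>.exists
  have hy := Real.exp_pos (-(n * Y))
  have h5' := (P n).sqrt_fidelity_le (hΦ n) (D n) (upper (D n).p (Real.exp (-(n * Y))))
  have h6 : 1 - ∑ j ∈ upper (D n).p (Real.exp (-(n * Y))), (D n).p j ≤ Real.exp (-(n * E)) := by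
    refine (one_sub_upper_le (D n).p_pos (h.hasSum n) hy hs1.le h1).trans (le_of_eq ?_)
    rw [exp_neg_rpow, ← Real.exp_add, hEdef]
    ring_nf
  have h7 : (∑ j ∈ upper (D n).p (Real.exp (-(n * Y))), √((D n).p j)) /
      √((P n).Ψ.size : ℝ) ≤ √(Real.exp (-(n * E))) := by
    have h8 := sum_upper_sqrt_le (h.hasSum n).summable hy hs0 h1
    calc _ ≤ (Real.exp (-(n * Y)) ^ ((1 : ℝ) / 2 - s) * Real.exp (n * c)) /
          √(Real.exp (n * R)) := by gcongr
      _ = _ := by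
        rw [exp_neg_rpow, Real.sqrt_eq_rpow, Real.sqrt_eq_rpow, ← Real.exp_mul, ← Real.exp_mul,
          ← Real.exp_add, ← Real.exp_sub]
        congr 1
        have : R = Y * s + c := by linarith
        rw [hEdef, this]
        ring
  have h9 := Real.sqrt_le_sqrt h6
  have h10 : √((P n).fidelity (Φ n)) ≤ 2 * √(Real.exp (-(n * E))) := by linarith
  have h11 : (P n).fidelity (Φ n) ≤ 4 * Real.exp (-(n * E)) := by
    rw [Real.sqrt_le_left (by positivity), mul_pow, Real.sq_sqrt (Real.exp_pos _).le] at h10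
    linarith
  rw [ENNReal.ofReal_le_ofReal_iff ((P n).fidelity_nonneg _)] at h3
  rw [mul_neg, mul_neg] at h5
  linarith

end SpectralLimit

end EntConc

namespace EntConc

namespace SpectralLimit

variable {HA HB : ℕ → Type u}
  [∀ n, NormedAddCommGroup (HA n)] [∀ n, InnerProductSpace ℂ (HA n)] [∀ n, CompleteSpace (HA n)]
  [∀ n, NormedAddCommGroup (HB n)] [∀ n, InnerProductSpace ℂ (HB n)] [∀ n, CompleteSpace (HB n)]
  {Φ : ∀ n, HTensor (HA n) (HB n)} {ψ : ℝ → EReal}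

/-- The weight of the indices with `p j < exp (-n y)` decays at most with the exponent given by the
Legendre transform, for `y` below the slope at `s`. -/
theorem eventually_le_one_sub_upper {J : ℕ → Type} {p : ∀ n, J n → ℝ} (h : SpectralLimit p ψ)
    {s y : ℝ} (hs : s ∈ Set.Ioo (0 : ℝ) 1) (hy : y < -deriv (fun t => (ψ t).toReal) s)
    {ε : ℝ} (hε : 0 < ε) :
    ∀ᶠ n : ℕ in atTop,
      Real.exp (-(n * (-(ψ s).toReal - (1 - s) * deriv (fun t => (ψ t).toReal) s + ε))) ≤
        1 - ∑ j ∈ upper (p n) (Real.exp (-(n * y))), p n j := by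
  set d := deriv (fun t => (ψ t).toReal) s with hd
  obtain ⟨δ, hδ0, hδ⟩ : ∃ δ, 0 < δ ∧ δ < min (-d - y) (ε / 2) :=
    exists_between (lt_min (by linarith) (by positivity))
  have hδ1 : y < -d - δ := by linarith [hδ.trans_le (min_le_left _ _)]
  have hδ2 : 2 * δ ≤ ε := by linarith [hδ.trans_le (min_le_right _ _)]
  filter_upwards [h.eventually_window (Or.inl hs) hδ0, eventually_gt_atTop 0] with n hn hn0
  obtain ⟨F, hF1, hF2⟩ := hn
  have hn' : (0 : ℝ) < n := by exact_mod_cast hn0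
  have hdisj : Disjoint F (upper (p n) (Real.exp (-(n * y)))) := by
    rw [Finset.disjoint_left]
    intro j hj
    rw [mem_upper (h.hasSum n).summable (Real.exp_pos _), not_le]
    refine (hF1 j hj).2.trans_lt (Real.exp_lt_exp.2 ?_)
    nlinarith
  refine le_trans ?_ (sum_le_one_sub_sum (h.pos n) (h.hasSum n) hdisj)
  have h6 := sum_rpow_le_of_le (T := F) (a := s) (s := 1) (Real.exp_pos _)
    (fun j hj => (hF1 j hj).1) hs.2.le
  simp only [Real.rpow_one] at h6
  have h7 := hF2.trans h6
  rw [exp_neg_rpow, Real.exp_neg, ← div_eq_inv_mul, le_div_iff₀ (Real.exp_pos _),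
    ← Real.exp_add] at h7
  refine le_trans (Real.exp_le_exp.2 ?_) h7
  have h8 : 0 ≤ s * δ := mul_nonneg hs.1.le hδ0.le
  have : -(-(ψ s).toReal - (1 - s) * d + ε) ≤ (ψ s).toReal - δ + (-d + δ) * (s - 1) := by
    nlinarith
  nlinarith [mul_le_mul_of_nonneg_left this hn'.le]

/-- Achievability for the exponent of the success probability. -/
theorem le_BePstar_of_weight (hΦ : ∀ n, ‖Φ n‖ = 1) (D : ∀ n, Schmidt (Φ n)) {r r' y : ℝ}
    (hr : r' ≤ r)
    (hw : ∀ ε > 0, ∀ᶠ n : ℕ in atTop, Real.exp (-(n * (r' + ε))) ≤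
      1 - ∑ j ∈ upper (D n).p (Real.exp (-(n * y))), (D n).p j) :
    ((y - r' : ℝ) : EReal) ≤ BePstar Φ r := by
  choose I hI1 hI2 using fun n : ℕ => exists_threshold_pflec_half (hΦ n) (D n)
    (Real.exp_pos (-(n * y)))
  refine le_trans (le_rate fun ε hε => ?_) (le_sSup ⟨I, rfl, ?_⟩)
  · filter_upwards [hw (ε / 2) (half_pos hε), eventually_const_le_exp 4 (half_pos hε)]
      with n h1 h2
    have h3 := h1.trans (hI2 n)
    have h4 : Real.exp (n * (y - r' - ε)) * Real.exp (n * (ε / 2)) =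
        Real.exp (-(n * (r' + ε / 2))) / Real.exp (-(n * y)) := by
      rw [← Real.exp_add, ← Real.exp_sub]; ring_nf
    have h5 : Real.exp (-(n * (r' + ε / 2))) / Real.exp (-(n * y)) ≤ 4 * (I n).Ψ.size := by
      rw [div_le_iff₀ (Real.exp_pos _)]; linarith
    rw [← h4] at h5
    nlinarith [Real.exp_pos (n * (y - r' - ε))]
  · rw [limsup_exponent_le_iff]
    intro ε hε
    filter_upwards [hw (ε / 2) (half_pos hε), eventually_const_le_exp 2 (half_pos hε)]
      with n h1 h2
    refine le_trans (ENNReal.ofReal_le_ofReal ?_) (hI1 n)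
    have h3 : Real.exp (-(n * (r + ε))) * Real.exp (n * (ε / 2)) ≤
        Real.exp (-(n * (r' + ε / 2))) := by
      rw [← Real.exp_add]
      refine Real.exp_le_exp.2 ?_
      nlinarith [mul_le_mul_of_nonneg_left hr (Nat.cast_nonneg n : (0 : ℝ) ≤ n)]
    nlinarith [Real.exp_pos (-(n * (r + ε)))]

theorem le_BePstar (hΦ : ∀ n, ‖Φ n‖ = 1) (D : ∀ n, Schmidt (Φ n))
    (h : SpectralLimit (fun n => (D n).p) ψ) {r s : ℝ} (hs : s ∈ Set.Ioo (0 : ℝ) 1)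
    (hN : 0 ≤ r + (ψ s).toReal + (1 - s) * deriv (fun t => (ψ t).toReal) s) :
    (((ψ s).toReal - s * deriv (fun t => (ψ t).toReal) s : ℝ) : EReal) ≤ BePstar Φ r := by
  set d := deriv (fun t => (ψ t).toReal) s with hd
  refine le_of_forall_sub_le fun ε hε => ?_
  have := le_BePstar_of_weight hΦ D (r := r) (r' := -(ψ s).toReal - (1 - s) * d)
    (y := -d - ε) (by linarith)
    (fun δ hδ => h.eventually_le_one_sub_upper hs (by linarith) hδ)
  convert this using 2
  ring

theorem Hplus_le_BePstar_zero (hΦ : ∀ n, ‖Φ n‖ = 1) (D : ∀ n, Schmidt (Φ n))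
    (h : SpectralLimit (fun n => (D n).p) ψ) {H : ℝ}
    (hH : ∀ s ∈ Set.Ioo (0 : ℝ) 1, H ≤ -deriv (fun t => (ψ t).toReal) s) :
    (H : EReal) ≤ BePstar Φ 0 := by
  refine le_of_forall_sub_le fun ε hε => ?_
  have := le_BePstar_of_weight hΦ D (r := 0) (r' := 0) (y := H - ε) le_rfl (fun δ hδ => by
    obtain ⟨s, hs, hsN⟩ := h.exists_numerator_pos (half_pos hδ)
    filter_upwards [h.eventually_le_one_sub_upper hs (y := H - ε) (by linarith [hH s hs])
      (half_pos hδ)] with n hn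
    refine le_trans (Real.exp_le_exp.2 ?_) hn
    have hn0 : (0 : ℝ) ≤ n := Nat.cast_nonneg n
    rw [neg_le_neg_iff]
    refine mul_le_mul_of_nonneg_left ?_ hn0
    linarith)
  simpa using this

theorem numerator_zero_nonpos {J : ℕ → Type} {p : ∀ n, J n → ℝ} (h : SpectralLimit p ψ) {s : ℝ}
    (hs : s ∈ Set.Ioo (0 : ℝ) 1) :
    (ψ s).toReal + (1 - s) * deriv (fun t => (ψ t).toReal) s ≤ 0 := by
  have := h.tangent_le (Or.inl hs) one_pos
  rw [h.toReal_one] at this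
  linarith

theorem BePstar_eq (hΦ : ∀ n, ‖Φ n‖ = 1) (D : ∀ n, Schmidt (Φ n))
    (h : SpectralLimit (fun n => (D n).p) ψ) {r : ℝ} (hr : 0 ≤ r) :
    BePstar Φ r = ⨅ s ∈ Set.Ico (0 : ℝ) 1, strongFun ψ r s := by
  refine le_antisymm (le_iInf₂ fun s hs => ?_) ?_
  · rcases hs.1.eq_or_lt with rfl | hs0
    · rw [strongFun_zero]; exact h.BePstar_le_apply_zero hΦ D
    · rw [h.strongFun_eq r hs0]; exact h.BePstar_le hΦ D hs0 hs.2
  have hle : ∀ s ∈ Set.Ioo (0 : ℝ) 1, (⨅ s ∈ Set.Ico (0 : ℝ) 1, strongFun ψ r s) ≤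
      (((s * r + (ψ s).toReal) / (1 - s) : ℝ) : EReal) := fun s hs => by
    rw [← h.strongFun_eq r hs.1]
    exact iInf₂_le s ⟨hs.1.le, hs.2⟩
  rcases hr.eq_or_lt with rfl | hr0
  · obtain ⟨H, hH1, hH2⟩ := h.exists_tendsto_nhdsLT_one
    refine le_trans ?_ (h.Hplus_le_BePstar_zero hΦ D hH2)
    refine ge_of_tendsto (continuous_coe_real_ereal.continuousAt.tendsto.comp hH1) ?_
    filter_upwards [Ioo_mem_nhdsLT one_pos] with s hs
    refine (hle s hs).trans ?_
    have := h.numerator_zero_nonpos hs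
    rw [Function.comp, EReal.coe_le_coe_iff, div_le_iff₀ (by linarith [hs.2])]
    linarith
  · rcases h.numerator_dichotomy hr0 with ⟨s, hs, hN⟩ | hall
    · refine (hle s hs).trans (le_trans (le_of_eq ?_) (h.le_BePstar hΦ D hs hN.ge))
      rw [EReal.coe_eq_coe_iff, div_eq_iff (by linarith [hs.2])]
      set d := deriv (fun t => (ψ t).toReal) s
      have : r = -(ψ s).toReal - (1 - s) * d := by linarith
      rw [this]
      ring
    · have h1 : ∀ s ∈ Set.Ioo (0 : ℝ) 1, (((ψ s).toReal : ℝ) : EReal) ≤ BePstar Φ r :=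
        fun s hs => by
          refine le_trans ?_ (h.le_BePstar hΦ D hs (hall s hs).le)
          rw [EReal.coe_le_coe_iff]
          nlinarith [h.deriv_nonpos (Or.inl hs), hs.1]
      refine le_of_forall_real_lt_le fun c hc => ?_
      by_contra hcon
      push Not at hcon
      obtain ⟨c', hc1, hc2⟩ := EReal.lt_iff_exists_real_btwn.1 hcon
      have hc2' : c' < c := by exact_mod_cast hc2
      have hlim : Tendsto (fun s : ℝ => (s * r + c') / (1 - s)) (𝓝[>] 0) (𝓝 c') := by
        have : ContinuousAt (fun s : ℝ => (s * r + c') / (1 - s)) 0 :=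
          ContinuousAt.div (by fun_prop) (by fun_prop) (by norm_num)
        have h2 := this.tendsto
        simp only [zero_mul, zero_add, sub_zero, div_one] at h2
        exact h2.mono_left nhdsWithin_le_nhds
      obtain ⟨s, hs1, hs2⟩ := ((hlim.eventually (gt_mem_nhds hc2')).and
        (Ioo_mem_nhdsGT one_pos)).exists
      have h3 : c < (s * r + (ψ s).toReal) / (1 - s) := by
        exact_mod_cast hc.trans_le (hle s hs2)
      have h4 : (ψ s).toReal < c' := by exact_mod_cast (h1 s hs2).trans_lt hc1
      have h5 : (s * r + (ψ s).toReal) / (1 - s) ≤ (s * r + c') / (1 - s) := by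
        have : 0 < 1 - s := by linarith [hs2.2]
        gcongr
      linarith

/-- If the numerator of the derivative is nonpositive at `t`, the infimum is determined by
`[t, 1)`. -/
theorem le_iInf_strongFun {J : ℕ → Type} {p : ∀ n, J n → ℝ} (h : SpectralLimit p ψ) {r t : ℝ}
    (ht : t ∈ Set.Ioo (0 : ℝ) 1)
    (hN : r + (ψ t).toReal + (1 - t) * deriv (fun t => (ψ t).toReal) t ≤ 0) {x : EReal}
    (hx : ∀ s, t ≤ s → s < 1 → x ≤ (((s * r + (ψ s).toReal) / (1 - s) : ℝ) : EReal)) {s : ℝ}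
    (hs : s ∈ Set.Ico (0 : ℝ) 1) : x ≤ strongFun ψ r s := by
  rcases hs.1.eq_or_lt with rfl | hs0
  · rw [strongFun_zero]
    exact (hx t le_rfl ht.2).trans
      (h.le_apply_zero r _ ht.1 fun s hs0 hst => h.strong_antitone r ht hN hs0 hst)
  · rw [h.strongFun_eq r hs0]
    rcases le_total t s with hts | hts
    · exact hx s hts hs.2
    · refine (hx t le_rfl ht.2).trans ?_
      rw [EReal.coe_le_coe_iff]
      exact h.strong_antitone r ht hN hs0 hts

theorem numerator_half_nonpos {r : ℝ}
    (hr : r ≤ -(1 / 2) * deriv (fun t => (ψ t).toReal) (1 / 2) - (ψ (1 / 2)).toReal) :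
    r + (ψ (1 / 2)).toReal + (1 - 1 / 2) * deriv (fun t => (ψ t).toReal) (1 / 2) ≤ 0 := by
  linarith

theorem BeDstar_eq (hΦ : ∀ n, ‖Φ n‖ = 1) (D : ∀ n, Schmidt (Φ n))
    (h : SpectralLimit (fun n => (D n).p) ψ) {r : ℝ} (hr : 0 ≤ r)
    (hr2 : r ≤ -(1 / 2) * deriv (fun t => (ψ t).toReal) (1 / 2) - (ψ (1 / 2)).toReal) :
    BeDstar Φ r = ⨅ s ∈ Set.Ico (0 : ℝ) 1, strongFun ψ r s := by
  refine le_antisymm (le_iInf₂ fun s hs => ?_) ?_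
  · exact h.le_iInf_strongFun (t := 1 / 2) (by norm_num) (numerator_half_nonpos hr2)
      (fun s hs0 hs1 => h.BeDstar_le hΦ D hs0 hs1) hs
  · rw [← h.BePstar_eq hΦ D hr]
    exact BePstar_le_BeDstar r

/-- Achievability for the exponent of the fidelity above the critical exponent. -/
theorem le_BeDstar (D : ∀ n, Schmidt (Φ n))
    (h : SpectralLimit (fun n => (D n).p) ψ) {r R : ℝ}
    (hR1 : (ψ (1 / 2)).toReal - 1 / 2 * deriv (fun t => (ψ t).toReal) (1 / 2) < R)
    (hR2 : R < 2 * (ψ (1 / 2)).toReal + r) : (R : EReal) ≤ BeDstar Φ r := by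
  set f := (ψ (1 / 2)).toReal with hf
  set d := deriv (fun t => (ψ t).toReal) (1 / 2) with hd
  have hd0 : d ≤ 0 := h.deriv_nonpos (Or.inl (by norm_num))
  have hf0 : 0 ≤ f := by
    rw [hf, ← h.toReal_one]; exact h.toReal_antitone (by norm_num) (by norm_num)
  have hR0 : 0 ≤ R := by linarith
  obtain ⟨δ, hδ0, hδ⟩ : ∃ δ, 0 < δ ∧
      δ < min ((R - (f - 1 / 2 * d)) / 2) ((2 * f + r - R) / 3) :=
    exists_between (lt_min (by linarith) (by linarith))
  have hδ1 := hδ.trans_le (min_le_left _ _)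
  have hδ2 := hδ.trans_le (min_le_right _ _)
  set L : ℕ → ℕ := fun n => ⌈Real.exp (n * R)⌉₊ with hL
  have hLpos : ∀ n, 0 < L n := fun n => Nat.ceil_pos.2 (Real.exp_pos _)
  have hLle : ∀ n, (L n : ℝ) ≤ 2 * Real.exp (n * R) := fun n => by
    have h1 := Nat.ceil_lt_add_one (Real.exp_pos (n * R)).le
    have h2 : 1 ≤ Real.exp (n * R) := Real.one_le_exp (by positivity)
    simp only [hL]
    linarith
  have hev : ∀ᶠ n : ℕ in atTop, ∃ P : DFLEC (HA n) (HB n), P.Ψ.size = L n ∧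
      Real.exp (-(n * r)) ≤ P.fidelity (Φ n) := by
    filter_upwards [h.eventually_window (Or.inl (show (1 / 2 : ℝ) ∈ Set.Ioo 0 1 by norm_num)) hδ0,
      h.eventually_sum_le_real (s := 1 / 2) (by norm_num)
        (show (ψ (1 / 2)).toReal < f + δ by linarith),
      eventually_mul_exp_le 2 (show -r < 2 * (f - δ) - R by linarith)] with n h1 h2 h3
    obtain ⟨F, hF1, hF2⟩ := h1
    have hcard : F.card ≤ L n := by
      have h4 := sum_rpow_le_of_le (T := F) (a := 0) (s := 1 / 2) (Real.exp_pos _)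
        (fun j hj => (hF1 j hj).1) (by norm_num)
      simp only [Real.rpow_zero, Finset.sum_const, nsmul_eq_mul, mul_one] at h4
      have h5 : (F.card : ℝ) ≤ Real.exp (n * R) := by
        refine h4.trans ((mul_le_mul_of_nonneg_left (h2 F)
          (Real.rpow_nonneg (Real.exp_pos _).le _)).trans ?_)
        rw [exp_neg_rpow, ← Real.exp_add]
        refine Real.exp_le_exp.2 ?_
        have h6 : (-d + δ) / 2 + (f + δ) ≤ R := by linarith
        nlinarith [mul_le_mul_of_nonneg_left h6 (Nat.cast_nonneg n : (0 : ℝ) ≤ n)]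
      exact_mod_cast h5.trans (Nat.le_ceil _)
    obtain ⟨P, hP1, hP2⟩ := exists_dflec (D n) (hLpos n) F hcard
    refine ⟨P, hP1, le_trans ?_ hP2⟩
    have hL0 : (0 : ℝ) < L n := by exact_mod_cast hLpos n
    rw [le_div_iff₀ hL0]
    have h6 : Real.exp (n * (f - δ)) ≤ ∑ j ∈ F, √((D n).p j) := by
      simpa only [Real.sqrt_eq_rpow] using hF2
    calc Real.exp (-(n * r)) * L n ≤ Real.exp (-(n * r)) * (2 * Real.exp (n * R)) := by
          gcongr; exact hLle n
      _ = 2 * Real.exp (n * -r) * Real.exp (n * R) := by ring_nf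
      _ ≤ Real.exp (n * (2 * (f - δ) - R)) * Real.exp (n * R) := by gcongr
      _ = Real.exp (n * (f - δ)) ^ 2 := by
          rw [← Real.exp_add, ← Real.exp_nat_mul]; push_cast; ring_nf
      _ ≤ (∑ j ∈ F, √((D n).p j)) ^ 2 := by gcongr
  have hex : ∀ n, ∃ P : DFLEC (HA n) (HB n), P.Ψ.size = L n ∧
      ((∃ P : DFLEC (HA n) (HB n), P.Ψ.size = L n ∧ Real.exp (-(n * r)) ≤ P.fidelity (Φ n)) →
        Real.exp (-(n * r)) ≤ P.fidelity (Φ n)) := fun n => by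
    by_cases hP : ∃ P : DFLEC (HA n) (HB n), P.Ψ.size = L n ∧
        Real.exp (-(n * r)) ≤ P.fidelity (Φ n)
    · obtain ⟨P, hP1, hP2⟩ := hP
      exact ⟨P, hP1, fun _ => hP2⟩
    · obtain ⟨P, hP1, -⟩ := exists_dflec (D n) (hLpos n) ∅ (by simp)
      exact ⟨P, hP1, fun h => absurd h hP⟩
  choose P hP1 hP2 using hex
  refine le_trans (le_rate fun ε hε => ?_) (le_sSup ⟨P, rfl, ?_⟩)
  · refine Eventually.of_forall fun n => ?_
    rw [hP1]
    refine le_trans (Real.exp_le_exp.2 ?_) (Nat.le_ceil _)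
    nlinarith [(Nat.cast_nonneg n : (0 : ℝ) ≤ n)]
  · rw [limsup_exponent_le_iff]
    intro ε hε
    filter_upwards [hev] with n hn
    refine ENNReal.ofReal_le_ofReal (le_trans (Real.exp_le_exp.2 ?_) (hP2 n hn))
    nlinarith [(Nat.cast_nonneg n : (0 : ℝ) ≤ n)]

theorem BeDstar_eq_of_lt (hΦ : ∀ n, ‖Φ n‖ = 1) (D : ∀ n, Schmidt (Φ n))
    (h : SpectralLimit (fun n => (D n).p) ψ) {r : ℝ}
    (hr : -(1 / 2) * deriv (fun t => (ψ t).toReal) (1 / 2) - (ψ (1 / 2)).toReal < r) :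
    BeDstar Φ r = 2 * ψ (1 / 2) + (r : EReal) := by
  have h0 : (0 : ℝ) < 1 / 2 := by norm_num
  have hval : 2 * ψ (1 / 2) + (r : EReal) = ((2 * (ψ (1 / 2)).toReal + r : ℝ) : EReal) := by
    rw [EReal.coe_add, EReal.coe_mul, h.coe_toReal h0]; rfl
  rw [hval]
  refine le_antisymm ?_ ?_
  · convert h.BeDstar_le hΦ D (s := 1 / 2) (r := r) le_rfl (by norm_num) using 2
    ring
  · refine le_of_forall_real_lt_le fun c hc => ?_
    have hc' : c < 2 * (ψ (1 / 2)).toReal + r := by exact_mod_cast hc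
    obtain ⟨R, hR1, hR2⟩ : ∃ R, max c ((ψ (1 / 2)).toReal -
        1 / 2 * deriv (fun t => (ψ t).toReal) (1 / 2)) < R ∧ R < 2 * (ψ (1 / 2)).toReal + r :=
      exists_between (max_lt hc' (by linarith))
    have h1 : (c : EReal) ≤ (R : EReal) := by
      exact_mod_cast ((le_max_left _ _).trans_lt hR1).le
    exact h1.trans (h.le_BeDstar D ((le_max_right _ _).trans_lt hR1) hR2)

theorem exists_isMin_strongFun {J : ℕ → Type} {p : ∀ n, J n → ℝ} (h : SpectralLimit p ψ) {r : ℝ}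
    (hr : 0 < r)
    (hcond : ContinuousWithinAt ψ (Set.Ici 0) 0 ∨
      r ≤ -(1 / 2) * deriv (fun t => (ψ t).toReal) (1 / 2) - (ψ (1 / 2)).toReal) :
    ∃ s ∈ Set.Ico (0 : ℝ) 1, ∀ t ∈ Set.Ico (0 : ℝ) 1, strongFun ψ r s ≤ strongFun ψ r t := by
  rcases h.numerator_dichotomy hr with ⟨s, hs, hN⟩ | hall
  · refine ⟨s, ⟨hs.1.le, hs.2⟩, fun t ht => ?_⟩
    refine h.le_iInf_strongFun hs hN.le (fun u hsu hu1 => ?_) ht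
    rw [h.strongFun_eq r hs.1, EReal.coe_le_coe_iff]
    exact h.strong_monotone r hs hN.ge hu1 hsu
  · rcases hcond with hcont | hr2
    · refine ⟨0, by norm_num, fun t ht => ?_⟩
      rcases ht.1.eq_or_lt with rfl | ht0
      · exact le_rfl
      rw [strongFun_zero, h.strongFun_eq r ht0]
      refine le_of_tendsto (hcont.mono_left (nhdsWithin_mono 0 Set.Ioi_subset_Ici_self)) ?_
      filter_upwards [Ioo_mem_nhdsGT ht0] with u hu
      have hu1 : u < 1 := hu.2.trans ht.2
      rw [← h.coe_toReal hu.1, EReal.coe_le_coe_iff]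
      refine le_trans ?_ (h.strong_monotone r ⟨hu.1, hu1⟩ (hall u ⟨hu.1, hu1⟩).le ht.2 hu.2.le)
      have hf0 : 0 ≤ (ψ u).toReal := by
        rw [← h.toReal_one]; exact h.toReal_antitone hu.1 hu1.le
      rw [le_div_iff₀ (by linarith)]
      nlinarith [mul_nonneg hu.1.le hf0, mul_pos hu.1 hr]
    · exact absurd (numerator_half_nonpos hr2) (not_le.2 (hall _ (by norm_num)))

theorem BePstar_eq_apply_zero (hΦ : ∀ n, ‖Φ n‖ = 1) (D : ∀ n, Schmidt (Φ n))
    (h : SpectralLimit (fun n => (D n).p) ψ) {E : EReal}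
    (hE : ∀ s ∈ Set.Ioo (0 : ℝ) 1, ((-deriv (fun t => (ψ t).toReal) s : ℝ) : EReal) ≤ E)
    (hcont : ContinuousWithinAt ψ (Set.Ici 0) 0) (h0 : ψ 0 ≠ ⊤) {r : ℝ}
    (hr : E - ψ 0 ≤ (r : EReal)) : BePstar Φ r = ψ 0 := by
  have hbot : ψ 0 ≠ ⊥ := by
    have h1 := h.antitone le_rfl zero_le_one
    rw [h.apply_one] at h1
    exact (EReal.bot_lt_zero.trans_le h1).ne'
  set a := (ψ 0).toReal with ha
  have hψ0 : ψ 0 = (a : EReal) := (EReal.coe_toReal h0 hbot).symm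
  have hd : ∀ s ∈ Set.Ioo (0 : ℝ) 1, -deriv (fun t => (ψ t).toReal) s ≤ r + a := fun s hs => by
    have h1 : E ≤ (r : EReal) + ψ 0 :=
      (EReal.sub_le_iff_le_add (Or.inl hbot) (Or.inl h0)).1 hr
    have h2 := (hE s hs).trans h1
    rw [hψ0] at h2
    exact_mod_cast h2
  have hlim : Tendsto (fun s => (ψ s).toReal) (𝓝[>] 0) (𝓝 a) :=
    (EReal.tendsto_toReal h0 hbot).comp
      (hcont.mono_left (nhdsWithin_mono 0 Set.Ioi_subset_Ici_self))
  have hr0 : 0 ≤ r := by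
    have h1 : a ≤ r + a := by
      refine le_of_tendsto hlim ?_
      filter_upwards [Ioo_mem_nhdsGT one_pos] with s hs
      have h2 := h.numerator_zero_nonpos hs
      have h3 := hd s hs
      have h4 := h.deriv_nonpos (Or.inl hs)
      nlinarith [hs.1, hs.2]
    linarith
  refine le_antisymm (h.BePstar_le_apply_zero hΦ D) ?_
  rw [h.BePstar_eq hΦ D hr0]
  refine le_iInf₂ fun s hs => ?_
  rcases hs.1.eq_or_lt with rfl | hs0
  · rw [strongFun_zero]
  rw [h.strongFun_eq r hs0, hψ0, EReal.coe_le_coe_iff, le_div_iff₀ (by linarith [hs.2])]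
  have h1 : a - (r + a) * (s - 0) ≤ (ψ s).toReal := by
    have h2 : Tendsto (fun t => (ψ t).toReal - (r + a) * (s - t)) (𝓝[>] 0)
        (𝓝 (a - (r + a) * (s - 0))) :=
      hlim.sub ((tendsto_const_nhds.sub (tendsto_id.mono_left nhdsWithin_le_nhds)).const_mul _)
    refine le_of_tendsto h2 ?_
    filter_upwards [Ioo_mem_nhdsGT hs0] with t ht
    have ht' : t ∈ Set.Ioo (0 : ℝ) 1 := ⟨ht.1, ht.2.trans hs.2⟩
    have h3 := h.tangent_le (Or.inl ht') hs0
    have h4 := hd t ht'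
    nlinarith [ht.2]
  linarith

end SpectralLimit

end EntConc

namespace EntConc

namespace SpectralLimit

variable {HA HB : ℕ → Type u}
  [∀ n, NormedAddCommGroup (HA n)] [∀ n, InnerProductSpace ℂ (HA n)] [∀ n, CompleteSpace (HA n)]
  [∀ n, NormedAddCommGroup (HB n)] [∀ n, InnerProductSpace ℂ (HB n)] [∀ n, CompleteSpace (HB n)]
  {Φ : ∀ n, HTensor (HA n) (HB n)} {ψ : ℝ → EReal}

theorem Hminus_le_BP (hΦ : ∀ n, ‖Φ n‖ = 1) (D : ∀ n, Schmidt (Φ n))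
    (h : SpectralLimit (fun n => (D n).p) ψ) {H : ℝ}
    (hH : Tendsto (fun s => -deriv (fun t => (ψ t).toReal) s) (𝓝[>] 1) (𝓝 H)) (ε : ℝ) :
    (H : EReal) ≤ BP Φ ε := by
  refine le_of_forall_sub_le fun δ hδ => ?_
  obtain ⟨s, hs1, hs⟩ := ((hH.eventually (lt_mem_nhds (sub_lt_self H hδ))).and
    self_mem_nhdsWithin).exists
  have hs' : 1 < s := hs
  refine h.le_BP hΦ D hs' ?_ ε
  have h1 := h.tangent_le (s := s) (Or.inr hs) one_pos
  rw [h.toReal_one] at h1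
  nlinarith [mul_lt_mul_of_pos_left hs1 (sub_pos.2 hs')]

theorem BD_le_Hplus (hΦ : ∀ n, ‖Φ n‖ = 1) (D : ∀ n, Schmidt (Φ n))
    (h : SpectralLimit (fun n => (D n).p) ψ) {H : ℝ}
    (hH : Tendsto (fun s => -deriv (fun t => (ψ t).toReal) s) (𝓝[<] 1) (𝓝 H)) {ε : ℝ}
    (hε : ε < 1) : BD Φ ε ≤ (H : EReal) := by
  refine le_of_forall_le_add fun δ hδ => ?_
  obtain ⟨s, hs1, hs⟩ := ((hH.eventually (gt_mem_nhds (lt_add_of_pos_right H hδ))).and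
    (Ioo_mem_nhdsLT one_pos)).exists
  refine h.BD_le hΦ D hs.1 hs.2 hε ?_
  have h1 := h.numerator_zero_nonpos hs
  nlinarith [mul_lt_mul_of_pos_left hs1 (sub_pos.2 hs.2)]

theorem weakFun_eq {J : ℕ → Type} {p : ∀ n, J n → ℝ} (h : SpectralLimit p ψ) (r : ℝ) {s : ℝ}
    (hs : 0 < s) : ((r : EReal) + ψ s) / ((1 - s : ℝ) : EReal) =
      (((r + (ψ s).toReal) / (1 - s) : ℝ) : EReal) := by
  rw [← h.coe_toReal hs, ← EReal.coe_add, ← EReal.coe_div, EReal.toReal_coe]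

theorem iSup_le_BeP (hΦ : ∀ n, ‖Φ n‖ = 1) (D : ∀ n, Schmidt (Φ n))
    (h : SpectralLimit (fun n => (D n).p) ψ) {r : ℝ} (hr : 0 < r) :
    ⨆ s ∈ Set.Ioi (1 : ℝ), ((r : EReal) + ψ s) / ((1 - s : ℝ) : EReal) ≤ BeP Φ r := by
  refine iSup₂_le fun s hs => ?_
  have hs' : 1 < s := hs
  rw [h.weakFun_eq r (zero_lt_one.trans hs')]
  refine le_of_forall_sub_le fun δ hδ => h.le_BeP hΦ D hr hs' ?_
  have h1 : (s - 1) * ((r + (ψ s).toReal) / (1 - s)) = -(r + (ψ s).toReal) := by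
    have : 1 - s ≠ 0 := by linarith
    field_simp
    ring
  rw [mul_sub, h1]
  nlinarith

theorem BeD_le_iSup (hΦ : ∀ n, ‖Φ n‖ = 1) (D : ∀ n, Schmidt (Φ n))
    (h : SpectralLimit (fun n => (D n).p) ψ) {r : ℝ} (hr : 0 < r) :
    BeD Φ r ≤ ⨆ s ∈ Set.Ioi (1 : ℝ), ((r : EReal) + ψ s) / ((1 - s : ℝ) : EReal) := by
  refine le_of_forall_gt fun y hy => ?_
  obtain ⟨x, hx1, hx2⟩ := EReal.lt_iff_exists_real_btwn.1 hy
  obtain ⟨R, hR1, hR2⟩ := EReal.lt_iff_exists_real_btwn.1 hx2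
  refine lt_of_le_of_lt ?_ hR2
  obtain ⟨s, hs, hs1, hs2⟩ := h.exists_slope_lt hr (Rs := x) (R := R) (fun s hs => by
    have h1 := (le_iSup₂ (f := fun (s : ℝ) (_ : s ∈ Set.Ioi (1 : ℝ)) =>
      ((r : EReal) + ψ s) / ((1 - s : ℝ) : EReal)) s hs).trans hx1.le
    rw [h.weakFun_eq r (zero_lt_one.trans hs)] at h1
    exact_mod_cast h1) (by exact_mod_cast hR1)
  exact h.BeD_le hΦ D hs hs1 hs2

theorem BeD_eq_BeP (hΦ : ∀ n, ‖Φ n‖ = 1) (D : ∀ n, Schmidt (Φ n))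
    (h : SpectralLimit (fun n => (D n).p) ψ) {r : ℝ} (hr : 0 < r) : BeD Φ r = BeP Φ r :=
  le_antisymm ((h.BeD_le_iSup hΦ D hr).trans (h.iSup_le_BeP hΦ D hr)) (BeP_le_BeD hΦ r)

theorem BeP_eq (hΦ : ∀ n, ‖Φ n‖ = 1) (D : ∀ n, Schmidt (Φ n))
    (h : SpectralLimit (fun n => (D n).p) ψ) {r : ℝ} (hr : 0 < r) :
    BeP Φ r = ⨆ s ∈ Set.Ioi (1 : ℝ), ((r : EReal) + ψ s) / ((1 - s : ℝ) : EReal) :=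
  le_antisymm ((BeP_le_BeD hΦ r).trans (h.BeD_le_iSup hΦ D hr)) (h.iSup_le_BeP hΦ D hr)

theorem iSup_eq_Hinf {J : ℕ → Type} {p : ∀ n, J n → ℝ} (h : SpectralLimit p ψ) {H r : ℝ}
    (hH : Tendsto (fun s => -(ψ s).toReal / s) atTop (𝓝 H))
    (hle : ∀ s > 1, -(ψ s).toReal ≤ s * H) (hr : H ≤ r) :
    ⨆ s ∈ Set.Ioi (1 : ℝ), ((r : EReal) + ψ s) / ((1 - s : ℝ) : EReal) = (H : EReal) := by
  refine le_antisymm (iSup₂_le fun s hs => ?_) ?_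
  · have hs' : 1 < s := hs
    rw [h.weakFun_eq r (zero_lt_one.trans hs'), EReal.coe_le_coe_iff,
      div_le_iff_of_neg (by linarith)]
    linarith [hle s hs']
  · have h1 : Tendsto (fun s : ℝ => (r + (ψ s).toReal) / (1 - s)) atTop (𝓝 H) := by
      have h2 : Tendsto (fun s : ℝ => (r * s⁻¹ - (-(ψ s).toReal / s)) / (s⁻¹ - 1)) atTop
          (𝓝 ((r * 0 - H) / (0 - 1))) :=
        ((tendsto_inv_atTop_zero.const_mul r).sub hH).div
          (tendsto_inv_atTop_zero.sub_const 1) (by norm_num)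
      have h3 : (r * 0 - H) / (0 - 1) = H := by ring
      rw [h3] at h2
      refine h2.congr' ?_
      filter_upwards [eventually_gt_atTop 1] with s hs
      have hs0 : s ≠ 0 := by linarith
      have hs1 : 1 - s ≠ 0 := by linarith
      have hs2 : s⁻¹ - 1 ≠ 0 := by
        have : s⁻¹ - 1 = (1 - s) / s := by field_simp
        rw [this]
        exact div_ne_zero hs1 hs0
      rw [div_eq_div_iff hs2 hs1]
      field_simp
      ring
    refine le_of_tendsto (continuous_coe_real_ereal.continuousAt.tendsto.comp h1) ?_
    filter_upwards [eventually_gt_atTop 1] with s hs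
    rw [Function.comp, ← h.weakFun_eq r (zero_lt_one.trans hs)]
    exact le_iSup₂ (f := fun (s : ℝ) (_ : s ∈ Set.Ioi (1 : ℝ)) =>
      ((r : EReal) + ψ s) / ((1 - s : ℝ) : EReal)) s hs

end SpectralLimit

end EntConc
open EntConc in
theorem theorem3 {HA HB : ℕ → Type u}
    [∀ n, NormedAddCommGroup (HA n)] [∀ n, InnerProductSpace ℂ (HA n)]
    [∀ n, CompleteSpace (HA n)]
    [∀ n, NormedAddCommGroup (HB n)] [∀ n, InnerProductSpace ℂ (HB n)]
    [∀ n, CompleteSpace (HB n)]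
    (Φ : ∀ n, HTensor (HA n) (HB n)) (hΦ : ∀ n, ‖Φ n‖ = 1)
    -- the limit `ψ` of `ψₙ / n` exists on `[0, ∞)`; it may be `+∞` at `s = 0`
    (ψ : ℝ → EReal)
    (hlim : ∀ s : ℝ, 0 ≤ s → Tendsto (fun n : ℕ => psi Φ n s / n) atTop (𝓝 (ψ s)))
    -- `ψ` is finite and twice differentiable on `(0, 1) ∪ (1, ∞)`
    (hfin : ∀ s ∈ Set.Ioo (0 : ℝ) 1 ∪ Set.Ioi 1, ψ s ≠ ⊥ ∧ ψ s ≠ ⊤)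
    (hdiff : ∀ s ∈ Set.Ioo (0 : ℝ) 1 ∪ Set.Ioi 1,
      DifferentiableAt ℝ (fun t => (ψ t).toReal) s ∧
      DifferentiableAt ℝ (deriv fun t => (ψ t).toReal) s) :
    -- constant constraint
    (∃ Hminus Hplus : ℝ,
      Tendsto (fun s => -deriv (fun t => (ψ t).toReal) s) (𝓝[>] 1) (𝓝 Hminus) ∧
      Tendsto (fun s => -deriv (fun t => (ψ t).toReal) s) (𝓝[<] 1) (𝓝 Hplus) ∧
      ∀ ε : ℝ, 0 ≤ ε → ε < 1 →
        (Hminus : EReal) ≤ BD Φ ε ∧ BD Φ ε = BP Φ ε ∧ BP Φ ε ≤ (Hplus : EReal)) ∧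
    -- exponential constraint for the failure probability
    (∀ r : ℝ, 0 < r →
      BeD Φ r = BeP Φ r ∧
      BeP Φ r = ⨆ s ∈ Set.Ioi (1 : ℝ), ((r : EReal) + ψ s) / ((1 - s : ℝ) : EReal)) ∧
    -- exponential constraint for the success probability
    (∀ r : ℝ, 0 ≤ r → BePstar Φ r = ⨅ s ∈ Set.Ico (0 : ℝ) 1, strongFun ψ r s) ∧
    (∀ r : ℝ, 0 ≤ r →
      (r ≤ -(1 / 2) * deriv (fun t => (ψ t).toReal) (1 / 2) - (ψ (1 / 2)).toReal →
        BeDstar Φ r = ⨅ s ∈ Set.Ico (0 : ℝ) 1, strongFun ψ r s) ∧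
      (-(1 / 2) * deriv (fun t => (ψ t).toReal) (1 / 2) - (ψ (1 / 2)).toReal < r →
        BeDstar Φ r = 2 * ψ (1 / 2) + (r : EReal))) ∧
    -- the infimum is a minimum
    (∀ r : ℝ, 0 < r →
      (ContinuousWithinAt ψ (Set.Ici 0) 0 ∨
        r ≤ -(1 / 2) * deriv (fun t => (ψ t).toReal) (1 / 2) - (ψ (1 / 2)).toReal) →
      ∃ s ∈ Set.Ico (0 : ℝ) 1, ∀ t ∈ Set.Ico (0 : ℝ) 1, strongFun ψ r s ≤ strongFun ψ r t) ∧
    -- large failure exponents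
    (∃ Hinf : ℝ,
      Tendsto (fun s => -(ψ s).toReal / s) atTop (𝓝 Hinf) ∧
      Tendsto (fun s => -deriv (fun t => (ψ t).toReal) s) atTop (𝓝 Hinf) ∧
      ∀ r : ℝ, 0 < r → Hinf ≤ r → BeD Φ r = (Hinf : EReal) ∧ BeP Φ r = (Hinf : EReal)) ∧
    -- large success exponents
    (∃ D : EReal,
      Tendsto (fun s => ((-deriv (fun t => (ψ t).toReal) s : ℝ) : EReal)) (𝓝[>] 0) (𝓝 D) ∧
      (ContinuousWithinAt ψ (Set.Ici 0) 0 → ψ 0 ≠ ⊤ →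
        ∀ r : ℝ, D - ψ 0 ≤ (r : EReal) → BePstar Φ r = ψ 0)) := by
  have D : ∀ n, Schmidt (Φ n) := fun n => (exists_schmidt (Φ n)).some
  have h : SpectralLimit (fun n => (D n).p) ψ :=
    { pos := fun n => (D n).p_pos
      hasSum := fun n => (D n).hasSum_p (hΦ n)
      tendsto := fun s hs => by
        simpa only [psi, (D _).trPow_eq] using hlim s hs
      fin := hfin
      diff := hdiff }
  obtain ⟨Hm, hHm, -⟩ := h.exists_tendsto_nhdsGT_one
  obtain ⟨Hp, hHp, -⟩ := h.exists_tendsto_nhdsLT_one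
  obtain ⟨Hi, hHi1, hHi2, hHi3⟩ := h.exists_tendsto_atTop
  obtain ⟨E, hE1, hE2⟩ := h.exists_tendsto_nhdsGT_zero
  refine ⟨⟨Hm, Hp, hHm, hHp, fun ε hε0 hε1 => ?_⟩,
    fun r hr => ⟨h.BeD_eq_BeP hΦ D hr, h.BeP_eq hΦ D hr⟩,
    fun r hr => h.BePstar_eq hΦ D hr,
    fun r hr => ⟨fun hr2 => h.BeDstar_eq hΦ D hr hr2, fun hr2 => h.BeDstar_eq_of_lt hΦ D hr2⟩,
    fun r hr hcond => h.exists_isMin_strongFun hr hcond,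
    ⟨Hi, hHi1, hHi2, fun r hr hHr => ?_⟩,
    ⟨E, hE1, fun hcont h0 r hr => h.BePstar_eq_apply_zero hΦ D hE2 hcont h0 hr⟩⟩
  · have heq : BD Φ ε = BP Φ ε := le_antisymm (BD_le_BP hΦ D hε0 hε1) (BP_le_BD hΦ hε0)
    refine ⟨heq ▸ h.Hminus_le_BP hΦ D hHm ε, heq, heq ▸ h.BD_le_Hplus hΦ D hHp hε1⟩
  · rw [h.BeD_eq_BeP hΦ D hr, h.BeP_eq hΦ D hr, h.iSup_eq_Hinf hHi1 hHi3 hHr]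
    exact ⟨rfl, rfl⟩
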